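/- Let $k$ be a field and $Q=(Q_0,Q_1,s,t)$ a finite quiver; paths are composed from right to left. Let $I$ be the two-sided ideal of $kQ$ generated by a set $Z$ of paths of length two, and assume that $(Q,I)$ is gentle: at most two arrows start and at most two arrows end at each vertex; for each arrow $\alpha$ there is at most one arrow $\beta$ with $s(\beta)=t(\alpha)$ and $\beta\alpha\in I$, and at most one with $s(\beta)=t(\alpha)$ and $\beta\alpha\notin I$; and dually for each arrow $\beta$. Assume that $Q$ has no isolated vertex and that each arrow lies on an admissible cycle, i.e. on a cyclic path $\alpha_n\cdots\alpha_1$ of pairwise distinct arrows with $\alpha_{i+1}\alpha_i\notin I$ for $1\le i<n$ and $\alpha_1\alpha_n\notin I$. Then each vertex is either $2$-regular (two arrows start and two arrows end there) or a transition vertex (one arrow starts and one arrow ends there). Let $Q_0^r$ and $Q_0^t$ denote the corresponding sets of vertices, and $Q_1^t$ the set of arrows starting at transition vertices. For $\alpha\in Q_1$ let $\sigma(\alpha)$ be the unique arrow with $s(\sigma(\alpha))=t(\alpha)$ and $\sigma(\alpha)\alpha\notin I$, let $\alpha_n=\sigma^{n-1}(\alpha)\cdots\sigma(\alpha)\alpha$,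 let $\ell_\alpha\ge 1$ be minimal with $\sigma^{\ell_\alpha}(\alpha)=\alpha$, let $c_\alpha=\alpha_{\ell_\alpha}$ be the admissible cycle beginning with $\alpha$, and let $c_\alpha\partial$ be the path of length $\ell_\alpha-1$ with $(c_\alpha\partial)\,\alpha=c_\alpha$ (so $c_\alpha\partial=e_{s(\alpha)}$ if $\ell_\alpha=1$). Let $A$ be the completion of $kQ/I$ with respect to its arrow ideal, viewed as an algebra over $R=k[[c]]$ via $c\mapsto\sum_{\alpha\in Q_1}c_\alpha$. Choose signs $\varepsilon\colon Q_1\to\{-1,1\}$ with $\varepsilon_\alpha\ne\varepsilon_\beta$ for distinct arrows $\alpha,\beta$ with $s(\alpha)=s(\beta)$, and $\varepsilon_\gamma=-1$ for $\gamma\in Q_1^t$. Let $\nu\colon A\to A$ be the completion of the $k$-algebra morphism of $kQ/I$ with $e_i\mapsto e_i$ and $\alpha\mapsto\varepsilon_{\sigma(\alpha)}\varepsilon_\alpha\,\alpha$. Let $A_\nu$ be the bimodule $A$ with regular left action and right action $x\cdot_\nu a=x\,\nu(a)$, and let $A_\nu^\circ\subseteq A_\nu$ be the sub-bimodule generated by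 the idempotents $e_i$ with $i\in Q_0^r$ and the arrows $\gamma\in Q_1^t$. Let $\omega_{A/R}=\operatorname{Hom}_R(A,R)$, with $(a\cdot f\cdot b)(x)=f(bxa)$. Let $P_i=Ae_i$, let $\operatorname{rad}P_i$ be the intersection of its maximal submodules, and put $P_i^\circ=P_i$ for $i\in Q_0^r$ and $P_i^\circ=\operatorname{rad}P_i$ for $i\in Q_0^t$. Then the following hold. (1) The elements $e_i$ ($i\in Q_0$), $\alpha_n$ ($\alpha\in Q_1$, $1\le n<\ell_\alpha$) and $c_\beta$ ($\beta\in Q_1$, $\varepsilon_\beta=1$) form an $R$-basis of $A$. Let $q^*\in\omega_{A/R}$ denote the elements of the dual basis. There is a unique left $A$-linear map $\vartheta\colon A_\nu^\circ\to\omega_{A/R}$ with $\vartheta(e_i)=c_{\beta(i)}^*$ for $i\in Q_0^r$, where $\beta(i)$ is the arrow with sign $1$ starting at $i$, and $\vartheta(\gamma)=-(c_\gamma\partial)^*$ for $\gamma\in Q_1^t$. It is an isomorphism, and it is $A$-bilinear: $\vartheta(x\cdot_\nu a)=\vartheta(x)\cdot a$ for all $x\in A_\nu^\circ$, $a\in A$.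 (2) As a left $A$-module, $A_\nu^\circ$ is the internal direct sum of the submodules $P_i^\circ$, $i\in Q_0$. (3) Let $C$ be a complex of projective left $A$-modules. Each term $C^n$ is isomorphic to a direct sum of modules $P_i$. For any choice of isomorphisms $C^n\cong\bigoplus_{x\in X_n}P_{v_n(x)}$, let $(m^n_{xy})$ be the matrix of the differential $C^n\to C^{n+1}$, so that its component $P_{v_n(x)}\to P_{v_{n+1}(y)}$ is right multiplication by $m^n_{xy}\in e_{v_n(x)}Ae_{v_{n+1}(y)}$. Then $\omega_{A/R}\otimes_A C$ is isomorphic, as a complex of left $A$-modules, to the complex with terms $\bigoplus_{x\in X_n}P^\circ_{v_n(x)}$ whose differential has as components the right multiplications by $\nu(m^n_{xy})$. In other words, each $P_j$ with $j\in Q_0^t$ is replaced by its radical, and each path in each differential is changed by a sign. -/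

import Mathlib

open scoped DirectSum TensorProduct PowerSeries

universe w

set_option linter.unusedSectionVars false

noncomputable section

/-! ## Completion of a ring with respect to a two-sided ideal -/

/-- The completion `lim_n L / J ^ n` of a (not necessarily commutative) ring `L` with respect to a
two-sided ideal `J`, as the ring of compatible families in `∏ n, L / J ^ n`. -/
def idealCompletion {L : Type*} [Ring L] (J : Ideal L) [J.IsTwoSided] :
    Subring (∀ n : ℕ, L ⧸ J ^ n) where
  carrier := {x | ∀ (m n : ℕ) (h : m ≤ n),
    Ideal.Quotient.factor (Ideal.pow_le_pow_right h) (x n) = x m}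
  mul_mem' hx hy m n h := by simp [hx m n h, hy m n h]
  one_mem' m n h := by simp
  add_mem' hx hy m n h := by simp [hx m n h, hy m n h]
  zero_mem' m n h := by simp
  neg_mem' hx m n h := by simp [hx m n h]

namespace idealCompletion

variable {L : Type*} [Ring L] (J : Ideal L) [J.IsTwoSided]

/-- The canonical map from a ring to its completion. -/
def of : L →+* idealCompletion J :=
  (RingHom.pi fun n => Ideal.Quotient.mk (J ^ n)).codRestrict (idealCompletion J)
    (fun _ _ _ _ => rfl)

theorem pow_le_comap {f : L →+* L} (hf : J ≤ J.comap f) (n : ℕ) :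
    J ^ n ≤ (J ^ n).comap f := by
  induction n with
  | zero => rw [Submodule.pow_zero, Ideal.one_eq_top]; exact le_rfl
  | succ n ih =>
    rw [Submodule.pow_succ, Ideal.mul_le]
    intro a ha b hb
    rw [Ideal.mem_comap, map_mul]
    exact Ideal.mul_mem_mul (ih ha) (hf hb)

/-- The completion of a ring endomorphism that preserves the ideal. -/
def map (f : L →+* L) (hf : J ≤ J.comap f) : idealCompletion J →+* idealCompletion J :=
  ((RingHom.pi fun n => (Ideal.quotientMap (J ^ n) f (pow_le_comap J hf n)).comp
    (Pi.evalRingHom (fun n => L ⧸ J ^ n) n)).comp (idealCompletion J).subtype).codRestrict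
    (idealCompletion J) (by
      rintro ⟨x, hx⟩ m n h
      obtain ⟨y, hy⟩ := Ideal.Quotient.mk_surjective (x n)
      have h1 := hx m n h
      rw [← hy, Ideal.Quotient.factor_mk] at h1
      change Ideal.Quotient.factor _ (Ideal.quotientMap (J ^ n) f (pow_le_comap J hf n) (x n)) =
        Ideal.quotientMap (J ^ m) f (pow_le_comap J hf m) (x m)
      rw [← hy, ← h1, Ideal.quotientMap_mk, Ideal.quotientMap_mk, Ideal.Quotient.factor_mk])

variable {k : Type*} [Field k] [Algebra k L]

theorem aeval_mem_pow {z : L} (hz : z ∈ J) (p : Polynomial k) (n : ℕ)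
    (hp : PowerSeries.trunc n (p : k⟦X⟧) = 0) : Polynomial.aeval z p ∈ J ^ n := by
  rw [Polynomial.aeval_eq_sum_range]
  refine Submodule.sum_mem _ fun i _ => ?_
  by_cases hi : i < n
  · have h := congrArg (fun q => Polynomial.coeff q i) hp
    simp only [PowerSeries.coeff_trunc, hi, if_true, Polynomial.coeff_coe,
      Polynomial.coeff_zero] at h
    simp [h]
  · rw [Algebra.smul_def]
    exact Ideal.mul_mem_left _ _
      (Ideal.pow_le_pow_right (not_lt.mp hi) (Ideal.pow_mem_pow hz i))

theorem mk_aeval_eq {z : L} (hz : z ∈ J) (p q : Polynomial k) (n : ℕ)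
    (h : PowerSeries.trunc n (p : k⟦X⟧) = PowerSeries.trunc n (q : k⟦X⟧)) :
    Ideal.Quotient.mk (J ^ n) (Polynomial.aeval z p) =
      Ideal.Quotient.mk (J ^ n) (Polynomial.aeval z q) := by
  rw [Ideal.Quotient.eq, ← map_sub]
  refine aeval_mem_pow J hz _ n ?_
  rw [Polynomial.coe_sub, map_sub, h, sub_self]

/-- Evaluation of formal power series at an element `z` of `J`: the series `∑ a_m c ^ m` is sent to
`∑ a_m z ^ m`, whose component modulo `J ^ n` is the finite sum over `m < n`. -/
def evalPowerSeries (z : L) (hz : z ∈ J) : k⟦X⟧ →+* idealCompletion J :=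
  RingHom.codRestrict
    (RingHom.pi fun n =>
      { toFun := fun f => Ideal.Quotient.mk (J ^ n) (Polynomial.aeval z (PowerSeries.trunc n f))
        map_one' := by
          rw [mk_aeval_eq J hz _ 1 n (by simp [PowerSeries.trunc_trunc]), map_one, map_one]
        map_mul' := fun f g => by
          rw [← map_mul, ← map_mul]
          refine mk_aeval_eq J hz _ _ n ?_
          rw [PowerSeries.trunc_trunc, Polynomial.coe_mul, PowerSeries.trunc_trunc_mul_trunc]
        map_zero' := by simp
        map_add' := fun f g => by simp }) (idealCompletion J) (by
      intro f m n h
      change Ideal.Quotient.mk (J ^ m) (Polynomial.aeval z (PowerSeries.trunc n f)) =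
        Ideal.Quotient.mk (J ^ m) (Polynomial.aeval z (PowerSeries.trunc m f))
      refine mk_aeval_eq J hz _ _ m ?_
      rw [PowerSeries.trunc_trunc_of_le f h, PowerSeries.trunc_trunc])

theorem evalPowerSeries_commutes (z : L) (hz : z ∈ J) (hc : ∀ x, Commute z x) (f : k⟦X⟧)
    (x : idealCompletion J) : evalPowerSeries J z hz f * x = x * evalPowerSeries J z hz f := by
  refine Subtype.ext (funext fun n => ?_)
  obtain ⟨y, hy⟩ := Ideal.Quotient.mk_surjective (x.1 n)
  change Ideal.Quotient.mk (J ^ n) (Polynomial.aeval z (PowerSeries.trunc n f)) * x.1 n =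
    x.1 n * Ideal.Quotient.mk (J ^ n) (Polynomial.aeval z (PowerSeries.trunc n f))
  rw [← hy, ← map_mul, ← map_mul]
  congr 1
  induction (PowerSeries.trunc n f) using Polynomial.induction_on' with
  | add p q hp hq => rw [map_add, add_mul, mul_add, hp, hq]
  | monomial i a =>
    rw [Polynomial.aeval_monomial, mul_assoc, ((hc y).pow_left i).eq, ← mul_assoc,
      Algebra.commutes, mul_assoc]

end idealCompletion

/-! ## Bimodules

An `A`-bimodule is an abelian group with commuting `A`-module and `Aᵐᵒᵖ`-module structures;
`MulOpposite.op a • x` is the right action `x · a`. -/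

section Bimodules

variable (A : Type*) [Ring A]

/-- The left submodule underlying the sub-bimodule generated by a set `S`; it consists of the
finite sums of elements `a · g · b` with `g` in `S`. -/
def subbimoduleSpan {M : Type*} [AddCommGroup M] [Module A M] [Module Aᵐᵒᵖ M] (S : Set M) :
    Submodule A M :=
  Submodule.span A {x | ∃ g ∈ S, ∃ a : A, x = MulOpposite.op a • g}

variable {M : Type*} [AddCommGroup M] [Module A M] [Module Aᵐᵒᵖ M] [SMulCommClass A Aᵐᵒᵖ M]

theorem op_smul_mem_subbimoduleSpan {S : Set M} (a : Aᵐᵒᵖ) {x : M}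
    (hx : x ∈ subbimoduleSpan A S) : a • x ∈ subbimoduleSpan A S := by
  induction hx using Submodule.span_induction with
  | mem x hx =>
    obtain ⟨g, hg, b, rfl⟩ := hx
    exact Submodule.subset_span ⟨g, hg, b * a.unop, by rw [← mul_smul]; rfl⟩
  | zero => rw [smul_zero]; exact Submodule.zero_mem _
  | add x y _ _ hx hy => rw [smul_add]; exact Submodule.add_mem _ hx hy
  | smul b x _ hx => rw [← smul_comm b a x]; exact Submodule.smul_mem _ _ hx

theorem subset_subbimoduleSpan (S : Set M) : S ⊆ subbimoduleSpan A S := fun g hg =>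
  Submodule.subset_span ⟨g, hg, 1, by simp⟩

instance subbimoduleSpan.instModuleOp (S : Set M) : Module Aᵐᵒᵖ (subbimoduleSpan A S) where
  smul a x := ⟨a • x.1, op_smul_mem_subbimoduleSpan A a x.2⟩
  one_smul x := Subtype.ext (one_smul _ x.1)
  mul_smul a b x := Subtype.ext (mul_smul a b x.1)
  smul_zero a := Subtype.ext (smul_zero a)
  smul_add a x y := Subtype.ext (smul_add a x.1 y.1)
  add_smul a b x := Subtype.ext (add_smul a b x.1)
  zero_smul x := Subtype.ext (zero_smul _ x.1)

instance subbimoduleSpan.instSMulCommClass (S : Set M) :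
    SMulCommClass A Aᵐᵒᵖ (subbimoduleSpan A S) :=
  ⟨fun a b x => Subtype.ext (smul_comm a b x.1)⟩

variable {A}

/-- The regular bimodule of `A` with right action twisted by a ring endomorphism `ν`:
`x · a = x * ν a`. -/
def TwistedBimodule (_ν : A →+* A) : Type _ := A

namespace TwistedBimodule

variable (ν : A →+* A)

instance : AddCommGroup (TwistedBimodule ν) := inferInstanceAs (AddCommGroup A)

instance : Module A (TwistedBimodule ν) := inferInstanceAs (Module A A)

/-- The identity map, which is left `A`-linear. -/
def equiv : TwistedBimodule ν ≃ₗ[A] A := LinearEquiv.refl A A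

/-- The right action `x · a = x * ν a`. -/
instance : Module Aᵐᵒᵖ (TwistedBimodule ν) where
  smul a x := Mul.mul (α := A) x (ν a.unop)
  one_smul x := (congrArg (Mul.mul (α := A) x) (map_one ν)).trans (mul_one (M := A) x)
  mul_smul a b x := (congrArg (Mul.mul (α := A) x) (map_mul ν b.unop a.unop)).trans
    (mul_assoc (G := A) x (ν b.unop) (ν a.unop)).symm
  smul_zero a := zero_mul (M₀ := A) (ν a.unop)
  smul_add a x y := add_mul (R := A) x y (ν a.unop)
  add_smul a b x := (congrArg (Mul.mul (α := A) x) (map_add ν a.unop b.unop)).trans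
    (mul_add (R := A) x (ν a.unop) (ν b.unop))
  zero_smul x := (congrArg (Mul.mul (α := A) x) (map_zero ν)).trans (mul_zero (M₀ := A) x)

instance : SMulCommClass A Aᵐᵒᵖ (TwistedBimodule ν) :=
  ⟨fun a b x => (mul_assoc (G := A) a x (ν b.unop)).symm⟩

end TwistedBimodule

/-- The dualising bimodule `Hom_R(A, R)` of an `R`-algebra `A`. -/
def DualisingBimodule (R A : Type*) [CommRing R] [Ring A] [Algebra R A] : Type _ := A →ₗ[R] R

namespace DualisingBimodule

variable (R A : Type*) [CommRing R] [Ring A] [Algebra R A]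

instance : AddCommGroup (DualisingBimodule R A) := inferInstanceAs (AddCommGroup (A →ₗ[R] R))

/-- The left action `(a · f) x = f (x * a)`. -/
instance : Module A (DualisingBimodule R A) where
  smul a f := LinearMap.comp (show A →ₗ[R] R from f) (LinearMap.mulRight R a)
  one_smul f := LinearMap.ext fun x => congrArg (show A →ₗ[R] R from f) (mul_one x)
  mul_smul a b f :=
    LinearMap.ext fun x => congrArg (show A →ₗ[R] R from f) (mul_assoc x a b).symm
  smul_zero _ := rfl
  smul_add _ _ _ := rfl
  add_smul a b f := LinearMap.ext fun x =>
    (congrArg (show A →ₗ[R] R from f) (mul_add x a b)).trans (map_add _ _ _)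
  zero_smul f := LinearMap.ext fun x =>
    (congrArg (show A →ₗ[R] R from f) (mul_zero x)).trans (map_zero _)

/-- The right action `(f · a) x = f (a * x)`. -/
instance : Module Aᵐᵒᵖ (DualisingBimodule R A) where
  smul a f := LinearMap.comp (show A →ₗ[R] R from f) (LinearMap.mulLeft R a.unop)
  one_smul f := LinearMap.ext fun x => congrArg (show A →ₗ[R] R from f) (one_mul x)
  mul_smul a b f := LinearMap.ext fun x =>
    congrArg (show A →ₗ[R] R from f) (mul_assoc b.unop a.unop x)
  smul_zero _ := rfl
  smul_add _ _ _ := rfl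
  add_smul a b f := LinearMap.ext fun x =>
    (congrArg (show A →ₗ[R] R from f) (add_mul a.unop b.unop x)).trans (map_add _ _ _)
  zero_smul f := LinearMap.ext fun x =>
    (congrArg (show A →ₗ[R] R from f) (zero_mul x)).trans (map_zero _)

instance : SMulCommClass A Aᵐᵒᵖ (DualisingBimodule R A) :=
  ⟨fun a b f => LinearMap.ext fun x =>
    congrArg (show A →ₗ[R] R from f) (mul_assoc b.unop x a).symm⟩

end DualisingBimodule

variable (A) (B : Type*) [AddCommGroup B] [Module A B] [Module Aᵐᵒᵖ B] [SMulCommClass A Aᵐᵒᵖ B]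

/-- The `A`-submodule of `B ⊗_ℤ M` generated by the elements `(b · a) ⊗ m - b ⊗ (a • m)`. -/
def balancedRelations (M : Type*) [AddCommGroup M] [Module A M] : Submodule A (B ⊗[ℤ] M) :=
  Submodule.span A
    {z | ∃ (b : B) (a : A) (m : M), z = (MulOpposite.op a • b) ⊗ₜ[ℤ] m - b ⊗ₜ[ℤ] (a • m)}

/-- The tensor product `B ⊗_A M` of an `A`-bimodule `B` with a left `A`-module `M`, as a left
`A`-module: the quotient of `B ⊗_ℤ M` by the relations `(b · a) ⊗ m = b ⊗ (a • m)`. -/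
abbrev BimoduleTensor (M : Type*) [AddCommGroup M] [Module A M] : Type _ :=
  (B ⊗[ℤ] M) ⧸ balancedRelations A B M

/-- The map `id ⊗ f : B ⊗_A M → B ⊗_A N` induced by an `A`-linear map `f : M → N`. -/
def BimoduleTensor.map {M N : Type*} [AddCommGroup M] [Module A M] [AddCommGroup N] [Module A N]
    (f : M →ₗ[A] N) : BimoduleTensor A B M →ₗ[A] BimoduleTensor A B N :=
  Submodule.mapQ _ _
    (TensorProduct.AlgebraTensorModule.lTensor A B (f.toAddMonoidHom.toIntLinearMap)) (by
      rw [balancedRelations, Submodule.span_le]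
      rintro _ ⟨b, a, m, rfl⟩
      refine Submodule.subset_span ⟨b, a, f m, ?_⟩
      simp)

end Bimodules

/-! ## Gentle quivers -/

/-- A quiver with vertices `V` and arrows `E`, together with a set of paths of length two:
`rel β α` says that the path `βα` (first `α`, then `β`) belongs to the set. -/
structure BoundQuiver (V E : Type*) where
  s : E → V
  t : E → V
  rel : E → E → Prop
  comp_of_rel : ∀ {β α : E}, rel β α → s β = t α

namespace BoundQuiver

variable {V E : Type*} (Q : BoundQuiver V E)

/-- The conditions on the quiver and on the ideal generated by the given paths of length two that
define a gentle quiver. -/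
structure IsGentle : Prop where
  starting : ∀ i, {α | Q.s α = i}.encard ≤ 2
  ending : ∀ i, {α | Q.t α = i}.encard ≤ 2
  after_rel : ∀ α, {β | Q.s β = Q.t α ∧ Q.rel β α}.Subsingleton
  after_not_rel : ∀ α, {β | Q.s β = Q.t α ∧ ¬ Q.rel β α}.Subsingleton
  before_rel : ∀ β, {α | Q.t α = Q.s β ∧ Q.rel β α}.Subsingleton
  before_not_rel : ∀ β, {α | Q.t α = Q.s β ∧ ¬ Q.rel β α}.Subsingleton

/-- The arrows `a 0, a 1, …, a n` are pairwise distinct and form, in this order, a cyclic path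
without zero relations, also from `a n` to `a 0` (addition in `Fin (n + 1)` is cyclic). -/
def IsAdmissibleCycle {n : ℕ} (a : Fin (n + 1) → E) : Prop :=
  Function.Injective a ∧ ∀ i, Q.s (a (i + 1)) = Q.t (a i) ∧ ¬ Q.rel (a (i + 1)) (a i)

/-- Two arrows start and two arrows end at the vertex. -/
def IsRegularVertex (i : V) : Prop :=
  {α | Q.s α = i}.encard = 2 ∧ {α | Q.t α = i}.encard = 2

/-- One arrow starts and one arrow ends at the vertex. -/
def IsTransitionVertex (i : V) : Prop :=
  {α | Q.s α = i}.encard = 1 ∧ {α | Q.t α = i}.encard = 1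

end BoundQuiver

/-- A gentle quiver in which each arrow lies on an admissible cycle, without isolated vertices. -/
structure CyclicGentleQuiver (V E : Type*) extends BoundQuiver V E where
  gentle : toBoundQuiver.IsGentle
  admissible : ∀ α : E, ∃ (n : ℕ) (a : Fin (n + 1) → E),
    toBoundQuiver.IsAdmissibleCycle a ∧ α ∈ Set.range a
  not_isolated : ∀ i : V, ∃ α : E, toBoundQuiver.s α = i ∨ toBoundQuiver.t α = i

namespace CyclicGentleQuiver

variable {V E : Type*} (Q : CyclicGentleQuiver V E)

theorem exists_succ (α : E) : ∃ β, Q.s β = Q.t α ∧ ¬ Q.rel β α := by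
  obtain ⟨n, a, ha, i, rfl⟩ := Q.admissible α
  exact ⟨a (i + 1), ha.2 i⟩

/-- The unique arrow `σ α` such that `(σ α) α` is a path that is not a zero relation. -/
def σ (α : E) : E := (Q.exists_succ α).choose

theorem s_σ (α : E) : Q.s (Q.σ α) = Q.t α := (Q.exists_succ α).choose_spec.1

theorem not_rel_σ (α : E) : ¬ Q.rel (Q.σ α) α := (Q.exists_succ α).choose_spec.2

theorem eq_σ {α β : E} (h : Q.s β = Q.t α) (h' : ¬ Q.rel β α) : β = Q.σ α :=
  Q.gentle.after_not_rel α ⟨h, h'⟩ ⟨Q.s_σ α, Q.not_rel_σ α⟩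

theorem σ_injective : Function.Injective Q.σ := fun α β h =>
  Q.gentle.before_not_rel (Q.σ α) ⟨(Q.s_σ α).symm, Q.not_rel_σ α⟩
    ⟨by rw [h, Q.s_σ], by rw [h]; exact Q.not_rel_σ β⟩

/-- The length `ℓ_α` of the admissible cycle `c_α` that begins with `α`: the least `ℓ ≥ 1` with
`σ ^ ℓ α = α`. -/
def ℓ (α : E) : ℕ := Function.minimalPeriod Q.σ α

theorem iterate_ℓ (α : E) : Q.σ^[Q.ℓ α] α = α := Function.iterate_minimalPeriod

theorem ℓ_pos [Finite E] (α : E) : 0 < Q.ℓ α :=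
  Function.minimalPeriod_pos_of_mem_periodicPts
    (Q.σ_injective.mem_periodicPts α)

theorem ℓ_σ [Finite E] (α : E) : Q.ℓ (Q.σ α) = Q.ℓ α :=
  Function.minimalPeriod_apply (Q.σ_injective.mem_periodicPts α)

/-! ### The gentle algebra and its completion -/

variable (k : Type*) [Field k]

open FreeAlgebra in
/-- The defining relations of the path algebra, on generators `e_i` (`i` a vertex) and `α` (an
arrow). -/
inductive PathRel [Fintype V] : FreeAlgebra k (V ⊕ E) → FreeAlgebra k (V ⊕ E) → Prop
  | idem (i : V) : PathRel (ι k (Sum.inl i) * ι k (Sum.inl i)) (ι k (Sum.inl i))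
  | orth {i j : V} (h : i ≠ j) : PathRel (ι k (Sum.inl i) * ι k (Sum.inl j)) 0
  | sum_one : PathRel (∑ i : V, ι k (Sum.inl i)) 1
  | target (α : E) : PathRel (ι k (Sum.inl (Q.t α)) * ι k (Sum.inr α)) (ι k (Sum.inr α))
  | source (α : E) : PathRel (ι k (Sum.inr α) * ι k (Sum.inl (Q.s α))) (ι k (Sum.inr α))

variable [Fintype V]

/-- The path algebra `kQ`; paths are composed from right to left. -/
abbrev PathAlgebra : Type _ := RingQuot (Q.PathRel k)

/-- The vertex idempotent `e_i` in `kQ`. -/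
def pathVertex (i : V) : Q.PathAlgebra k :=
  RingQuot.mkAlgHom k (Q.PathRel k) (FreeAlgebra.ι k (Sum.inl i))

/-- The arrow `α` in `kQ`. -/
def pathArrow (α : E) : Q.PathAlgebra k :=
  RingQuot.mkAlgHom k (Q.PathRel k) (FreeAlgebra.ι k (Sum.inr α))

/-- The two-sided ideal `I` of `kQ` generated by the given paths of length two. -/
def relIdeal : Ideal (Q.PathAlgebra k) :=
  (TwoSidedIdeal.span {x | ∃ β α, Q.rel β α ∧ x = Q.pathArrow k β * Q.pathArrow k α}).asIdeal

instance : (Q.relIdeal k).IsTwoSided := by unfold relIdeal; infer_instance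

/-- The gentle algebra `kQ / I`. -/
abbrev GentleAlgebra : Type _ := Q.PathAlgebra k ⧸ Q.relIdeal k

/-- The vertex idempotent `e_i` in `kQ / I`. -/
def vertex (i : V) : Q.GentleAlgebra k := Ideal.Quotient.mk _ (Q.pathVertex k i)

/-- The arrow `α` in `kQ / I`. -/
def arrow (α : E) : Q.GentleAlgebra k := Ideal.Quotient.mk _ (Q.pathArrow k α)

/-- The path of length `n` that begins with the arrow `α` and is not contained in `I`
(for `n = 0`, the idempotent at the source of `α`). -/
def path (α : E) : ℕ → Q.GentleAlgebra k
  | 0 => Q.vertex k (Q.s α)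
  | n + 1 => Q.arrow k (Q.σ^[n] α) * path α n

/-- The two-sided ideal `J` of `kQ / I` generated by the arrows. -/
def arrowIdeal : Ideal (Q.GentleAlgebra k) :=
  (TwoSidedIdeal.span (Set.range (Q.arrow k))).asIdeal

instance : (Q.arrowIdeal k).IsTwoSided := by unfold arrowIdeal; infer_instance

/-- The completion `A` of `kQ / I` with respect to its arrow ideal. -/
def CompletedAlgebra : Type _ := idealCompletion (Q.arrowIdeal k)

instance : Ring (Q.CompletedAlgebra k) := inferInstanceAs (Ring (idealCompletion (Q.arrowIdeal k)))

/-- The canonical map from `kQ / I` to its completion. -/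
def toCompleted : Q.GentleAlgebra k →+* Q.CompletedAlgebra k := idealCompletion.of (Q.arrowIdeal k)

/-! ### The structure map `k⟦c⟧ → A` -/

theorem vertex_mul_vertex_self (i : V) : Q.vertex k i * Q.vertex k i = Q.vertex k i := by
  rw [vertex, ← map_mul, pathVertex, ← map_mul, RingQuot.mkAlgHom_rel k (PathRel.idem i)]

theorem vertex_mul_vertex {i j : V} (h : i ≠ j) : Q.vertex k i * Q.vertex k j = 0 := by
  rw [vertex, vertex, ← map_mul, pathVertex, pathVertex, ← map_mul,
    RingQuot.mkAlgHom_rel k (PathRel.orth h), map_zero, map_zero]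

theorem sum_vertex : ∑ i, Q.vertex k i = 1 := by
  have h := RingQuot.mkAlgHom_rel k (PathRel.sum_one (Q := Q) (k := k))
  simp only [vertex, pathVertex]
  rw [← map_sum, ← map_sum, h, map_one, map_one]

theorem vertex_mul_arrow (α : E) : Q.vertex k (Q.t α) * Q.arrow k α = Q.arrow k α := by
  rw [vertex, arrow, ← map_mul, pathVertex, pathArrow, ← map_mul,
    RingQuot.mkAlgHom_rel k (PathRel.target α)]

theorem arrow_mul_vertex (α : E) : Q.arrow k α * Q.vertex k (Q.s α) = Q.arrow k α := by
  rw [vertex, arrow, ← map_mul, pathVertex, pathArrow, ← map_mul,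
    RingQuot.mkAlgHom_rel k (PathRel.source α)]

theorem arrow_mul_arrow_of_rel {β α : E} (h : Q.rel β α) : Q.arrow k β * Q.arrow k α = 0 := by
  rw [arrow, arrow, ← map_mul, Ideal.Quotient.eq_zero_iff_mem, relIdeal,
    TwoSidedIdeal.mem_asIdeal]
  exact TwoSidedIdeal.subset_span ⟨β, α, h, rfl⟩

theorem arrow_mul_arrow {β α : E} (h : β ≠ Q.σ α) : Q.arrow k β * Q.arrow k α = 0 := by
  by_cases hs : Q.s β = Q.t α
  · exact Q.arrow_mul_arrow_of_rel k (by_contra fun hr => h (Q.eq_σ hs hr))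
  · rw [← Q.arrow_mul_vertex k β, ← Q.vertex_mul_arrow k α, mul_assoc,
      ← mul_assoc (Q.vertex k _), Q.vertex_mul_vertex k hs, zero_mul, mul_zero]

theorem arrow_mem (α : E) : Q.arrow k α ∈ Q.arrowIdeal k := by
  rw [arrowIdeal, TwoSidedIdeal.mem_asIdeal]
  exact TwoSidedIdeal.subset_span ⟨α, rfl⟩

theorem path_mul_vertex (α : E) (n : ℕ) :
    Q.path k α n * Q.vertex k (Q.s α) = Q.path k α n := by
  induction n with
  | zero => exact Q.vertex_mul_vertex_self k _
  | succ n ih => rw [path, mul_assoc, ih]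

theorem vertex_mul_path (α : E) (n : ℕ) :
    Q.vertex k (Q.s (Q.σ^[n] α)) * Q.path k α n = Q.path k α n := by
  cases n with
  | zero => exact Q.vertex_mul_vertex_self k _
  | succ n =>
    rw [path, ← mul_assoc, Function.iterate_succ_apply', Q.s_σ, Q.vertex_mul_arrow]

theorem path_σ_mul_arrow (α : E) (n : ℕ) :
    Q.path k (Q.σ α) n * Q.arrow k α = Q.path k α (n + 1) := by
  induction n with
  | zero =>
    simp only [path, Function.iterate_zero, id]
    rw [Q.s_σ, Q.vertex_mul_arrow, Q.arrow_mul_vertex]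
  | succ n ih => rw [path, mul_assoc, ih, path.eq_2 Q k α (n + 1), Function.iterate_succ_apply]

theorem path_mul_arrow {α β : E} (h : α ≠ Q.σ β) {n : ℕ} (hn : 0 < n) :
    Q.path k α n * Q.arrow k β = 0 := by
  obtain ⟨n, rfl⟩ := Nat.exists_eq_succ_of_ne_zero hn.ne'
  induction n with
  | zero =>
    simp only [path, Function.iterate_zero, id]
    rw [Q.arrow_mul_vertex, Q.arrow_mul_arrow k h]
  | succ n ih => rw [path, mul_assoc, ih (Nat.succ_pos n), mul_zero]

theorem arrow_mul_path {α β : E} {n : ℕ} (hn : 0 < n) (h : β ≠ Q.σ^[n] α) :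
    Q.arrow k β * Q.path k α n = 0 := by
  obtain ⟨n, rfl⟩ := Nat.exists_eq_succ_of_ne_zero hn.ne'
  rw [Function.iterate_succ_apply'] at h
  rw [path, ← mul_assoc, Q.arrow_mul_arrow k h, zero_mul]

variable [Fintype E]

/-- The sum of all admissible cycles `c_α` in `kQ / I`. -/
def cycleSum : Q.GentleAlgebra k := ∑ α, Q.path k α (Q.ℓ α)

theorem cycleSum_mem : Q.cycleSum k ∈ Q.arrowIdeal k := by
  refine Submodule.sum_mem _ fun α _ => ?_
  obtain ⟨n, hn⟩ := Nat.exists_eq_succ_of_ne_zero (Q.ℓ_pos α).ne'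
  rw [hn, path]
  exact Ideal.mul_mem_right _ _ (Q.arrow_mem k _)

theorem cycleSum_vertex (i : V) :
    Q.cycleSum k * Q.vertex k i = Q.vertex k i * Q.cycleSum k := by
  rw [cycleSum, Finset.sum_mul, Finset.mul_sum]
  refine Finset.sum_congr rfl fun α _ => ?_
  by_cases h : Q.s α = i
  · subst h
    have h2 := Q.vertex_mul_path k α (Q.ℓ α)
    rw [Q.iterate_ℓ] at h2
    rw [Q.path_mul_vertex, h2]
  · have h2 := Q.vertex_mul_path k α (Q.ℓ α)
    rw [Q.iterate_ℓ] at h2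
    rw [← h2, ← mul_assoc, Q.vertex_mul_vertex k (Ne.symm h), zero_mul, h2,
      ← Q.path_mul_vertex, mul_assoc, Q.vertex_mul_vertex k h, mul_zero]

theorem cycleSum_arrow (β : E) :
    Q.cycleSum k * Q.arrow k β = Q.arrow k β * Q.cycleSum k := by
  classical
  rw [cycleSum, Finset.sum_mul, Finset.mul_sum,
    Finset.sum_eq_single_of_mem (Q.σ β) (Finset.mem_univ _)
      (fun α _ h => Q.path_mul_arrow k h (Q.ℓ_pos α)),
    Finset.sum_eq_single_of_mem β (Finset.mem_univ _)
      (fun α _ h => Q.arrow_mul_path k (Q.ℓ_pos α) (by rw [Q.iterate_ℓ]; exact h.symm)),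
    Q.path_σ_mul_arrow, Q.ℓ_σ, path, Q.iterate_ℓ]

theorem cycleSum_commute (x : Q.GentleAlgebra k) : Commute (Q.cycleSum k) x := by
  obtain ⟨x, rfl⟩ := Ideal.Quotient.mk_surjective x
  obtain ⟨x, rfl⟩ := RingQuot.mkAlgHom_surjective k (Q.PathRel k) x
  induction x using FreeAlgebra.induction with
  | grade0 r =>
    rw [AlgHom.commutes]
    exact (Algebra.commutes (A := Q.GentleAlgebra k) r (Q.cycleSum k)).symm
  | grade1 x =>
    cases x with
    | inl i => exact Q.cycleSum_vertex k i
    | inr α => exact Q.cycleSum_arrow k α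
  | mul x y hx hy => rw [map_mul, map_mul]; exact hx.mul_right hy
  | add x y hx hy => rw [map_add, map_add]; exact hx.add_right hy

/-- The structure of a `k⟦c⟧`-algebra on `A`, sending `c` to the sum of all admissible cycles. -/
instance : Algebra k⟦X⟧ (Q.CompletedAlgebra k) :=
  RingHom.toAlgebra' (idealCompletion.evalPowerSeries (Q.arrowIdeal k) (Q.cycleSum k)
      (Q.cycleSum_mem k) : k⟦X⟧ →+* idealCompletion (Q.arrowIdeal k))
    (idealCompletion.evalPowerSeries_commutes (Q.arrowIdeal k) (Q.cycleSum k) (Q.cycleSum_mem k)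
      (Q.cycleSum_commute k))

/-! ### Paths in `A` and the `k⟦c⟧`-basis -/

/-- The vertex idempotent `e_i` in `A`. -/
def e (i : V) : Q.CompletedAlgebra k := Q.toCompleted k (Q.vertex k i)

/-- The element of `A` given by an arrow. -/
def a (α : E) : Q.CompletedAlgebra k := Q.toCompleted k (Q.arrow k α)

/-- The path `α_n` of length `n` that begins with `α` and is not contained in `I`, in `A`. -/
def p (α : E) (n : ℕ) : Q.CompletedAlgebra k := Q.toCompleted k (Q.path k α n)

/-- The admissible cycle `c_α` that begins with `α`, in `A`. -/
def c (α : E) : Q.CompletedAlgebra k := Q.p k α (Q.ℓ α)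

/-- The path `c_α ∂`, which is obtained from the admissible cycle `c_α` by deleting its first
arrow `α`; it has length `ℓ_α - 1`. -/
def cDel (α : E) : Q.CompletedAlgebra k := Q.p k (Q.σ α) (Q.ℓ α - 1)

/-- A choice of signs that separates the two arrows starting at a `2`-regular vertex and is `-1`
on each arrow starting at a transition vertex. -/
structure IsSignChoice (ε : E → ℤˣ) : Prop where
  ne : ∀ {α β : E}, α ≠ β → Q.s α = Q.s β → ε α ≠ ε β
  transition : ∀ {γ : E}, Q.IsTransitionVertex (Q.s γ) → ε γ = -1

/-- Indices for the basis of `A` over `k⟦c⟧`: the vertices, the pairs `(α, n)` with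
`1 ≤ n < ℓ_α`, and the arrows `β` of sign `1`. -/
inductive BasisIndex (ε : E → ℤˣ) : Type _
  | vertex (i : V) : BasisIndex ε
  | path (α : E) (n : ℕ) (one_le : 1 ≤ n) (lt : n < Q.ℓ α) : BasisIndex ε
  | cycle (β : E) (sign : ε β = 1) : BasisIndex ε

/-- The elements `e_i`, `α_n` and `c_β` of `A`. -/
def basisElement (ε : E → ℤˣ) : Q.BasisIndex ε → Q.CompletedAlgebra k
  | .vertex i => Q.e k i
  | .path α n _ _ => Q.p k α n
  | .cycle β _ => Q.c k β

/-! ### The automorphism `ν` -/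

theorem asIdeal_span_le {L : Type*} [Ring L] {S : Set L} {I : Ideal L} [I.IsTwoSided]
    (h : S ⊆ I) : (TwoSidedIdeal.span S).asIdeal ≤ I := by
  intro x hx
  rw [TwoSidedIdeal.mem_asIdeal] at hx
  have h2 : TwoSidedIdeal.span S ≤ I.toTwoSided :=
    TwoSidedIdeal.span_le.2 (by rwa [Ideal.coe_toTwoSided])
  exact Ideal.mem_toTwoSided.1 (h2 hx)

/-- The algebra morphism `kQ → kQ / I` with `e_i ↦ e_i` and `α ↦ ε_{σ α} ε_α α`. -/
def νPath (ε : E → ℤˣ) : Q.PathAlgebra k →ₐ[k] Q.GentleAlgebra k :=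
  RingQuot.liftAlgHom k ⟨FreeAlgebra.lift k (Sum.elim (Q.vertex k)
    (fun α => ((ε (Q.σ α) * ε α : ℤˣ) : ℤ) • Q.arrow k α)), by
      intro x y h
      cases h with
      | idem i => simp [vertex_mul_vertex_self]
      | orth h => simp [vertex_mul_vertex, h]
      | sum_one => simp [sum_vertex]
      | target α => simp only [map_mul, FreeAlgebra.lift_ι_apply, Sum.elim_inl, Sum.elim_inr,
          mul_smul_comm, vertex_mul_arrow]
      | source α => simp only [map_mul, FreeAlgebra.lift_ι_apply, Sum.elim_inl, Sum.elim_inr,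
          smul_mul_assoc, arrow_mul_vertex]⟩

theorem νPath_vertex (ε : E → ℤˣ) (i : V) : Q.νPath k ε (Q.pathVertex k i) = Q.vertex k i := by
  simp [νPath, pathVertex]

theorem νPath_arrow (ε : E → ℤˣ) (α : E) :
    Q.νPath k ε (Q.pathArrow k α) = ((ε (Q.σ α) * ε α : ℤˣ) : ℤ) • Q.arrow k α := by
  simp [νPath, pathArrow]

/-- The algebra morphism `kQ / I → kQ / I` with `e_i ↦ e_i` and `α ↦ ε_{σ α} ε_α α`. -/
def νGentle (ε : E → ℤˣ) : Q.GentleAlgebra k →+* Q.GentleAlgebra k :=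
  Ideal.Quotient.lift (Q.relIdeal k) (Q.νPath k ε : Q.PathAlgebra k →+* Q.GentleAlgebra k) (by
    intro x hx
    have h : Q.relIdeal k ≤
        RingHom.ker (Q.νPath k ε : Q.PathAlgebra k →+* Q.GentleAlgebra k) := by
      refine asIdeal_span_le ?_
      rintro _ ⟨β, α, h, rfl⟩
      rw [SetLike.mem_coe, RingHom.mem_ker, map_mul, AlgHom.coe_toRingHom, νPath_arrow, νPath_arrow,
        smul_mul_assoc, mul_smul_comm, Q.arrow_mul_arrow_of_rel k h, smul_zero, smul_zero]
    exact h hx)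

theorem νGentle_vertex (ε : E → ℤˣ) (i : V) : Q.νGentle k ε (Q.vertex k i) = Q.vertex k i :=
  Q.νPath_vertex k ε i

theorem νGentle_arrow (ε : E → ℤˣ) (α : E) :
    Q.νGentle k ε (Q.arrow k α) = ((ε (Q.σ α) * ε α : ℤˣ) : ℤ) • Q.arrow k α :=
  Q.νPath_arrow k ε α

theorem arrowIdeal_le_comap (ε : E → ℤˣ) :
    Q.arrowIdeal k ≤ (Q.arrowIdeal k).comap (Q.νGentle k ε) := by
  refine asIdeal_span_le ?_
  rintro _ ⟨α, rfl⟩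
  rw [SetLike.mem_coe, Ideal.mem_comap, νGentle_arrow]
  exact zsmul_mem (Q.arrow_mem k α) _

/-- The completion `ν : A → A` of the algebra morphism with `e_i ↦ e_i` and
`α ↦ ε_{σ α} ε_α α`. -/
def ν (ε : E → ℤˣ) : Q.CompletedAlgebra k →+* Q.CompletedAlgebra k :=
  idealCompletion.map (Q.arrowIdeal k) (Q.νGentle k ε) (Q.arrowIdeal_le_comap k ε)

/-! ### The bimodules -/

/-- The dualising bimodule `ω = Hom_R(A, R)` for `R = k⟦c⟧`. -/
abbrev Omega : Type _ := DualisingBimodule k⟦X⟧ (Q.CompletedAlgebra k)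

/-- The sub-bimodule `A°` of the twisted bimodule `A_ν` generated by the idempotents `e_i` at
`2`-regular vertices `i` and by the arrows that start at transition vertices. -/
def circ (ε : E → ℤˣ) : Submodule (Q.CompletedAlgebra k) (TwistedBimodule (Q.ν k ε)) :=
  subbimoduleSpan (Q.CompletedAlgebra k)
    ({x | ∃ i, Q.IsRegularVertex i ∧ x = Q.e k i} ∪
      {x | ∃ γ, Q.IsTransitionVertex (Q.s γ) ∧ x = Q.a k γ})

instance (ε : E → ℤˣ) : Module (Q.CompletedAlgebra k)ᵐᵒᵖ (Q.circ k ε) :=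
  subbimoduleSpan.instModuleOp _ _

/-- The idempotent at a `2`-regular vertex, as an element of `A°`. -/
def circVertex (ε : E → ℤˣ) (i : V) (hi : Q.IsRegularVertex i) : Q.circ k ε :=
  ⟨Q.e k i, subset_subbimoduleSpan _ _ (Or.inl ⟨i, hi, rfl⟩)⟩

/-- An arrow that starts at a transition vertex, as an element of `A°`. -/
def circArrow (ε : E → ℤˣ) (γ : E) (hγ : Q.IsTransitionVertex (Q.s γ)) : Q.circ k ε :=
  ⟨Q.a k γ, subset_subbimoduleSpan _ _ (Or.inr ⟨γ, hγ, rfl⟩)⟩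

/-- The values that determine `ϑ`: it sends `e_i` to `c_β^*` if `i` is `2`-regular and `β` is the
arrow of sign `1` starting at `i`, and it sends an arrow `γ` starting at a transition vertex to
`-(c_γ ∂)^*`. Here `q^*` denotes the elements of the basis dual to `b`. -/
def HasThetaValues {ε : E → ℤˣ}
    (b : Module.Basis (Q.BasisIndex ε) k⟦X⟧ (Q.CompletedAlgebra k))
    (ϑ : Q.circ k ε →ₗ[Q.CompletedAlgebra k] Q.Omega k) : Prop :=
  (∀ (i : V) (hi : Q.IsRegularVertex i), ∃ (β : E) (hβ : ε β = 1), Q.s β = i ∧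
    ϑ (Q.circVertex k ε i hi) = b.coord (.cycle β hβ)) ∧
  ∀ (γ : E) (hγ : Q.IsTransitionVertex (Q.s γ)), ∃ q : Q.BasisIndex ε,
    Q.basisElement k ε q = Q.cDel k γ ∧ ϑ (Q.circArrow k ε γ hγ) = -b.coord q

/-- The projective left `A`-module `P_i = A e_i`. -/
def P (i : V) : Submodule (Q.CompletedAlgebra k) (Q.CompletedAlgebra k) :=
  Submodule.span (Q.CompletedAlgebra k) {Q.e k i}

/-- The generator `e_i` of `P_i`. -/
def eP (i : V) : Q.P k i := ⟨Q.e k i, Submodule.mem_span_singleton_self _⟩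

open Classical in
/-- The left `A`-module that replaces `P_i`: the radical of `P_i`, that is, the intersection of its
maximal submodules, if `i` is a transition vertex, and `P_i` itself otherwise. -/
def PCirc (i : V) : Submodule (Q.CompletedAlgebra k) (Q.CompletedAlgebra k) :=
  if Q.IsTransitionVertex i then
    (Module.jacobson (Q.CompletedAlgebra k) (Q.P k i)).map (Q.P k i).subtype
  else Q.P k i

/-- The entries in `A` of the matrix of a linear map `f : M → N` with respect to decompositions of
`M` and `N` as direct sums of modules `P_i`: the entry at `(x, y)` is the component in the `y`-th
summand of the image of the generator of the `x`-th summand. -/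
def entry {M N X Y : Type*} [AddCommGroup M] [Module (Q.CompletedAlgebra k) M]
    [AddCommGroup N] [Module (Q.CompletedAlgebra k) N] {v : X → V} {v' : Y → V}
    (d : M ≃ₗ[Q.CompletedAlgebra k] ⨁ x, Q.P k (v x))
    (d' : N ≃ₗ[Q.CompletedAlgebra k] ⨁ y, Q.P k (v' y))
    (f : M →ₗ[Q.CompletedAlgebra k] N) (x : X) (y : Y) : Q.CompletedAlgebra k := by
  classical
  exact (d' (f (d.symm (DirectSum.lof (Q.CompletedAlgebra k) X (fun x => Q.P k (v x)) x
    (Q.eP k (v x))))) y : Q.CompletedAlgebra k)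

/-- The linear map `D` is given on the `x`-th and `y`-th summands by right multiplication with
`ν (m x y)`. -/
def IsSignedMatrixMap (ε : E → ℤˣ) {X Y : Type*} {v : X → V} {v' : Y → V}
    (m : X → Y → Q.CompletedAlgebra k)
    (D : (⨁ x, Q.PCirc k (v x)) →ₗ[Q.CompletedAlgebra k] ⨁ y, Q.PCirc k (v' y)) : Prop := by
  classical
  exact ∀ (x : X) (z : Q.PCirc k (v x)) (y : Y),
    (D (DirectSum.lof (Q.CompletedAlgebra k) X (fun x => Q.PCirc k (v x)) x z) y :
      Q.CompletedAlgebra k) = (z : Q.CompletedAlgebra k) * Q.ν k ε (m x y)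

end CyclicGentleQuiver

end

/-!
An element of `A` is the same as a family of scalars indexed by the paths `α_n`, where the entries
at `n = 0` depend only on the source of `α` (`coeff`, `ext_coeff`, `exists_coeff_eq`). Products are
convolutions along the factorisations of `α_n` into a path that begins with `α` and a path that
begins with `σ^j α` (`coeff_mul`). To obtain the coefficients, `kQ / I` is represented on such
families (`rep`), and an element is applied to the family of the unit. In these terms, a power
series acts by convolution on each residue class of `n` modulo `ℓ_α` (`coeff_smul`), and `ν`
multiplies the entry at `α_n` by `ε_{σ^n α} ε_α` (`coeff_ν`).

The theorem rests on the trace form `A → k⟦c⟧` whose `m`-th coefficient is the sum over all arrows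
`α` of `ε_α` times the coefficient of `c_α^{m+1}`.

* Rotating a cycle interchanges its two factors and replaces the sign of its first arrow by the sign
  of the first arrow of the other factor. Hence `trace (z ν(a)) = trace (a z)` (`trace_mul_ν`).
* The trace is linear over `k⟦c⟧` on the elements whose constant terms vanish at the transition
  vertices, because the signs of the two arrows starting at a regular vertex cancel (`trace_smul`).
  These elements form the ideal `vanishIdeal`, which is `A°` (`map_circ`).

Thus `ϑ(x)(y) = trace (y x)` defines a bilinear map from `A°` to the dualising bimodule. Let the
path `q` complete `α_n` to a power of an admissible cycle; then a coefficient of `trace (q x)` is,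
up to a sign, the coefficient of `α_n` in `x` (`coeff_trace_p_mul`). So `ϑ` is injective, and a
linear form `f` has a preimage whose coefficients are read off from the values of `f` at the paths
`q` (`exists_traceForm_eq`). The coordinates with respect to the claimed basis are the coefficients
along residue classes and the forms `ϑ(e_i)` (`coordinate_basisElement`, `eq_zero_of_coordinate`);
this also yields the values of `ϑ` at the generators of `A°`.

An element of `A` with nonzero constant terms is invertible (`exists_inverse`). Therefore `rad P_i`
consists, for a transition vertex `i`, of the elements of `P_i` without constant term
(`jacobson_P`), and `P_i° = P_i ∩ A°`, which gives the decomposition of `A°`.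

For the same reason, the idempotents `e_i` are local. Over a ring with such a decomposition of the
unit, each element of a projective module lies in a direct summand that is a finite direct sum of
modules `A e_v`: an expression of the element by a dual basis is shortened until its elements and
linear forms are dual to each other modulo the radical, and then Nakayama's lemma applies
(`exists_summand_of_eq_sum`, `exists_summand_of_dual`). Countably generated projective modules are
exhausted by such summands (`exists_family_of_countable`), and the general case is reduced to this
one as in Kaplansky's theorem (`exists_family`).

Finally, for a decomposition of `M` into modules `P_{v(x)}`, the map `f ⊗ m ↦ (ϑ⁻¹(f) ν(m_x))_x`
identifies `ω ⊗_A M` with the direct sum of the modules `P_{v(x)}°` (`tensorEquiv`). Its inverse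
sends `z` in the summand of `x` to `ϑ(z) ⊗ e_x`, so that right multiplication by `m` becomes right
multiplication by `ν(m)` (`isSignedMatrixMap_tensorEquiv`).
-/

noncomputable section

namespace CyclicGentleQuiver

variable {V E : Type*} (Q : CyclicGentleQuiver V E)

/-! ### Arrows and their successors -/

theorem s_iterate_σ_succ (α : E) (n : ℕ) : Q.s (Q.σ^[n + 1] α) = Q.t (Q.σ^[n] α) := by
  rw [Function.iterate_succ_apply', Q.s_σ]

theorem ne_σ_of_rel {β α : E} (h : Q.rel β α) : β ≠ Q.σ α := fun h' =>
  Q.not_rel_σ α (h' ▸ h)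

theorem exists_source (i : V) : ∃ α : E, Q.s α = i := by
  obtain ⟨α, h | h⟩ := Q.not_isolated i
  · exact ⟨α, h⟩
  · exact ⟨Q.σ α, (Q.s_σ α).trans h⟩

variable (k : Type*) [Field k]

/-! ### Coefficients of paths -/

open Classical in
/-- The action of the idempotent `e_i` on families of scalars indexed by the paths `α_n`; it keeps
the entries of the paths that end at `i`. -/
def vertexOp (i : V) : Module.End k (E → ℕ → k) where
  toFun w α n := if Q.s (Q.σ^[n] α) = i then w α n else 0
  map_add' w w' := by ext α n; simp only [Pi.add_apply]; split_ifs <;> simp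
  map_smul' c w := by ext α n; simp

open Classical in
/-- The action of the arrow `β` on families of scalars indexed by the paths `α_n`; the entry at
`α_n` is moved to `α_{n+1}` if `α_{n+1} = β α_n`. -/
def arrowOp (β : E) : Module.End k (E → ℕ → k) where
  toFun w α n := match n with
    | 0 => 0
    | n + 1 => if Q.σ^[n] α = β then w α n else 0
  map_add' w w' := by
    ext α n
    cases n
    · simp
    · simp only [Pi.add_apply]; split_ifs <;> simp
  map_smul' c w := by ext α n; cases n <;> simp

@[simp] theorem arrowOp_zero (β : E) (w : E → ℕ → k) (α : E) : Q.arrowOp k β w α 0 = 0 := rfl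

open Classical in
theorem arrowOp_succ (β : E) (w : E → ℕ → k) (α : E) (n : ℕ) :
    Q.arrowOp k β w α (n + 1) = if Q.σ^[n] α = β then w α n else 0 := rfl

open Classical in
theorem vertexOp_apply (i : V) (w : E → ℕ → k) (α : E) (n : ℕ) :
    Q.vertexOp k i w α n = if Q.s (Q.σ^[n] α) = i then w α n else 0 := rfl

variable [Fintype V]

/-- The representation of `kQ` on families of scalars indexed by the paths `α_n`. The paths `α_0`
are not identified for arrows `α` with the same source: this makes the operators simpler and does
no harm, since only the images of the family of the unit are used. -/
def repPath : Q.PathAlgebra k →ₐ[k] Module.End k (E → ℕ → k) :=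
  RingQuot.liftAlgHom k ⟨FreeAlgebra.lift k (Sum.elim (Q.vertexOp k) (Q.arrowOp k)), by
    intro x y h
    cases h with
    | idem i =>
      ext w α n
      simp only [map_mul, FreeAlgebra.lift_ι_apply, Sum.elim_inl, Module.End.mul_apply,
        vertexOp_apply]
      split_ifs <;> rfl
    | orth h =>
      rename_i i j
      ext w α n
      simp only [map_mul, FreeAlgebra.lift_ι_apply, Sum.elim_inl, Module.End.mul_apply,
        vertexOp_apply]
      split_ifs with h1 h2
      · exact absurd (h1.symm.trans h2) h
      · simp
      · simp
    | sum_one =>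
      ext w α n
      simp only [map_sum, FreeAlgebra.lift_ι_apply, Sum.elim_inl, LinearMap.sum_apply,
        Finset.sum_apply, vertexOp_apply, map_one, Module.End.one_apply]
      rw [Finset.sum_eq_single_of_mem (Q.s (Q.σ^[n] α)) (Finset.mem_univ _)
        (fun i _ hi => if_neg hi.symm), if_pos rfl]
    | target α =>
      ext w β n
      cases n with
      | zero =>
        simp only [map_mul, FreeAlgebra.lift_ι_apply, Sum.elim_inl, Sum.elim_inr,
          Module.End.mul_apply, vertexOp_apply, arrowOp_zero, ite_self]
      | succ n =>
        simp only [map_mul, FreeAlgebra.lift_ι_apply, Sum.elim_inl, Sum.elim_inr,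
          Module.End.mul_apply, vertexOp_apply, arrowOp_succ]
        split_ifs with h1 h2 h2
        · rfl
        · rfl
        · exact absurd ((Q.s_iterate_σ_succ β n).trans (congrArg Q.t h2)) h1
        · rfl
    | source α =>
      ext w β n
      cases n with
      | zero => simp
      | succ n =>
        simp only [map_mul, FreeAlgebra.lift_ι_apply, Sum.elim_inl, Sum.elim_inr,
          Module.End.mul_apply, vertexOp_apply, arrowOp_succ]
        split_ifs with h1 h2
        · rfl
        · exact absurd (congrArg Q.s h1) h2
        · rfl⟩

theorem repPath_vertex (i : V) : Q.repPath k (Q.pathVertex k i) = Q.vertexOp k i := by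
  simp [repPath, pathVertex]

theorem repPath_arrow (α : E) : Q.repPath k (Q.pathArrow k α) = Q.arrowOp k α := by
  simp [repPath, pathArrow]

/-- The representation of `kQ / I` on families of scalars indexed by the paths `α_n`. -/
def rep : Q.GentleAlgebra k →ₐ[k] Module.End k (E → ℕ → k) :=
  Ideal.Quotient.liftₐ (Q.relIdeal k) (Q.repPath k) (by
    intro x hx
    have h : Q.relIdeal k ≤
        RingHom.ker (Q.repPath k : Q.PathAlgebra k →+* Module.End k (E → ℕ → k)) := by
      refine asIdeal_span_le ?_
      rintro _ ⟨β, α, h, rfl⟩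
      rw [SetLike.mem_coe, RingHom.mem_ker, map_mul, AlgHom.coe_toRingHom, repPath_arrow,
        repPath_arrow]
      ext w γ n
      rcases n with _ | _ | n
      · simp
      · simp only [Module.End.mul_apply, arrowOp_succ, arrowOp_zero, ite_self,
          LinearMap.zero_apply, Pi.zero_apply]
      · simp only [Module.End.mul_apply, arrowOp_succ, LinearMap.zero_apply, Pi.zero_apply]
        split_ifs with h1 h2
        · exact absurd (by rw [← h1, ← h2, Function.iterate_succ_apply']) (Q.ne_σ_of_rel h)
        · rfl
        · rfl
    exact h hx)

theorem rep_vertex (i : V) : Q.rep k (Q.vertex k i) = Q.vertexOp k i := Q.repPath_vertex k i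

theorem rep_arrow (α : E) : Q.rep k (Q.arrow k α) = Q.arrowOp k α := Q.repPath_arrow k α

variable {k}

/-- Induction on the elements of `kQ / I`, along the generators `e_i` and `α`. -/
@[elab_as_elim]
theorem gentle_induction {C : Q.GentleAlgebra k → Prop}
    (scalar : ∀ r : k, C (algebraMap k (Q.GentleAlgebra k) r))
    (vertex : ∀ i, C (Q.vertex k i)) (arrow : ∀ α, C (Q.arrow k α))
    (mul : ∀ x y, C x → C y → C (x * y)) (add : ∀ x y, C x → C y → C (x + y))
    (x : Q.GentleAlgebra k) : C x := by
  obtain ⟨x, rfl⟩ := Ideal.Quotient.mk_surjective x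
  obtain ⟨x, rfl⟩ := RingQuot.mkAlgHom_surjective k (Q.PathRel k) x
  induction x using FreeAlgebra.induction with
  | grade0 r => rw [AlgHom.commutes]; exact scalar r
  | grade1 x =>
    cases x with
    | inl i => exact vertex i
    | inr α => exact arrow α
  | mul x y hx hy => rw [map_mul, map_mul]; exact mul _ _ hx hy
  | add x y hx hy => rw [map_add, map_add]; exact add _ _ hx hy

/-- The family of scalars that represents the unit: `1` at the paths of length zero. -/
def unitFamily : E → ℕ → k := fun _ n => if n = 0 then 1 else 0

/-- The coefficient of the path `α_n` in an element of `kQ / I`; for `n = 0`, this is the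
coefficient of the idempotent at the source of `α`. -/
def gcoeff : Q.GentleAlgebra k →ₗ[k] E → ℕ → k :=
  (LinearMap.applyₗ (unitFamily (E := E) (k := k))).comp (Q.rep k).toLinearMap

theorem gcoeff_def (x : Q.GentleAlgebra k) : Q.gcoeff x = Q.rep k x unitFamily := rfl

theorem gcoeff_algebraMap (r : k) (α : E) (n : ℕ) :
    Q.gcoeff (algebraMap k (Q.GentleAlgebra k) r) α n = if n = 0 then r else 0 := by
  rw [gcoeff_def, AlgHom.commutes, Module.algebraMap_end_apply]
  simp [unitFamily]

theorem gcoeff_one (α : E) (n : ℕ) :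
    Q.gcoeff (1 : Q.GentleAlgebra k) α n = if n = 0 then 1 else 0 := by
  rw [gcoeff_def, map_one]; rfl

open Classical in
theorem gcoeff_vertex (i : V) (α : E) (n : ℕ) :
    Q.gcoeff (Q.vertex k i) α n = if n = 0 ∧ Q.s α = i then 1 else 0 := by
  rw [gcoeff_def, rep_vertex, vertexOp_apply]
  rcases n with _ | n <;> simp [unitFamily]

open Classical in
theorem gcoeff_arrow (β α : E) (n : ℕ) :
    Q.gcoeff (Q.arrow k β) α n = if n = 1 ∧ α = β then 1 else 0 := by
  rw [gcoeff_def, rep_arrow]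
  rcases n with _ | _ | n
  · simp
  · simp [arrowOp_succ, unitFamily]
  · simp [arrowOp_succ, unitFamily]

open Finset in
/-- An element acts by convolution with its coefficients: the path `α_n` is the product of a path
`β_i` and the path `α_j` with `i + j = n` and `β = σ^j α`. -/
theorem rep_apply (x : Q.GentleAlgebra k) : ∀ (w : E → ℕ → k) (α : E) (n : ℕ),
    Q.rep k x w α n = ∑ p ∈ antidiagonal n, Q.gcoeff x (Q.σ^[p.2] α) p.1 * w α p.2 := by
  classical
  induction x using Q.gentle_induction with
  | scalar r =>
    intro w α n
    rw [AlgHom.commutes, Module.algebraMap_end_apply, sum_eq_single_of_mem (0, n) (by simp)]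
    · simp [gcoeff_algebraMap]
    · rintro ⟨i, j⟩ h1 h2
      rw [gcoeff_algebraMap, if_neg, zero_mul]
      rintro rfl
      simp_all
  | vertex v =>
    intro w α n
    rw [rep_vertex, vertexOp_apply, sum_eq_single_of_mem (0, n) (by simp)]
    · simp [gcoeff_vertex]
    · rintro ⟨i, j⟩ h1 h2
      rw [gcoeff_vertex, if_neg, zero_mul]
      rintro ⟨rfl, -⟩
      simp_all
  | arrow β =>
    intro w α n
    rw [rep_arrow]
    cases n with
    | zero => simp [gcoeff_arrow]
    | succ n =>
      rw [arrowOp_succ, sum_eq_single_of_mem (1, n) (by simp [add_comm])]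
      · simp [gcoeff_arrow]
      · rintro ⟨i, j⟩ h1 h2
        rw [gcoeff_arrow, if_neg, zero_mul]
        rintro ⟨rfl, -⟩
        simp only [HasAntidiagonal.mem_antidiagonal, ne_eq, Prod.mk.injEq, true_and] at h1 h2
        omega
  | mul x y hx hy =>
    intro w α n
    have h : ∀ (β : E) (m : ℕ), Q.gcoeff (x * y) β m = ∑ p ∈ antidiagonal m,
        Q.gcoeff x (Q.σ^[p.2] β) p.1 * Q.gcoeff y β p.2 := fun β m => by
      rw [gcoeff_def, map_mul, Module.End.mul_apply, hx]; rfl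
    rw [map_mul, Module.End.mul_apply, hx]
    simp_rw [h, hy, mul_sum, sum_mul, sum_sigma']
    refine sum_nbij' (fun p => ⟨(p.1.1 + p.2.1, p.2.2), (p.1.1, p.2.1)⟩)
      (fun p => ⟨(p.2.1, p.2.2 + p.1.2), (p.2.2, p.1.2)⟩) ?_ ?_ ?_ ?_ ?_
    · rintro ⟨⟨a, b⟩, ⟨c, d⟩⟩ h
      simp only [mem_sigma, HasAntidiagonal.mem_antidiagonal, and_true] at h ⊢
      omega
    · rintro ⟨⟨a, b⟩, ⟨c, d⟩⟩ h
      simp only [mem_sigma, HasAntidiagonal.mem_antidiagonal, and_true] at h ⊢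
      omega
    · rintro ⟨⟨a, b⟩, ⟨c, d⟩⟩ h
      simp only [mem_sigma, HasAntidiagonal.mem_antidiagonal] at h
      obtain ⟨-, rfl⟩ := h
      rfl
    · rintro ⟨⟨a, b⟩, ⟨c, d⟩⟩ h
      simp only [mem_sigma, HasAntidiagonal.mem_antidiagonal] at h
      obtain ⟨-, rfl⟩ := h
      rfl
    · rintro ⟨⟨a, b⟩, ⟨c, d⟩⟩ h
      simp only [mem_sigma, HasAntidiagonal.mem_antidiagonal] at h
      obtain ⟨-, rfl⟩ := h
      simp [← Function.iterate_add_apply, mul_assoc]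
  | add x y hx hy =>
    intro w α n
    simp only [map_add, LinearMap.add_apply, Pi.add_apply, hx, hy, add_mul, sum_add_distrib]

open Finset in
theorem gcoeff_mul (x y : Q.GentleAlgebra k) (α : E) (n : ℕ) :
    Q.gcoeff (x * y) α n =
      ∑ p ∈ antidiagonal n, Q.gcoeff x (Q.σ^[p.2] α) p.1 * Q.gcoeff y α p.2 := by
  rw [gcoeff_def, map_mul, Module.End.mul_apply, rep_apply]; rfl

end CyclicGentleQuiver

namespace CyclicGentleQuiver

variable {V E : Type*} (Q : CyclicGentleQuiver V E) {k : Type*} [Field k] [Fintype V]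

/-! ### Paths in the gentle algebra -/

theorem gcoeff_arrow_mul_zero (β : E) (x : Q.GentleAlgebra k) (α : E) :
    Q.gcoeff (Q.arrow k β * x) α 0 = 0 := by
  rw [gcoeff_def, map_mul, rep_arrow]; rfl

open Classical in
theorem gcoeff_arrow_mul_succ (β : E) (x : Q.GentleAlgebra k) (α : E) (n : ℕ) :
    Q.gcoeff (Q.arrow k β * x) α (n + 1) = if Q.σ^[n] α = β then Q.gcoeff x α n else 0 := by
  rw [gcoeff_def, map_mul, rep_arrow]; rfl

open Classical in
theorem gcoeff_path_succ (β : E) (m : ℕ) (α : E) (n : ℕ) :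
    Q.gcoeff (Q.path k β (m + 1)) α n = if n = m + 1 ∧ α = β then 1 else 0 := by
  induction m generalizing n with
  | zero =>
    rw [path, path]
    cases n with
    | zero => rw [gcoeff_arrow_mul_zero]; simp
    | succ n =>
      rw [gcoeff_arrow_mul_succ, gcoeff_vertex]
      rcases n with _ | n
      · by_cases h : α = β <;> simp [h]
      · simp
  | succ m ih =>
    rw [path]
    cases n with
    | zero => rw [gcoeff_arrow_mul_zero]; simp
    | succ n =>
      rw [gcoeff_arrow_mul_succ, ih]
      by_cases h : n = m + 1 ∧ α = β
      · obtain ⟨rfl, rfl⟩ := h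
        simp
      · rw [if_neg h, ite_self, if_neg (by simpa using h)]

theorem path_one (α : E) : Q.path k α 1 = Q.arrow k α := by
  rw [path, path]; exact Q.arrow_mul_vertex k α

/-- The paths that are not in `I` span `kQ / I`: their span contains the unit and is stable under
left multiplication by the generators. -/
theorem mem_span_path (x : Q.GentleAlgebra k) :
    x ∈ Submodule.span k (Set.range fun q : E × ℕ => Q.path k q.1 q.2) := by
  set S := Submodule.span k (Set.range fun q : E × ℕ => Q.path k q.1 q.2) with hS
  have hp : ∀ (α : E) (n : ℕ), Q.path k α n ∈ S := fun α n => Submodule.subset_span ⟨(α, n), rfl⟩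
  have key : ∀ y ∈ S, x * y ∈ S := by
    induction x using Q.gentle_induction with
    | scalar r => intro y hy; rw [← Algebra.smul_def]; exact S.smul_mem r hy
    | vertex i =>
      intro y hy
      induction hy using Submodule.span_induction with
      | mem y hy =>
        obtain ⟨⟨α, n⟩, rfl⟩ := hy
        simp only
        by_cases h : Q.s (Q.σ^[n] α) = i
        · rw [← h, vertex_mul_path]; exact hp α n
        · rw [← vertex_mul_path, ← mul_assoc, Q.vertex_mul_vertex k (Ne.symm h), zero_mul]
          exact S.zero_mem
      | zero => rw [mul_zero]; exact S.zero_mem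
      | add y z _ _ hy hz => rw [mul_add]; exact S.add_mem hy hz
      | smul c y _ hy => rw [mul_smul_comm]; exact S.smul_mem c hy
    | arrow β =>
      intro y hy
      induction hy using Submodule.span_induction with
      | mem y hy =>
        obtain ⟨⟨α, n⟩, rfl⟩ := hy
        simp only
        by_cases h : β = Q.σ^[n] α
        · rw [h]; exact hp α (n + 1)
        · rcases n.eq_zero_or_pos with rfl | hn
          · by_cases h2 : Q.s β = Q.s α
            · rw [path, ← h2, arrow_mul_vertex, ← path_one]; exact hp β 1
            · rw [path, ← arrow_mul_vertex, mul_assoc, Q.vertex_mul_vertex k h2, mul_zero]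
              exact S.zero_mem
          · rw [Q.arrow_mul_path k hn h]; exact S.zero_mem
      | zero => rw [mul_zero]; exact S.zero_mem
      | add y z _ _ hy hz => rw [mul_add]; exact S.add_mem hy hz
      | smul c y _ hy => rw [mul_smul_comm]; exact S.smul_mem c hy
    | mul x y hx hy => intro z hz; rw [mul_assoc]; exact hx _ (hy _ hz)
    | add x y hx hy => intro z hz; rw [add_mul]; exact S.add_mem (hx _ hz) (hy _ hz)
  rw [← mul_one x, ← Q.sum_vertex k]
  refine key _ (S.sum_mem fun i _ => ?_)
  obtain ⟨α, rfl⟩ := Q.exists_source i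
  exact hp α 0

theorem path_mem_pow (α : E) (n : ℕ) : Q.path k α n ∈ Q.arrowIdeal k ^ n := by
  induction n with
  | zero => rw [Submodule.pow_zero, Ideal.one_eq_top]; trivial
  | succ n ih =>
    rw [path]
    rcases n.eq_zero_or_pos with rfl | hn
    · rw [zero_add, Submodule.pow_one]; exact Ideal.mul_mem_right _ _ (Q.arrow_mem k _)
    · rw [add_comm, Submodule.pow_add _ hn.ne', Submodule.pow_one]
      exact Ideal.mul_mem_mul (Q.arrow_mem k _) ih

/-- The ideal of elements without constant terms. -/
def constFree : Ideal (Q.GentleAlgebra k) where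
  carrier := {x | ∀ α, Q.gcoeff x α 0 = 0}
  add_mem' hx hy α := by simp [hx α, hy α]
  zero_mem' α := by simp
  smul_mem' c x hx α := by simp [gcoeff_mul, hx α]

instance : (Q.constFree (k := k)).IsTwoSided :=
  ⟨fun {x} y hx α => by
    change Q.gcoeff (x * y) α 0 = 0
    simp [gcoeff_mul, show Q.gcoeff x α 0 = 0 from hx α]⟩

theorem arrowIdeal_le_constFree : Q.arrowIdeal k ≤ Q.constFree := by
  refine asIdeal_span_le ?_
  rintro _ ⟨α, rfl⟩ β
  simp [gcoeff_arrow]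

/-- Elements of the `n`-th power of the arrow ideal involve only paths of length at least `n`. -/
theorem gcoeff_eq_zero_of_mem_pow {n : ℕ} {x : Q.GentleAlgebra k}
    (hx : x ∈ Q.arrowIdeal k ^ n) (α : E) (m : ℕ) (hm : m < n) : Q.gcoeff x α m = 0 := by
  induction n generalizing x α m with
  | zero => omega
  | succ n ih =>
    rw [Submodule.pow_succ] at hx
    induction hx using Submodule.mul_induction_on' with
    | mem_mul_mem y hy z hz =>
      rw [gcoeff_mul]
      refine Finset.sum_eq_zero fun p hp => ?_
      rw [Finset.HasAntidiagonal.mem_antidiagonal] at hp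
      rcases Nat.eq_zero_or_pos p.2 with h | h
      · rw [h, Q.arrowIdeal_le_constFree hz α, mul_zero]
      · rw [ih hy _ _ (by omega), zero_mul]
    | add y _ z _ hy hz => simp [hy, hz]

variable [Fintype E]

variable (k) in
/-- The element of `kQ / I` whose coefficients at the paths of length less than `n` are given by
a family of scalars (and at paths of length zero, for `n = 0`). The coefficient of `e_i` is read
off from one arrow that starts at `i`. -/
def ofFamily (n : ℕ) : (E → ℕ → k) →ₗ[k] Q.GentleAlgebra k where
  toFun f := ∑ i, f (Q.exists_source i).choose 0 • Q.vertex k i +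
    ∑ α, ∑ m ∈ Finset.Ico 1 n, f α m • Q.path k α m
  map_add' f g := by
    simp only [Pi.add_apply, add_smul, Finset.sum_add_distrib]; abel
  map_smul' c f := by
    simp only [Pi.smul_apply, smul_assoc, ← Finset.smul_sum, ← smul_add, RingHom.id_apply]

theorem ofFamily_apply (n : ℕ) (f : E → ℕ → k) :
    Q.ofFamily k n f = ∑ i, f (Q.exists_source i).choose 0 • Q.vertex k i +
      ∑ α, ∑ m ∈ Finset.Ico 1 n, f α m • Q.path k α m := rfl

theorem gcoeff_ofFamily {f : E → ℕ → k} (hf : ∀ α β, Q.s α = Q.s β → f α 0 = f β 0) {n m : ℕ}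
    (α : E) (hm : m < n) : Q.gcoeff (Q.ofFamily k n f) α m = f α m := by
  classical
  rw [ofFamily_apply]
  simp only [map_add, map_sum, map_smul, Pi.add_apply, Finset.sum_apply, Pi.smul_apply,
    gcoeff_vertex, smul_eq_mul]
  have h : ∀ β, ∀ j ∈ Finset.Ico 1 n, f β j * Q.gcoeff (Q.path k β j) α m =
      if m = j ∧ α = β then f α m else 0 := by
    intro β j hj
    obtain ⟨j, rfl⟩ := Nat.exists_eq_add_of_le' (Finset.mem_Ico.1 hj).1
    rw [gcoeff_path_succ]
    split_ifs with h
    · rw [h.1, h.2, mul_one]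
    · rw [mul_zero]
  rw [Finset.sum_congr rfl fun β _ => Finset.sum_congr rfl (h β)]
  rcases m with _ | m
  · have h2 : ∀ β, ∀ j ∈ Finset.Ico 1 n, (if 0 = j ∧ α = β then f α 0 else 0) = 0 := by
      intro β j hj
      rw [if_neg]
      rintro ⟨rfl, -⟩
      simp at hj
    rw [Finset.sum_congr rfl fun β _ => Finset.sum_eq_zero (h2 β), Finset.sum_const_zero, add_zero,
      Finset.sum_eq_single_of_mem (Q.s α) (Finset.mem_univ _)]
    · simp [hf _ _ (Q.exists_source (Q.s α)).choose_spec]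
    · intro i _ hi
      simp [hi.symm]
  · rw [Finset.sum_eq_zero, zero_add, Finset.sum_eq_single_of_mem α (Finset.mem_univ _),
      Finset.sum_eq_single_of_mem (m + 1) (by simp; omega)]
    · simp
    · intro j _ hj; simp [hj.symm]
    · intro β _ hβ; simp [hβ.symm]
    · intro i _; simp

/-- Modulo the `n`-th power of the arrow ideal, an element is determined by its coefficients at the
paths of length less than `n`. -/
theorem sub_ofFamily_mem (n : ℕ) (x : Q.GentleAlgebra k) :
    x - Q.ofFamily k n (Q.gcoeff x) ∈ Q.arrowIdeal k ^ n := by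
  classical
  rcases n.eq_zero_or_pos with rfl | hn
  · rw [Submodule.pow_zero, Ideal.one_eq_top]; trivial
  have hx := Q.mem_span_path x
  induction hx using Submodule.span_induction with
  | mem x hx =>
    obtain ⟨⟨β, m⟩, rfl⟩ := hx
    simp only
    rcases m with _ | m
    · convert Submodule.zero_mem _
      rw [path, sub_eq_zero, ofFamily_apply, Finset.sum_eq_single_of_mem (Q.s β)
        (Finset.mem_univ _), Finset.sum_eq_zero]
      · simp [gcoeff_vertex, (Q.exists_source (Q.s β)).choose_spec]
      · intro α _
        refine Finset.sum_eq_zero fun j hj => ?_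
        have : j ≠ 0 := by rintro rfl; simp at hj
        simp [gcoeff_vertex, this]
      · intro i _ hi
        simp [gcoeff_vertex, (Q.exists_source i).choose_spec, hi]
    · have h1 : ∑ i, Q.gcoeff (Q.path k β (m + 1)) (Q.exists_source i).choose 0 • Q.vertex k i
          = 0 := Finset.sum_eq_zero fun i _ => by simp [gcoeff_path_succ]
      rw [ofFamily_apply, h1, zero_add, Finset.sum_eq_single_of_mem β (Finset.mem_univ _)]
      · by_cases h : m + 1 < n
        · rw [Finset.sum_eq_single_of_mem (m + 1) (by simp [h])]
          · simp [gcoeff_path_succ]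
          · intro j _ hj; simp [gcoeff_path_succ, hj]
        · rw [Finset.sum_eq_zero, sub_zero]
          · exact Ideal.pow_le_pow_right (not_lt.1 h) (Q.path_mem_pow β _)
          · intro j hj
            have : j ≠ m + 1 := by rintro rfl; simp at hj; omega
            simp [gcoeff_path_succ, this]
      · intro α _ hα
        simp [gcoeff_path_succ, hα]
  | zero => simp
  | add x y _ _ hx hy =>
    rw [map_add, map_add, add_sub_add_comm]; exact Submodule.add_mem _ hx hy
  | smul c x _ hx =>
    rw [map_smul, map_smul, ← smul_sub, Algebra.smul_def]; exact Ideal.mul_mem_left _ _ hx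

end CyclicGentleQuiver

namespace CyclicGentleQuiver

variable {V E : Type*} (Q : CyclicGentleQuiver V E) {k : Type*} [Field k] [Fintype V]

/-! ### Coefficients in the completed algebra -/

/-- The component of an element of `A` modulo the `n`-th power of the arrow ideal. -/
def component (n : ℕ) : Q.CompletedAlgebra k →+* Q.GentleAlgebra k ⧸ Q.arrowIdeal k ^ n :=
  (Pi.evalRingHom (fun n => Q.GentleAlgebra k ⧸ Q.arrowIdeal k ^ n) n).comp
    (idealCompletion (Q.arrowIdeal k)).subtype

theorem component_add (n : ℕ) (x y : Q.CompletedAlgebra k) :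
    Q.component n (x + y) = Q.component n x + Q.component n y := RingHom.map_add _ x y

theorem component_mul (n : ℕ) (x y : Q.CompletedAlgebra k) :
    Q.component n (x * y) = Q.component n x * Q.component n y := RingHom.map_mul _ x y

theorem component_toCompleted (n : ℕ) (x : Q.GentleAlgebra k) :
    Q.component n (Q.toCompleted k x) = Ideal.Quotient.mk _ x := rfl

theorem factor_component {m n : ℕ} (h : m ≤ n) (x : Q.CompletedAlgebra k) :
    Ideal.Quotient.factor (Ideal.pow_le_pow_right h) (Q.component n x) = Q.component m x :=
  x.2 m n h

theorem ext_component {x y : Q.CompletedAlgebra k} (h : ∀ n, Q.component n x = Q.component n y) :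
    x = y := Subtype.ext (funext h)

/-- The coefficient of the path `α_n` in an element of `A`; for `n = 0`, this is the coefficient
of the idempotent at the source of `α`. -/
def coeff (x : Q.CompletedAlgebra k) (α : E) (n : ℕ) : k :=
  Q.gcoeff (Function.surjInv Ideal.Quotient.mk_surjective (Q.component (n + 1) x)) α n

theorem coeff_eq {x : Q.CompletedAlgebra k} {y : Q.GentleAlgebra k} {m n : ℕ} (h : n < m)
    (hy : Q.component m x = Ideal.Quotient.mk _ y) (α : E) : Q.coeff x α n = Q.gcoeff y α n := by
  have h1 := Q.factor_component (Nat.succ_le_of_lt h) x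
  rw [hy, Ideal.Quotient.factor_mk] at h1
  have h2 := (Function.surjInv_eq Ideal.Quotient.mk_surjective
    (Q.component (n + 1) x)).trans h1.symm
  rw [Ideal.Quotient.eq] at h2
  have h3 := Q.gcoeff_eq_zero_of_mem_pow h2 α n (Nat.lt_succ_self n)
  rw [map_sub, Pi.sub_apply, Pi.sub_apply, sub_eq_zero] at h3
  exact h3

theorem exists_lift (x : Q.CompletedAlgebra k) (m : ℕ) :
    ∃ y, Q.component m x = Ideal.Quotient.mk _ y ∧
      ∀ α, ∀ n < m, Q.coeff x α n = Q.gcoeff y α n := by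
  obtain ⟨y, hy⟩ := Ideal.Quotient.mk_surjective (Q.component m x)
  exact ⟨y, hy.symm, fun α n h => Q.coeff_eq h hy.symm α⟩

theorem coeff_toCompleted (x : Q.GentleAlgebra k) : Q.coeff (Q.toCompleted k x) = Q.gcoeff x := by
  ext α n
  exact Q.coeff_eq (Nat.lt_succ_self n) (Q.component_toCompleted _ x) α

theorem coeff_add (x y : Q.CompletedAlgebra k) : Q.coeff (x + y) = Q.coeff x + Q.coeff y := by
  ext α n
  obtain ⟨x', hx, hx'⟩ := Q.exists_lift x (n + 1)
  obtain ⟨y', hy, hy'⟩ := Q.exists_lift y (n + 1)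
  rw [Pi.add_apply, Pi.add_apply, hx' _ _ n.lt_succ_self, hy' _ _ n.lt_succ_self,
    Q.coeff_eq (y := x' + y') n.lt_succ_self (by rw [component_add, RingHom.map_add, hx, hy])]
  simp

variable (k) in
/-- The coefficient map as a homomorphism of additive groups. -/
def coeffHom : Q.CompletedAlgebra k →+ (E → ℕ → k) := AddMonoidHom.mk' Q.coeff Q.coeff_add

theorem coeff_zero : Q.coeff (0 : Q.CompletedAlgebra k) = 0 := map_zero (Q.coeffHom k)

theorem coeff_sub (x y : Q.CompletedAlgebra k) : Q.coeff (x - y) = Q.coeff x - Q.coeff y :=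
  map_sub (Q.coeffHom k) x y

theorem coeff_sum {ι : Type*} (s : Finset ι) (f : ι → Q.CompletedAlgebra k) :
    Q.coeff (∑ i ∈ s, f i) = ∑ i ∈ s, Q.coeff (f i) := map_sum (Q.coeffHom k) f s

theorem coeff_mul (x y : Q.CompletedAlgebra k) (α : E) (n : ℕ) :
    Q.coeff (x * y) α n = ∑ p ∈ Finset.HasAntidiagonal.antidiagonal n,
      Q.coeff x (Q.σ^[p.2] α) p.1 * Q.coeff y α p.2 := by
  obtain ⟨x', hx, hx'⟩ := Q.exists_lift x (n + 1)
  obtain ⟨y', hy, hy'⟩ := Q.exists_lift y (n + 1)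
  rw [Q.coeff_eq (y := x' * y') n.lt_succ_self (by rw [component_mul, RingHom.map_mul, hx, hy]),
    gcoeff_mul]
  refine Finset.sum_congr rfl fun p hp => ?_
  rw [Finset.HasAntidiagonal.mem_antidiagonal] at hp
  rw [hx' _ _ (by omega), hy' _ _ (by omega)]

theorem coeff_one (α : E) (n : ℕ) :
    Q.coeff (1 : Q.CompletedAlgebra k) α n = if n = 0 then 1 else 0 := by
  rw [← map_one (Q.toCompleted k), coeff_toCompleted, gcoeff_one]

open Classical in
theorem coeff_e (i : V) (α : E) (n : ℕ) :
    Q.coeff (Q.e k i) α n = if n = 0 ∧ Q.s α = i then 1 else 0 := by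
  rw [e, coeff_toCompleted, gcoeff_vertex]

open Classical in
theorem coeff_p {n : ℕ} (hn : 0 < n) (β α : E) (m : ℕ) :
    Q.coeff (Q.p k β n) α m = if m = n ∧ α = β then 1 else 0 := by
  obtain ⟨n, rfl⟩ := Nat.exists_eq_add_of_le' hn
  rw [p, coeff_toCompleted, gcoeff_path_succ]

theorem p_one (α : E) : Q.p k α 1 = Q.a k α := by rw [p, path_one, a]

open Classical in
theorem coeff_a (β α : E) (m : ℕ) :
    Q.coeff (Q.a k β) α m = if m = 1 ∧ α = β then 1 else 0 := by
  rw [← p_one, Q.coeff_p one_pos]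

theorem gcoeff_zero_eq {α β : E} (h : Q.s α = Q.s β) (y : Q.GentleAlgebra k) :
    Q.gcoeff y α 0 = Q.gcoeff y β 0 := by
  have hs := Q.mem_span_path y
  induction hs using Submodule.span_induction with
  | mem y hy =>
    obtain ⟨⟨γ, m⟩, rfl⟩ := hy
    classical
    rcases m with _ | m
    · simp [path, gcoeff_vertex, h]
    · simp [gcoeff_path_succ]
  | zero => simp
  | add y z _ _ hy hz => simp [hy, hz]
  | smul c y _ hy => simp [hy]

theorem coeff_zero_eq {α β : E} (h : Q.s α = Q.s β) (x : Q.CompletedAlgebra k) :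
    Q.coeff x α 0 = Q.coeff x β 0 := by
  obtain ⟨y, -, hy⟩ := Q.exists_lift x 1
  rw [hy _ _ one_pos, hy _ _ one_pos, Q.gcoeff_zero_eq h]

variable [Fintype E]

/-- An element of `A` is determined by its coefficients. -/
theorem ext_coeff {x y : Q.CompletedAlgebra k} (h : ∀ α n, Q.coeff x α n = Q.coeff y α n) :
    x = y := by
  refine Q.ext_component fun n => ?_
  obtain ⟨x', hx, hx'⟩ := Q.exists_lift x n
  obtain ⟨y', hy, hy'⟩ := Q.exists_lift y n
  rcases n.eq_zero_or_pos with rfl | hn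
  · rw [hx, hy, Ideal.Quotient.eq, Submodule.pow_zero, Ideal.one_eq_top]; trivial
  have h1 := Q.sub_ofFamily_mem n (x' - y')
  have h2 : ∀ α, ∀ m < n, Q.gcoeff (x' - y') α m = 0 := fun α m hm => by
    rw [map_sub, Pi.sub_apply, Pi.sub_apply, ← hx' _ _ hm, ← hy' _ _ hm, h, sub_self]
  rw [ofFamily_apply, Finset.sum_eq_zero fun i _ => by rw [h2 _ _ hn, zero_smul],
    Finset.sum_eq_zero fun α _ => Finset.sum_eq_zero fun m hm => by
      rw [h2 _ _ (Finset.mem_Ico.1 hm).2, zero_smul], add_zero, sub_zero] at h1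
  rw [hx, hy, Ideal.Quotient.eq]
  exact h1

/-- The only condition on the coefficients of an element of `A` is that those of the paths `α_0`
depend only on the source of `α`. -/
theorem exists_coeff_eq {f : E → ℕ → k} (hf : ∀ α β, Q.s α = Q.s β → f α 0 = f β 0) :
    ∃ x : Q.CompletedAlgebra k, Q.coeff x = f := by
  let x : Q.CompletedAlgebra k := ⟨fun n => Ideal.Quotient.mk _ (Q.ofFamily k n f), by
    intro m n h
    rw [Ideal.Quotient.factor_mk, Ideal.Quotient.eq]
    rcases m.eq_zero_or_pos with rfl | hm
    · rw [Submodule.pow_zero, Ideal.one_eq_top]; trivial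
    rw [ofFamily_apply, ofFamily_apply, add_sub_add_left_eq_sub, ← Finset.sum_sub_distrib]
    refine Submodule.sum_mem _ fun α _ => ?_
    rw [← Finset.sum_sdiff (Finset.Ico_subset_Ico_right h), add_sub_cancel_right]
    refine Submodule.sum_mem _ fun j hj => ?_
    have : m ≤ j := by simp at hj; omega
    rw [Algebra.smul_def]
    exact Ideal.mul_mem_left _ _ (Ideal.pow_le_pow_right this (Q.path_mem_pow α j))⟩
  refine ⟨x, ?_⟩
  ext α n
  rw [Q.coeff_eq (y := Q.ofFamily k (n + 1) f) n.lt_succ_self rfl,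
    Q.gcoeff_ofFamily hf _ n.lt_succ_self]

/-! ### The action of power series and of `ν` on coefficients -/

open Classical in
theorem gcoeff_cycleSum (α : E) (n : ℕ) :
    Q.gcoeff (Q.cycleSum k) α n = if n = Q.ℓ α then 1 else 0 := by
  rw [cycleSum, map_sum, Finset.sum_apply, Finset.sum_apply]
  have h : ∀ β, Q.gcoeff (Q.path k β (Q.ℓ β)) α n = if n = Q.ℓ β ∧ α = β then 1 else 0 := by
    intro β
    obtain ⟨m, hm⟩ := Nat.exists_eq_succ_of_ne_zero (Q.ℓ_pos β).ne'
    rw [hm, gcoeff_path_succ]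
  rw [Finset.sum_congr rfl fun β _ => h β, Finset.sum_eq_single_of_mem α (Finset.mem_univ _)]
  · simp
  · intro β _ hβ; simp [hβ.symm]

theorem ℓ_iterate_σ (α : E) (n : ℕ) : Q.ℓ (Q.σ^[n] α) = Q.ℓ α := by
  induction n with
  | zero => rfl
  | succ n ih => rw [Function.iterate_succ_apply', Q.ℓ_σ, ih]

theorem iterate_mul_ℓ (α : E) (n : ℕ) : Q.σ^[n * Q.ℓ α] α = α := by
  rw [mul_comm, Function.iterate_mul]
  exact Function.IsFixedPt.iterate (Q.iterate_ℓ α) n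

open Classical in
theorem gcoeff_cycleSum_pow (i : ℕ) (α : E) (n : ℕ) :
    Q.gcoeff (Q.cycleSum k ^ i) α n = if n = i * Q.ℓ α then 1 else 0 := by
  induction i generalizing α n with
  | zero => rw [pow_zero, gcoeff_one, zero_mul]
  | succ i ih =>
    rw [pow_succ, gcoeff_mul]
    simp only [ih, gcoeff_cycleSum, ℓ_iterate_σ]
    split_ifs with h
    · rw [Finset.sum_eq_single_of_mem (i * Q.ℓ α, Q.ℓ α) (by simp [h, add_mul])]
      · simp
      · rintro ⟨a, b⟩ _ hab
        by_cases h1 : a = i * Q.ℓ α <;> by_cases h2 : b = Q.ℓ α <;> simp_all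
    · refine Finset.sum_eq_zero fun p hp => ?_
      rw [Finset.HasAntidiagonal.mem_antidiagonal] at hp
      by_cases h1 : p.1 = i * Q.ℓ α <;> by_cases h2 : p.2 = Q.ℓ α <;> simp_all [add_mul]

open Classical in
/-- The power `c^m` acts as the sum of the powers `c_α^m`, which are the paths of length `m ℓ_α`
beginning with `α`. -/
theorem coeff_algebraMap (f : k⟦X⟧) (α : E) (n : ℕ) :
    Q.coeff (algebraMap k⟦X⟧ (Q.CompletedAlgebra k) f) α n =
      if Q.ℓ α ∣ n then PowerSeries.coeff (n / Q.ℓ α) f else 0 := by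
  rw [Q.coeff_eq (y := Polynomial.aeval (Q.cycleSum k) (PowerSeries.trunc (n + 1) f))
    n.lt_succ_self rfl, Polynomial.aeval_eq_sum_range' (n := n + 1)
    (PowerSeries.natDegree_trunc_lt f n)]
  simp only [map_sum, map_smul, Finset.sum_apply, Pi.smul_apply, gcoeff_cycleSum_pow, smul_eq_mul,
    PowerSeries.coeff_trunc]
  split_ifs with h
  · obtain ⟨m, rfl⟩ := h
    have hm : m < Q.ℓ α * m + 1 := Nat.lt_succ_of_le (Nat.le_mul_of_pos_left _ (Q.ℓ_pos α))
    rw [Nat.mul_div_cancel_left _ (Q.ℓ_pos α),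
      Finset.sum_eq_single_of_mem m (Finset.mem_range.2 hm)]
    · rw [if_pos hm, if_pos (mul_comm _ _), mul_one]
    · intro j _ hj
      rw [if_neg (c := Q.ℓ α * m = j * Q.ℓ α), mul_zero]
      rw [mul_comm]
      exact fun h => hj (Nat.eq_of_mul_eq_mul_right (Q.ℓ_pos α) h).symm
  · refine Finset.sum_eq_zero fun j _ => ?_
    rw [if_neg (c := n = j * Q.ℓ α), mul_zero]
    rintro rfl
    exact h (Dvd.intro_left j rfl)

/-- On the residue class of `r` modulo `ℓ_α`, the coefficients of `α_n` are multiplied like those of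
power series. -/
theorem coeff_smul (f : k⟦X⟧) (x : Q.CompletedAlgebra k) (α : E) {r : ℕ} (hr : r < Q.ℓ α) (m : ℕ) :
    Q.coeff (f • x) α (m * Q.ℓ α + r) = ∑ p ∈ Finset.HasAntidiagonal.antidiagonal m,
      PowerSeries.coeff p.1 f * Q.coeff x α (p.2 * Q.ℓ α + r) := by
  have hℓ := Q.ℓ_pos α
  rw [Algebra.smul_def, coeff_mul]
  simp only [coeff_algebraMap, ℓ_iterate_σ]
  symm
  refine Finset.sum_of_injOn (fun p => (p.1 * Q.ℓ α, p.2 * Q.ℓ α + r)) ?_ ?_ ?_ ?_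
  · rintro ⟨a, b⟩ _ ⟨c, d⟩ _ h
    simp only [Prod.mk.injEq, Nat.add_right_cancel_iff] at h
    exact Prod.ext (Nat.eq_of_mul_eq_mul_right hℓ h.1) (Nat.eq_of_mul_eq_mul_right hℓ h.2)
  · rintro ⟨a, b⟩ h
    simp only [Finset.mem_coe, Finset.HasAntidiagonal.mem_antidiagonal] at h ⊢
    rw [← h]; ring
  · rintro ⟨a, b⟩ h h'
    rw [if_neg, zero_mul]
    rintro ⟨c, rfl⟩
    simp only [Finset.HasAntidiagonal.mem_antidiagonal] at h
    apply h'
    have hc : c ≤ m := by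
      by_contra hc
      have : (m + 1) * Q.ℓ α ≤ Q.ℓ α * c := by
        rw [mul_comm]; exact Nat.mul_le_mul_left _ (by omega)
      rw [add_mul] at this
      omega
    obtain ⟨d, rfl⟩ := Nat.exists_eq_add_of_le hc
    refine ⟨(c, d), by simp, ?_⟩
    have : b = d * Q.ℓ α + r := by
      have h2 : (c + d) * Q.ℓ α = Q.ℓ α * c + d * Q.ℓ α := by ring
      omega
    rw [this, mul_comm]
  · rintro ⟨a, b⟩ _
    simp [hℓ]

/-- The signs of the inner arrows of a path cancel, so that only its first arrow and the successor
of its last arrow contribute to the sign by which `ν` multiplies it. -/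
theorem gcoeff_νGentle (ε : E → ℤˣ) (x : Q.GentleAlgebra k) : ∀ (α : E) (n : ℕ),
    Q.gcoeff (Q.νGentle k ε x) α n =
      ((ε (Q.σ^[n] α) * ε α : ℤˣ) : ℤ) * Q.gcoeff x α n := by
  classical
  induction x using Q.gentle_induction with
  | scalar r =>
    intro α n
    have : Q.νGentle k ε (algebraMap k _ r) = algebraMap k _ r :=
      AlgHom.commutes (Q.νPath k ε) r
    rw [this, gcoeff_algebraMap]
    split_ifs with h
    · subst h; simp
    · simp
  | vertex i =>
    intro α n
    rw [νGentle_vertex, gcoeff_vertex]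
    split_ifs with h
    · simp [h.1]
    · simp
  | arrow β =>
    intro α n
    rw [νGentle_arrow, map_zsmul, Pi.smul_apply, Pi.smul_apply, gcoeff_arrow, zsmul_eq_mul]
    split_ifs with h
    · rw [h.1, h.2]; rfl
    · simp
  | mul x y hx hy =>
    intro α n
    rw [map_mul, gcoeff_mul, gcoeff_mul, Finset.mul_sum]
    refine Finset.sum_congr rfl fun p hp => ?_
    rw [Finset.HasAntidiagonal.mem_antidiagonal] at hp
    rw [hx, hy, ← Function.iterate_add_apply, hp]
    have h : (ε (Q.σ^[n] α) * ε α : ℤˣ) =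
        (ε (Q.σ^[n] α) * ε (Q.σ^[p.2] α)) * (ε (Q.σ^[p.2] α) * ε α) := by
      rw [mul_mul_mul_comm, mul_comm (ε (Q.σ^[p.2] α)), ← mul_mul_mul_comm]
      simp [Int.units_mul_self]
    rw [h, Units.val_mul (ε (Q.σ^[n] α) * ε (Q.σ^[p.2] α)), Int.cast_mul]
    ring
  | add x y hx hy =>
    intro α n
    simp only [map_add, Pi.add_apply, hx, hy, mul_add]

theorem coeff_ν (ε : E → ℤˣ) (x : Q.CompletedAlgebra k) (α : E) (n : ℕ) :
    Q.coeff (Q.ν k ε x) α n = ((ε (Q.σ^[n] α) * ε α : ℤˣ) : ℤ) * Q.coeff x α n := by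
  obtain ⟨y, hy, hy'⟩ := Q.exists_lift x (n + 1)
  rw [hy' _ _ n.lt_succ_self, ← gcoeff_νGentle]
  refine Q.coeff_eq n.lt_succ_self ?_ α
  change Ideal.quotientMap _ (Q.νGentle k ε)
    (idealCompletion.pow_le_comap _ (Q.arrowIdeal_le_comap k ε) _) (Q.component (n + 1) x) = _
  rw [hy, Ideal.quotientMap_mk]

end CyclicGentleQuiver

namespace CyclicGentleQuiver

variable {V E : Type*} (Q : CyclicGentleQuiver V E)

/-! ### Vertices and signs -/

theorem σ_surjective [Finite E] : Function.Surjective Q.σ :=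
  Finite.surjective_of_injective Q.σ_injective

/-- The bijection `σ` maps the arrows ending at a vertex to the arrows starting there. -/
theorem encard_source_eq_target [Finite E] (i : V) :
    {α | Q.s α = i}.encard = {α | Q.t α = i}.encard := by
  have h : Q.σ '' {α | Q.t α = i} = {α | Q.s α = i} := by
    ext β
    constructor
    · rintro ⟨α, hα, rfl⟩
      exact (Q.s_σ α).trans hα
    · intro hβ
      obtain ⟨α, rfl⟩ := Q.σ_surjective β
      exact ⟨α, (Q.s_σ α).symm.trans hβ, rfl⟩
  rw [← h, Q.σ_injective.encard_image]

theorem regular_or_transition [Finite E] (i : V) :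
    Q.IsRegularVertex i ∨ Q.IsTransitionVertex i := by
  have h1 := Q.gentle.starting i
  have h2 : 1 ≤ {α | Q.s α = i}.encard := by
    rw [Set.one_le_encard_iff_nonempty]; exact Q.exists_source i
  have h3 := Q.encard_source_eq_target i
  rw [BoundQuiver.IsRegularVertex, BoundQuiver.IsTransitionVertex, ← h3, and_self, and_self]
  have hfin : {α | Q.s α = i}.Finite := Set.toFinite _
  obtain ⟨n, hn⟩ : ∃ n : ℕ, {α | Q.s α = i}.encard = n := ⟨_, hfin.encard_eq_coe⟩
  rw [hn] at h1 h2 ⊢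
  norm_cast at *
  omega

theorem not_transition_of_regular {i : V} (h : Q.IsRegularVertex i) :
    ¬ Q.IsTransitionVertex i := fun h' => by
  have := h.1.symm.trans h'.1
  norm_num at this

theorem eq_of_transition {i : V} (h : Q.IsTransitionVertex i) {α β : E} (hα : Q.s α = i)
    (hβ : Q.s β = i) : α = β := by
  obtain ⟨γ, hγ⟩ := Set.encard_eq_one.1 h.1
  have h1 : α ∈ {α | Q.s α = i} := hα
  have h2 : β ∈ {α | Q.s α = i} := hβ
  rw [hγ] at h1 h2
  exact h1.trans h2.symm

namespace IsSignChoice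

variable {Q} {ε : E → ℤˣ} (hε : Q.IsSignChoice ε)
include hε

theorem exists_neg [Finite E] (i : V) : ∃ α, Q.s α = i ∧ ε α = -1 := by
  obtain ⟨α, hα⟩ := Q.exists_source i
  rcases Q.regular_or_transition i with h | h
  · obtain ⟨β, γ, hne, h2⟩ := Set.encard_eq_two.1 h.1
    have hβ : Q.s β = i := by
      have : β ∈ {α | Q.s α = i} := by rw [h2]; simp
      exact this
    have hγ : Q.s γ = i := by
      have : γ ∈ {α | Q.s α = i} := by rw [h2]; simp
      exact this
    rcases Int.units_eq_one_or (ε β) with h3 | h3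
    · refine ⟨γ, hγ, (Int.units_eq_one_or _).resolve_left fun h4 => ?_⟩
      exact hε.ne hne (hβ.trans hγ.symm) (h3.trans h4.symm)
    · exact ⟨β, hβ, h3⟩
  · exact ⟨α, hα, hε.transition (hα ▸ h)⟩

theorem exists_pos {i : V} (h : Q.IsRegularVertex i) : ∃ α, Q.s α = i ∧ ε α = 1 := by
  obtain ⟨β, γ, hne, h2⟩ := Set.encard_eq_two.1 h.1
  have hβ : Q.s β = i := by
    have : β ∈ {α | Q.s α = i} := by rw [h2]; simp
    exact this
  have hγ : Q.s γ = i := by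
    have : γ ∈ {α | Q.s α = i} := by rw [h2]; simp
    exact this
  rcases Int.units_eq_one_or (ε β) with h3 | h3
  · exact ⟨β, hβ, h3⟩
  · refine ⟨γ, hγ, (Int.units_eq_one_or _).resolve_right fun h4 => ?_⟩
    exact hε.ne hne (hβ.trans hγ.symm) (h3.trans h4.symm)

theorem eq_of_sign {α β : E} (h : Q.s α = Q.s β) (h' : ε α = ε β) : α = β :=
  by_contra fun hne => hε.ne hne h h'

theorem regular [Finite E] {β : E} (h : ε β = 1) : Q.IsRegularVertex (Q.s β) :=
  (Q.regular_or_transition _).resolve_right fun h' => by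
    have := h.symm.trans (hε.transition h')
    exact absurd this (by decide)

/-- The arrow of sign `-1` that starts at a vertex. Each vertex, regular or transition, has exactly
one. -/
def neg [Finite E] (i : V) : E := (hε.exists_neg i).choose

theorem s_neg [Finite E] (i : V) : Q.s (hε.neg i) = i := (hε.exists_neg i).choose_spec.1

theorem ε_neg [Finite E] (i : V) : ε (hε.neg i) = -1 := (hε.exists_neg i).choose_spec.2

theorem neg_s [Finite E] {α : E} (h : ε α = -1) : hε.neg (Q.s α) = α :=
  hε.eq_of_sign (hε.s_neg _) ((hε.ε_neg _).trans h.symm)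

theorem sum_source {M : Type*} [AddCommGroup M] [Fintype E] [DecidableEq V] {β : E} (hβ : ε β = 1)
    (f : E → M) :
    ∑ α with Q.s α = Q.s β, f α = f β + f (hε.neg (Q.s β)) := by
  classical
  have hne : β ≠ hε.neg (Q.s β) := fun h => by
    have := (congrArg ε h).trans (hε.ε_neg _)
    rw [hβ] at this
    exact absurd this (by decide)
  rw [← Finset.sum_pair hne]
  refine Finset.sum_congr (Finset.ext fun α => ?_) fun _ _ => rfl
  simp only [Finset.mem_filter, Finset.mem_univ, true_and, Finset.mem_insert,
    Finset.mem_singleton]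
  constructor
  · intro h
    rcases Int.units_eq_one_or (ε α) with h1 | h1
    · exact Or.inl (hε.eq_of_sign h (h1.trans hβ.symm))
    · exact Or.inr (by rw [← h, hε.neg_s h1])
  · rintro (rfl | rfl)
    · rfl
    · exact hε.s_neg _

end IsSignChoice

variable {k : Type*} [Field k] [Fintype V] [Fintype E]

/-! ### The trace form -/

open Classical in
theorem coeff_mul_e (x : Q.CompletedAlgebra k) (i : V) (α : E) (n : ℕ) :
    Q.coeff (x * Q.e k i) α n = if Q.s α = i then Q.coeff x α n else 0 := by
  rw [coeff_mul, Finset.sum_eq_single_of_mem (n, 0) (by simp)]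
  · simp [coeff_e]
  · rintro ⟨a, b⟩ h1 h2
    rw [coeff_e, if_neg, mul_zero]
    rintro ⟨rfl, -⟩
    simp_all

open Classical in
theorem coeff_e_mul (x : Q.CompletedAlgebra k) (i : V) (α : E) (n : ℕ) :
    Q.coeff (Q.e k i * x) α n = if Q.s (Q.σ^[n] α) = i then Q.coeff x α n else 0 := by
  rw [coeff_mul, Finset.sum_eq_single_of_mem (0, n) (by simp)]
  · simp [coeff_e]
  · rintro ⟨a, b⟩ h1 h2
    rw [coeff_e, if_neg, zero_mul]
    rintro ⟨rfl, -⟩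
    simp_all

theorem e_mul_e_self (i : V) : Q.e k i * Q.e k i = Q.e k i := by
  rw [e, ← map_mul, vertex_mul_vertex_self]

theorem e_mul_e {i j : V} (h : i ≠ j) : Q.e k i * Q.e k j = 0 := by
  rw [e, e, ← map_mul, Q.vertex_mul_vertex k h, map_zero]

theorem sum_e : ∑ i, Q.e k i = 1 := by
  simp only [e]
  rw [← map_sum, sum_vertex, map_one]

theorem coeff_mul_zero (x y : Q.CompletedAlgebra k) (α : E) :
    Q.coeff (x * y) α 0 = Q.coeff x α 0 * Q.coeff y α 0 := by
  simp [coeff_mul]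

variable (k) in
/-- The ideal of the elements whose constant terms at transition vertices vanish. It is the image
of `A°` in `A`. -/
def vanishIdeal : Ideal (Q.CompletedAlgebra k) where
  carrier := {z | ∀ γ, Q.IsTransitionVertex (Q.s γ) → Q.coeff z γ 0 = 0}
  add_mem' hx hy γ hγ := by simp [coeff_add, hx γ hγ, hy γ hγ]
  zero_mem' γ _ := by simp [coeff_zero]
  smul_mem' c x hx γ hγ := by simp [coeff_mul_zero, hx γ hγ]

theorem mem_vanishIdeal {z : Q.CompletedAlgebra k} : z ∈ Q.vanishIdeal k ↔
    ∀ γ, Q.IsTransitionVertex (Q.s γ) → Q.coeff z γ 0 = 0 := Iff.rfl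

instance : (Q.vanishIdeal k).IsTwoSided :=
  ⟨fun {x} y hx => (Q.mem_vanishIdeal).2 fun γ hγ => by
    rw [coeff_mul_zero, hx γ hγ, zero_mul]⟩

theorem e_mem_vanishIdeal {i : V} (hi : Q.IsRegularVertex i) : Q.e k i ∈ Q.vanishIdeal k := by
  classical
  intro γ hγ
  rw [coeff_e, if_neg]
  rintro ⟨-, rfl⟩
  exact Q.not_transition_of_regular hi hγ

theorem a_mem_vanishIdeal (α : E) : Q.a k α ∈ Q.vanishIdeal k := by
  classical
  intro γ _
  simp [coeff_a]

/-- The sum of the coefficients of the admissible cycles `c_α`, weighted with the signs, as a power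
series: its `m`-th coefficient collects the coefficients of the powers `c_α ^ (m + 1)`. -/
def trace (ε : E → ℤˣ) (z : Q.CompletedAlgebra k) : k⟦X⟧ :=
  PowerSeries.mk fun m => ∑ α, ((ε α : ℤ) : k) * Q.coeff z α ((m + 1) * Q.ℓ α)

theorem coeff_trace (ε : E → ℤˣ) (z : Q.CompletedAlgebra k) (m : ℕ) :
    PowerSeries.coeff m (Q.trace ε z) =
      ∑ α, ((ε α : ℤ) : k) * Q.coeff z α ((m + 1) * Q.ℓ α) := PowerSeries.coeff_mk _ _

theorem trace_add (ε : E → ℤˣ) (y z : Q.CompletedAlgebra k) :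
    Q.trace ε (y + z) = Q.trace ε y + Q.trace ε z := by
  ext m
  simp [coeff_trace, coeff_add, mul_add, Finset.sum_add_distrib]

/-- At a regular vertex the two constant terms agree and have opposite signs, at a transition vertex
the constant term vanishes. -/
theorem sum_sign_mul_coeff_zero {ε : E → ℤˣ} (hε : Q.IsSignChoice ε) {z : Q.CompletedAlgebra k}
    (hz : z ∈ Q.vanishIdeal k) : ∑ α, ((ε α : ℤ) : k) * Q.coeff z α 0 = 0 := by
  classical
  rw [← Finset.sum_fiberwise (s := Finset.univ) (g := Q.s)]
  refine Finset.sum_eq_zero fun i _ => ?_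
  rcases Q.regular_or_transition i with h | h
  · obtain ⟨β, rfl, hβ⟩ := hε.exists_pos h
    rw [hε.sum_source hβ, hβ, hε.ε_neg, Q.coeff_zero_eq (hε.s_neg (Q.s β))]
    simp
  · refine Finset.sum_eq_zero fun α hα => ?_
    rw [hz α (by rw [(Finset.mem_filter.1 hα).2]; exact h), mul_zero]

/-- The trace is linear over `k⟦c⟧` on the ideal `A°`. In general, `trace (c z)` also involves the
constant terms of `z`, weighted with the signs. -/
theorem trace_smul {ε : E → ℤˣ} (hε : Q.IsSignChoice ε) (f : k⟦X⟧) {z : Q.CompletedAlgebra k}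
    (hz : z ∈ Q.vanishIdeal k) : Q.trace ε (f • z) = f * Q.trace ε z := by
  ext m
  have h : ∀ α, Q.coeff (f • z) α ((m + 1) * Q.ℓ α) = PowerSeries.coeff (m + 1) f * Q.coeff z α 0 +
      ∑ p ∈ Finset.HasAntidiagonal.antidiagonal m,
        PowerSeries.coeff p.1 f * Q.coeff z α ((p.2 + 1) * Q.ℓ α) := fun α => by
    have := Q.coeff_smul f z α (Q.ℓ_pos α) (m + 1)
    rw [add_zero] at this
    rw [this, Finset.Nat.sum_antidiagonal_succ']
    simp
  rw [coeff_trace, PowerSeries.coeff_mul]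
  simp only [h, coeff_trace, mul_add, Finset.sum_add_distrib, Finset.mul_sum]
  rw [Finset.sum_comm]
  have h2 : ∑ α, ((ε α : ℤ) : k) * (PowerSeries.coeff (m + 1) f * Q.coeff z α 0) = 0 := by
    rw [Finset.sum_congr rfl fun α _ => mul_left_comm _ _ _, ← Finset.mul_sum,
      Q.sum_sign_mul_coeff_zero hε hz, mul_zero]
  rw [h2, zero_add]
  exact Finset.sum_congr rfl fun p _ => Finset.sum_congr rfl fun α _ => mul_left_comm _ _ _

/-- The trace form is symmetric up to the automorphism `ν`: the two factors of a cycle are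
interchanged by rotation, and the sign of the first arrow changes accordingly. -/
theorem trace_mul_ν (ε : E → ℤˣ) (z a : Q.CompletedAlgebra k) :
    Q.trace ε (z * Q.ν k ε a) = Q.trace ε (a * z) := by
  ext m
  rw [coeff_trace, coeff_trace]
  simp only [coeff_mul, coeff_ν, Finset.mul_sum]
  rw [Finset.sum_sigma', Finset.sum_sigma']
  -- a cycle from `α` of the form `β_i α_j`, with `β = σ^j α`, is rotated to the cycle `α_j β_i`
  refine Finset.sum_nbij' (fun p => ⟨Q.σ^[p.2.2] p.1, p.2.swap⟩)
    (fun p => ⟨Q.σ^[p.2.2] p.1, p.2.swap⟩) ?_ ?_ ?_ ?_ ?_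
  · rintro ⟨α, i, j⟩ h
    simp only [Finset.mem_sigma, Finset.mem_univ, true_and,
      Finset.HasAntidiagonal.mem_antidiagonal, Prod.swap, ℓ_iterate_σ] at h ⊢
    omega
  · rintro ⟨α, i, j⟩ h
    simp only [Finset.mem_sigma, Finset.mem_univ, true_and,
      Finset.HasAntidiagonal.mem_antidiagonal, Prod.swap, ℓ_iterate_σ] at h ⊢
    omega
  · rintro ⟨α, i, j⟩ h
    simp only [Finset.mem_sigma, Finset.mem_univ, true_and,
      Finset.HasAntidiagonal.mem_antidiagonal] at h
    simp only [Prod.swap, ← Function.iterate_add_apply, h, iterate_mul_ℓ]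
  · rintro ⟨α, i, j⟩ h
    simp only [Finset.mem_sigma, Finset.mem_univ, true_and,
      Finset.HasAntidiagonal.mem_antidiagonal] at h
    simp only [Prod.swap, ← Function.iterate_add_apply, h, iterate_mul_ℓ]
  · rintro ⟨α, i, j⟩ h
    simp only [Finset.mem_sigma, Finset.mem_univ, true_and,
      Finset.HasAntidiagonal.mem_antidiagonal] at h
    simp only [Prod.swap, ← Function.iterate_add_apply, h, iterate_mul_ℓ]
    have h2 : ((ε α : ℤ) : k) * ((ε α : ℤ) : k) = 1 := by
      rw [← Int.cast_mul, ← Units.val_mul, Int.units_mul_self]; simp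
    rw [Units.val_mul, Int.cast_mul]
    linear_combination (Q.coeff z (Q.σ^[j] α) i * (((ε (Q.σ^[j] α) : ℤ) : k) * Q.coeff a α j)) * h2

/-- The linear form `y ↦ trace (y x)` on `A`, for `x` in the ideal `A°`. -/
def traceForm {ε : E → ℤˣ} (hε : Q.IsSignChoice ε) (x : Q.CompletedAlgebra k)
    (hx : x ∈ Q.vanishIdeal k) : Q.CompletedAlgebra k →ₗ[k⟦X⟧] k⟦X⟧ where
  toFun y := Q.trace ε (y * x)
  map_add' y z := by rw [add_mul, trace_add]
  map_smul' f y := by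
    rw [smul_mul_assoc, Q.trace_smul hε f (Ideal.mul_mem_left _ _ hx)]; rfl

theorem traceForm_apply {ε : E → ℤˣ} (hε : Q.IsSignChoice ε) (x : Q.CompletedAlgebra k)
    (hx : x ∈ Q.vanishIdeal k) (y : Q.CompletedAlgebra k) :
    Q.traceForm hε x hx y = Q.trace ε (y * x) := rfl

/-! ### The basis over the power series ring -/

/-- The coefficients of the paths `α_n`, for `n` in the residue class of `r` modulo `ℓ_α`. -/
def residueCoord (α : E) {r : ℕ} (hr : r < Q.ℓ α) : Q.CompletedAlgebra k →ₗ[k⟦X⟧] k⟦X⟧ where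
  toFun x := PowerSeries.mk fun m => Q.coeff x α (m * Q.ℓ α + r)
  map_add' x y := by ext m; simp [coeff_add]
  map_smul' f x := by
    ext m
    simp [Q.coeff_smul f x α hr, PowerSeries.coeff_mul]

theorem coeff_residueCoord (α : E) {r : ℕ} (hr : r < Q.ℓ α) (x : Q.CompletedAlgebra k) (m : ℕ) :
    PowerSeries.coeff m (Q.residueCoord α hr x) = Q.coeff x α (m * Q.ℓ α + r) := by
  simp [residueCoord]

theorem coeff_traceForm_e {ε : E → ℤˣ} (hε : Q.IsSignChoice ε) {β : E} (hβ : ε β = 1)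
    (x : Q.CompletedAlgebra k) (m : ℕ) :
    PowerSeries.coeff m (Q.traceForm hε _ (Q.e_mem_vanishIdeal (hε.regular hβ)) x) =
      Q.coeff x β ((m + 1) * Q.ℓ β) -
        Q.coeff x (hε.neg (Q.s β)) ((m + 1) * Q.ℓ (hε.neg (Q.s β))) := by
  classical
  rw [traceForm_apply, coeff_trace]
  simp only [coeff_mul_e, mul_ite, mul_zero]
  rw [← Finset.sum_filter, hε.sum_source hβ, hβ, hε.ε_neg]
  simp [sub_eq_add_neg]

/-- The coordinates with respect to the basis. The coordinate of `e_i` collects the constant term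
and the powers of the cycle of sign `-1` at `i`. This cycle is not a basis element; since `c e_i` is
the sum of the cycles at `i`, the coordinate of `c_β` is the difference of the coefficients at the
cycles of sign `1` and `-1`. -/
def coordinate {ε : E → ℤˣ} (hε : Q.IsSignChoice ε) :
    Q.BasisIndex ε → Q.CompletedAlgebra k →ₗ[k⟦X⟧] k⟦X⟧
  | .vertex i => Q.residueCoord (hε.neg i) (Q.ℓ_pos _)
  | .path α _ _ lt => Q.residueCoord α lt
  | .cycle _ sign => Q.traceForm hε _ (Q.e_mem_vanishIdeal (hε.regular sign))

theorem coordinate_basisElement {ε : E → ℤˣ} (hε : Q.IsSignChoice ε) [DecidableEq (Q.BasisIndex ε)]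
    (q q' : Q.BasisIndex ε) :
    Q.coordinate hε q (Q.basisElement k ε q') = if q' = q then 1 else 0 := by
  classical
  have hmod : ∀ {α : E} {m n r : ℕ}, r < Q.ℓ α → m * Q.ℓ α + r = n * Q.ℓ α → r = 0 := by
    intro α m n r hr h
    have := congrArg (· % Q.ℓ α) h
    simpa [Nat.mul_add_mod_self_right, Nat.mod_eq_of_lt hr] using this
  have hlt : ∀ {α : E} {m r n : ℕ}, n < Q.ℓ α → m * Q.ℓ α + r = n → m = 0 := by
    intro α m r n hn h
    by_contra hm
    have := Nat.le_mul_of_pos_left (Q.ℓ α) (Nat.pos_of_ne_zero hm)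
    omega
  have hneg : ∀ {β : E} {i : V}, ε β = 1 → hε.neg i ≠ β := by
    rintro β i h rfl
    rw [hε.ε_neg] at h
    exact absurd h (by decide)
  ext m
  rw [apply_ite (PowerSeries.coeff m), PowerSeries.coeff_one, map_zero]
  cases q with
  | vertex i =>
    rw [coordinate, coeff_residueCoord, add_zero]
    cases q' with
    | vertex j =>
      rw [basisElement, coeff_e, hε.s_neg]
      have := (Q.ℓ_pos (hε.neg i)).ne'
      by_cases h2 : i = j
      · subst h2
        simp [this]
      · rw [if_neg fun h => h2 h.2, if_neg]
        intro h
        cases h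
        exact h2 rfl
    | path α n h1 h2 =>
      rw [basisElement, Q.coeff_p h1, if_neg, if_neg (by simp)]
      rintro ⟨h, rfl⟩
      have := hlt (r := 0) h2 h
      subst this
      omega
    | cycle β hβ =>
      rw [basisElement, c, Q.coeff_p (Q.ℓ_pos β), if_neg, if_neg (by simp)]
      rintro ⟨-, h⟩
      exact hneg hβ h
  | path α n h1 h2 =>
    rw [coordinate, coeff_residueCoord]
    cases q' with
    | vertex j =>
      rw [basisElement, coeff_e, if_neg, if_neg (by simp)]
      omega
    | path α' n' h1' h2' =>
      rw [basisElement, Q.coeff_p h1']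
      by_cases h : BasisIndex.path (ε := ε) α' n' h1' h2' = .path α n h1 h2
      · cases h
        rw [if_pos rfl]
        have := (Q.ℓ_pos α).ne'
        simp [this]
      · rw [if_neg h, if_neg]
        rintro ⟨h3, rfl⟩
        have := hlt h2' h3
        subst this
        apply h
        congr 1
        omega
    | cycle β hβ =>
      rw [basisElement, c, Q.coeff_p (Q.ℓ_pos β), if_neg, if_neg (by simp)]
      rintro ⟨h, rfl⟩
      have := hmod (n := 1) h2 (by rw [h, one_mul])
      omega
  | cycle β hβ =>
    rw [coordinate, Q.coeff_traceForm_e hε hβ]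
    cases q' with
    | vertex j =>
      have h1 := (Q.ℓ_pos β).ne'
      have h2 := (Q.ℓ_pos (hε.neg (Q.s β))).ne'
      rw [basisElement, coeff_e, coeff_e, if_neg (by simp [h1]), if_neg (by simp [h2]),
        if_neg (by simp), sub_zero]
    | path α n h1 h2 =>
      rw [basisElement, Q.coeff_p h1, Q.coeff_p h1, if_neg, if_neg, if_neg (by simp), sub_zero]
      · rintro ⟨h, rfl⟩
        have := hlt (r := 0) h2 h
        omega
      · rintro ⟨h, rfl⟩
        have := hlt (r := 0) h2 h
        omega
    | cycle β' hβ' =>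
      rw [basisElement, c, Q.coeff_p (Q.ℓ_pos β'), Q.coeff_p (Q.ℓ_pos β'),
        if_neg (c := _ ∧ hε.neg (Q.s β) = β') (fun h => hneg hβ' h.2), sub_zero]
      by_cases h : β' = β
      · subst h
        have h1 := (Q.ℓ_pos β').ne'
        simp [add_mul, h1]
      · rw [if_neg fun h' => h h'.2.symm, if_neg]
        intro h'
        cases h'
        exact h rfl

theorem eq_zero_of_coordinate {ε : E → ℤˣ} (hε : Q.IsSignChoice ε) {x : Q.CompletedAlgebra k}
    (hx : ∀ q, Q.coordinate hε q x = 0) : x = 0 := by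
  refine Q.ext_coeff fun α n => ?_
  rw [coeff_zero, Pi.zero_apply, Pi.zero_apply]
  have hneg : ∀ (i : V) (m : ℕ), Q.coeff x (hε.neg i) (m * Q.ℓ (hε.neg i)) = 0 := fun i m => by
    have h := congrArg (PowerSeries.coeff m) (hx (.vertex i))
    rwa [coordinate, coeff_residueCoord, add_zero, map_zero] at h
  rw [← Nat.div_add_mod' n (Q.ℓ α)]
  have hr := Nat.mod_lt n (Q.ℓ_pos α)
  rcases Nat.eq_zero_or_pos (n % Q.ℓ α) with h0 | h0
  · rw [h0, add_zero]
    rcases Int.units_eq_one_or (ε α) with h | h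
    · rcases n / Q.ℓ α with _ | m
      · rw [zero_mul, ← Q.coeff_zero_eq (hε.s_neg (Q.s α))]
        simpa using hneg (Q.s α) 0
      · have h1 := congrArg (PowerSeries.coeff m) (hx (.cycle α h))
        rwa [coordinate, Q.coeff_traceForm_e hε h, hneg, sub_zero, map_zero] at h1
    · rw [← hε.neg_s h]; exact hneg _ _
  · have h := congrArg (PowerSeries.coeff (n / Q.ℓ α)) (hx (.path α _ h0 hr))
    rwa [coordinate, coeff_residueCoord, map_zero] at h

instance (ε : E → ℤˣ) : Finite (Q.BasisIndex ε) := by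
  let f : Q.BasisIndex ε → V ⊕ (Σ α, Fin (Q.ℓ α)) ⊕ E := fun q => match q with
    | .vertex i => .inl i
    | .path α n _ lt => .inr (.inl ⟨α, n, lt⟩)
    | .cycle β _ => .inr (.inr β)
  refine Finite.of_injective f ?_
  rintro (i | ⟨α, n, h1, h2⟩ | ⟨β, h⟩) (j | ⟨α', n', h1', h2'⟩ | ⟨β', h'⟩) heq
  · simp_all [f]
  · simp_all [f]
  · simp_all [f]
  · simp_all [f]
  · simp only [f, Sum.inr.injEq, Sum.inl.injEq, Sigma.mk.injEq] at heq
    obtain ⟨rfl, heq⟩ := heq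
    simp at heq
    subst heq
    rfl
  · simp_all [f]
  · simp_all [f]
  · simp_all [f]
  · simp_all [f]

/-- The elements `e_i`, `α_n` and `c_β` as a basis of `A` over `k⟦c⟧`. -/
def basis {ε : E → ℤˣ} (hε : Q.IsSignChoice ε) :
    Module.Basis (Q.BasisIndex ε) k⟦X⟧ (Q.CompletedAlgebra k) := by
  classical
  have := Fintype.ofFinite (Q.BasisIndex ε)
  exact .ofEquivFun
    { LinearMap.pi (Q.coordinate hε) with
      invFun := fun g => ∑ q, g q • Q.basisElement k ε q
      left_inv := fun x => by
        rw [← sub_eq_zero]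
        refine Q.eq_zero_of_coordinate hε fun q => ?_
        simp [coordinate_basisElement]
      right_inv := fun g => by
        ext1 q
        simp [coordinate_basisElement] }

theorem basis_coord {ε : E → ℤˣ} (hε : Q.IsSignChoice ε) (q : Q.BasisIndex ε) :
    (Q.basis (k := k) hε).coord q = Q.coordinate hε q := by
  ext1 x
  simp [basis]

theorem basis_apply {ε : E → ℤˣ} (hε : Q.IsSignChoice ε) (q : Q.BasisIndex ε) :
    Q.basis (k := k) hε q = Q.basisElement k ε q := by
  classical
  rw [← sub_eq_zero]
  refine Q.eq_zero_of_coordinate hε fun q' => ?_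
  rw [map_sub, coordinate_basisElement, ← basis_coord, Module.Basis.coord_apply,
    Module.Basis.repr_self, Finsupp.single_apply, sub_self]

end CyclicGentleQuiver

namespace CyclicGentleQuiver

variable {V E : Type*} (Q : CyclicGentleQuiver V E)
variable {k : Type*} [Field k] [Fintype V] [Fintype E]

/-! ### The bimodule `A°` -/

open Classical in
theorem coeff_mul_a_succ (x : Q.CompletedAlgebra k) (γ α : E) (n : ℕ) :
    Q.coeff (x * Q.a k γ) α (n + 1) = if α = γ then Q.coeff x (Q.σ γ) n else 0 := by
  rw [coeff_mul, Finset.sum_eq_single_of_mem (n, 1) (by simp)]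
  · by_cases h : α = γ <;> simp [coeff_a, h]
  · rintro ⟨i, j⟩ h1 h2
    rw [coeff_a, if_neg, mul_zero]
    rintro ⟨rfl, -⟩
    simp_all

theorem coeff_mul_a_zero (x : Q.CompletedAlgebra k) (γ α : E) :
    Q.coeff (x * Q.a k γ) α 0 = 0 := by
  classical
  rw [coeff_mul_zero, coeff_a, if_neg (by simp), mul_zero]

/-- If the constant term at an arrow `γ` vanishes, all paths that begin with `γ` can be divided by
`γ` on the right. -/
theorem exists_mul_a_eq {γ : E} (hγ : Q.IsTransitionVertex (Q.s γ)) {z : Q.CompletedAlgebra k}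
    (hz : Q.coeff z γ 0 = 0) : ∃ y, y * Q.a k γ = z * Q.e k (Q.s γ) := by
  classical
  let f : E → ℕ → k := fun β n =>
    if n = 0 then (if Q.s β = Q.t γ then Q.coeff z γ 1 else 0)
    else if β = Q.σ γ then Q.coeff z γ (n + 1) else 0
  obtain ⟨y, hy⟩ := Q.exists_coeff_eq (f := f) (fun α β h => by simp [f, h])
  refine ⟨y, Q.ext_coeff fun α n => ?_⟩
  rw [coeff_mul_e]
  have hα : Q.s α = Q.s γ ↔ α = γ :=
    ⟨fun h => Q.eq_of_transition hγ h rfl, fun h => by rw [h]⟩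
  rw [if_congr hα rfl rfl]
  cases n with
  | zero =>
    rw [coeff_mul_a_zero]
    split_ifs with h
    · rw [h, hz]
    · rfl
  | succ n =>
    rw [coeff_mul_a_succ, hy]
    split_ifs with h
    · subst h
      simp only [f, s_σ, if_true]
      split_ifs with h
      · rw [h]
      · rfl
    · rfl

variable (k) in
/-- The generators of `A°`. -/
def circGenerators : Set (Q.CompletedAlgebra k) :=
  {x | ∃ i, Q.IsRegularVertex i ∧ x = Q.e k i} ∪
    {x | ∃ γ, Q.IsTransitionVertex (Q.s γ) ∧ x = Q.a k γ}

theorem span_circGenerators :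
    Submodule.span (Q.CompletedAlgebra k) (Q.circGenerators k) = Q.vanishIdeal k := by
  refine le_antisymm (Submodule.span_le.2 ?_) fun z hz => ?_
  · rintro _ (⟨i, hi, rfl⟩ | ⟨γ, -, rfl⟩)
    · exact Q.e_mem_vanishIdeal hi
    · exact Q.a_mem_vanishIdeal γ
  · rw [← mul_one z, ← Q.sum_e, Finset.mul_sum]
    refine Submodule.sum_mem _ fun i _ => ?_
    rcases Q.regular_or_transition i with h | h
    · exact Submodule.smul_mem _ z (Submodule.subset_span (Or.inl ⟨i, h, rfl⟩))
    · obtain ⟨γ, rfl⟩ := Q.exists_source i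
      obtain ⟨y, hy⟩ := Q.exists_mul_a_eq h (hz γ h)
      rw [← hy]
      exact Submodule.smul_mem _ y (Submodule.subset_span (Or.inr ⟨γ, h, rfl⟩))

theorem map_circ (ε : E → ℤˣ) :
    (Q.circ k ε).map (TwistedBimodule.equiv (Q.ν k ε)).toLinearMap = Q.vanishIdeal k := by
  refine le_antisymm ?_ ?_
  · rw [circ, subbimoduleSpan, Submodule.map_span_le]
    rintro _ ⟨g, hg, a, rfl⟩
    have h : (g : Q.CompletedAlgebra k) ∈ Q.vanishIdeal k := by
      rcases hg with ⟨i, hi, rfl⟩ | ⟨γ, -, rfl⟩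
      · exact Q.e_mem_vanishIdeal hi
      · exact Q.a_mem_vanishIdeal γ
    exact Ideal.mul_mem_right (Q.ν k ε a) _ h
  · rw [← span_circGenerators, Submodule.span_le]
    intro x hx
    exact ⟨x, subset_subbimoduleSpan _ _ hx, rfl⟩

variable (k) in
/-- The bimodule `A°` as an ideal of `A`. -/
def circEquiv (ε : E → ℤˣ) : Q.circ k ε ≃ₗ[Q.CompletedAlgebra k] Q.vanishIdeal k :=
  (TwistedBimodule.equiv (Q.ν k ε)).submoduleMap (Q.circ k ε) ≪≫ₗ
    LinearEquiv.ofEq _ _ (Q.map_circ ε)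

theorem circEquiv_op_smul (ε : E → ℤˣ) (a : (Q.CompletedAlgebra k)ᵐᵒᵖ) (x : Q.circ k ε) :
    (Q.circEquiv k ε (a • x) : Q.CompletedAlgebra k) = Q.circEquiv k ε x * Q.ν k ε a.unop := rfl

/-- The generators of `A°` as a sub-bimodule already generate it as a left module. -/
theorem circ_hom_ext {ε : E → ℤˣ} {N : Type*} [AddCommGroup N] [Module (Q.CompletedAlgebra k) N]
    {f g : Q.circ k ε →ₗ[Q.CompletedAlgebra k] N}
    (h1 : ∀ i hi, f (Q.circVertex k ε i hi) = g (Q.circVertex k ε i hi))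
    (h2 : ∀ γ hγ, f (Q.circArrow k ε γ hγ) = g (Q.circArrow k ε γ hγ)) : f = g := by
  suffices h : ∀ z (hz : z ∈ Submodule.span (Q.CompletedAlgebra k) (Q.circGenerators k)),
      f ((Q.circEquiv k ε).symm ⟨z, Q.span_circGenerators.le hz⟩) =
        g ((Q.circEquiv k ε).symm ⟨z, Q.span_circGenerators.le hz⟩) by
    refine LinearMap.ext fun x => ?_
    have := h (Q.circEquiv k ε x) (Q.span_circGenerators.ge (Q.circEquiv k ε x).2)
    simpa using this
  intro z hz
  induction hz using Submodule.span_induction with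
  | mem z hz =>
    rcases hz with ⟨i, hi, rfl⟩ | ⟨γ, hγ, rfl⟩
    · exact h1 i hi
    · exact h2 γ hγ
  | zero => exact (map_zero f).trans (map_zero g).symm
  | add x y hx hy ihx ihy =>
    have h3 : (⟨x + y, Q.span_circGenerators.le (Submodule.add_mem _ hx hy)⟩ : Q.vanishIdeal k) =
      ⟨x, Q.span_circGenerators.le hx⟩ + ⟨y, Q.span_circGenerators.le hy⟩ := rfl
    rw [h3, map_add, map_add, map_add, ihx, ihy]
  | smul a x hx ih =>
    have h3 : (⟨a • x, Q.span_circGenerators.le (Submodule.smul_mem _ a hx)⟩ : Q.vanishIdeal k) =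
      a • ⟨x, Q.span_circGenerators.le hx⟩ := rfl
    rw [h3, map_smul, map_smul, map_smul, ih]

/-! ### The isomorphism with the dualising bimodule -/

open Classical in
theorem coeff_p_mul {r : ℕ} (hr : 0 < r) (β : E) (x : Q.CompletedAlgebra k) (α : E) (n : ℕ) :
    Q.coeff (Q.p k β r * x) α n =
      if r ≤ n ∧ Q.σ^[n - r] α = β then Q.coeff x α (n - r) else 0 := by
  rw [coeff_mul]
  simp only [Q.coeff_p hr]
  split_ifs with h
  · rw [Finset.sum_eq_single_of_mem (r, n - r) (by simp; omega)]
    · simp [h.2]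
    · rintro ⟨i, j⟩ h1 h2
      rw [if_neg, zero_mul]
      rintro ⟨h3, -⟩
      simp only [Finset.HasAntidiagonal.mem_antidiagonal] at h1
      simp only at h3
      apply h2
      ext
      · exact h3
      · simp only; omega
  · refine Finset.sum_eq_zero fun p hp => ?_
    rw [Finset.HasAntidiagonal.mem_antidiagonal] at hp
    rw [if_neg, zero_mul]
    rintro ⟨h3, h4⟩
    refine h ⟨by omega, ?_⟩
    rw [show n - r = p.2 by omega]
    exact h4

/-- Multiplication by the path that completes `α_n` to a power of an admissible cycle makes the
trace pick out the coefficient of `α_n`. -/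
theorem coeff_trace_p_mul (ε : E → ℤˣ) (x : Q.CompletedAlgebra k) (α : E) {n m : ℕ}
    (h : n < (m + 1) * Q.ℓ α) :
    PowerSeries.coeff m (Q.trace ε (Q.p k (Q.σ^[n] α) ((m + 1) * Q.ℓ α - n) * x)) =
      ((ε α : ℤ) : k) * Q.coeff x α n := by
  classical
  rw [coeff_trace, Finset.sum_eq_single_of_mem α (Finset.mem_univ _)]
  · rw [Q.coeff_p_mul (by omega), Nat.sub_sub_self h.le, if_pos ⟨Nat.sub_le _ _, rfl⟩]
  · intro β _ hβ
    rw [Q.coeff_p_mul (by omega), if_neg, mul_zero]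
    rintro ⟨h1, h2⟩
    have hℓ : Q.ℓ β = Q.ℓ α := by
      rw [← Q.ℓ_iterate_σ α n, ← h2, ℓ_iterate_σ]
    rw [hℓ, Nat.sub_sub_self h.le] at h2
    exact hβ ((Q.σ_injective.iterate n) h2)

theorem coeff_trace_p_mul_of_lt (ε : E → ℤˣ) (x : Q.CompletedAlgebra k) (β : E) {r m : ℕ}
    (h : (m + 1) * Q.ℓ β < r) :
    PowerSeries.coeff m (Q.trace ε (Q.p k β r * x)) = 0 := by
  classical
  rw [coeff_trace]
  refine Finset.sum_eq_zero fun α _ => ?_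
  rw [Q.coeff_p_mul (by omega), if_neg, mul_zero]
  rintro ⟨h1, h2⟩
  rw [← h2, ℓ_iterate_σ] at h
  omega

theorem coeff_X_smul (x : Q.CompletedAlgebra k) (α : E) (n : ℕ) :
    Q.coeff ((PowerSeries.X : k⟦X⟧) • x) α n =
      if Q.ℓ α ≤ n then Q.coeff x α (n - Q.ℓ α) else 0 := by
  have h1 := Nat.mod_lt n (Q.ℓ_pos α)
  have h2 := Nat.div_add_mod' n (Q.ℓ α)
  generalize n % Q.ℓ α = r at h1 h2
  generalize n / Q.ℓ α = m at h2
  subst h2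
  rw [Q.coeff_smul _ _ _ h1]
  cases m with
  | zero => simp [h1]
  | succ m =>
    rw [Finset.Nat.sum_antidiagonal_succ, Finset.sum_eq_single_of_mem (0, m) (by simp)]
    · rw [if_pos (by rw [add_mul]; omega)]
      simp only [PowerSeries.coeff_zero_X, zero_mul, zero_add, PowerSeries.coeff_one_X, one_mul]
      congr 1
      rw [add_mul]; omega
    · rintro ⟨i, j⟩ h3 h4
      rw [PowerSeries.coeff_X, if_neg, zero_mul]
      intro h5
      simp_all

theorem X_smul_p {r : ℕ} (hr : 0 < r) (β : E) :
    (PowerSeries.X : k⟦X⟧) • Q.p k β r = Q.p k β (r + Q.ℓ β) := by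
  classical
  refine Q.ext_coeff fun α n => ?_
  rw [coeff_X_smul, Q.coeff_p hr, Q.coeff_p (by omega)]
  by_cases h : α = β
  · subst h
    by_cases h1 : Q.ℓ α ≤ n
    · rw [if_pos h1]
      exact if_congr (by simp only [and_true]; omega) rfl rfl
    · rw [if_neg h1, if_neg]
      omega
  · simp [h]

theorem X_pow_smul_p {r : ℕ} (hr : 0 < r) (β : E) (j : ℕ) :
    (PowerSeries.X ^ j : k⟦X⟧) • Q.p k β r = Q.p k β (r + j * Q.ℓ β) := by
  induction j with
  | zero => simp
  | succ j ih => rw [pow_succ', mul_smul, ih, Q.X_smul_p (by omega), add_assoc, add_mul, one_mul]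

open Classical in
theorem X_smul_e (i : V) :
    (PowerSeries.X : k⟦X⟧) • Q.e k i = ∑ α with Q.s α = i, Q.c k α := by
  refine Q.ext_coeff fun α n => ?_
  have h : ∀ β, Q.coeff (Q.c k β) α n = if n = Q.ℓ β ∧ α = β then 1 else 0 :=
    fun β => by rw [c, Q.coeff_p (Q.ℓ_pos β)]
  rw [coeff_X_smul, coeff_e, coeff_sum, Finset.sum_apply, Finset.sum_apply,
    Finset.sum_congr rfl fun β _ => h β, Finset.sum_filter,
    Finset.sum_eq_single_of_mem α (Finset.mem_univ _)]
  · by_cases h1 : Q.s α = i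
    · by_cases h2 : n = Q.ℓ α
      · simp [h1, h2]
      · by_cases h3 : Q.ℓ α ≤ n
        · have : ¬ (n - Q.ℓ α = 0) := by omega
          simp [this, h2]
        · simp [h2, h3]
    · simp [h1]
  · intro β _ hβ
    simp [hβ.symm]

section Surjectivity

variable {ε : E → ℤˣ} (f : Q.CompletedAlgebra k →ₗ[k⟦X⟧] k⟦X⟧)

theorem coeff_form_p_add {r : ℕ} (hr : 0 < r) (β : E) (m j : ℕ) :
    PowerSeries.coeff (m + j) (f (Q.p k β (r + j * Q.ℓ β))) =
      PowerSeries.coeff m (f (Q.p k β r)) := by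
  rw [← Q.X_pow_smul_p hr, map_smul, smul_eq_mul, PowerSeries.coeff_X_pow_mul]

theorem coeff_form_p_of_lt (β : E) {r m : ℕ} (h : (m + 1) * Q.ℓ β < r) :
    PowerSeries.coeff m (f (Q.p k β r)) = 0 := by
  obtain ⟨r, rfl⟩ := Nat.exists_eq_add_of_le' h.le
  rw [← Q.X_pow_smul_p (by omega), map_smul, smul_eq_mul, PowerSeries.coeff_X_pow_mul',
    if_neg (by omega)]

/-- The coefficients of the element of `A°` that corresponds to a linear form `f`. The coefficient
at `α_n` is determined by the value of `f` at the path that completes `α_n` to a power of an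
admissible cycle; the least such power is used. -/
def formFamily (ε : E → ℤˣ) : E → ℕ → k := fun α n =>
  ((ε α : ℤ) : k) * PowerSeries.coeff (n / Q.ℓ α)
    (f (Q.p k (Q.σ^[n] α) ((n / Q.ℓ α + 1) * Q.ℓ α - n)))

/-- The coefficients do not depend on the power of the admissible cycle to which `α_n` is
completed. -/
theorem formFamily_eq (α : E) {n m : ℕ} (h : n < (m + 1) * Q.ℓ α) :
    Q.formFamily f ε α n = ((ε α : ℤ) : k) *
      PowerSeries.coeff m (f (Q.p k (Q.σ^[n] α) ((m + 1) * Q.ℓ α - n))) := by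
  have h1 : n / Q.ℓ α ≤ m := Nat.lt_succ_iff.1 ((Nat.div_lt_iff_lt_mul (Q.ℓ_pos α)).2 h)
  have h2 : n < (n / Q.ℓ α + 1) * Q.ℓ α := Nat.lt_mul_of_div_lt (Nat.lt_succ_self _) (Q.ℓ_pos α)
  obtain ⟨j, rfl⟩ := Nat.exists_eq_add_of_le h1
  rw [formFamily, ← Q.coeff_form_p_add f (Nat.sub_pos_of_lt h2) _ _ j, ℓ_iterate_σ]
  congr 5
  rw [add_right_comm, add_mul (n / Q.ℓ α + 1)]
  omega

theorem formFamily_zero (α : E) :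
    Q.formFamily f ε α 0 = ((ε α : ℤ) : k) * PowerSeries.coeff 0 (f (Q.c k α)) := by
  rw [Q.formFamily_eq f α (m := 0) (by simpa using Q.ℓ_pos α)]
  simp [c]

open Classical in
theorem sum_coeff_zero_form_c (i : V) :
    ∑ α with Q.s α = i, PowerSeries.coeff 0 (f (Q.c k α)) = 0 := by
  rw [← map_sum, ← map_sum, ← Q.X_smul_e, map_smul, smul_eq_mul,
    PowerSeries.coeff_zero_X_mul]

/-- The sum of the cycles at a vertex is `c e_i`, so that the values of `f` at the two cycles at a
regular vertex have opposite constant terms. -/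
theorem formFamily_compatible (hε : Q.IsSignChoice ε) {α β : E} (h : Q.s α = Q.s β) :
    Q.formFamily f ε α 0 = Q.formFamily f ε β 0 := by
  classical
  have key : ∀ α, Q.formFamily f ε α 0 = Q.formFamily f ε (hε.neg (Q.s α)) 0 := by
    intro α
    rcases Int.units_eq_one_or (ε α) with h | h
    · have h1 := Q.sum_coeff_zero_form_c f (Q.s α)
      rw [hε.sum_source h] at h1
      rw [formFamily_zero, formFamily_zero, h, hε.ε_neg]
      simpa using eq_neg_of_add_eq_zero_left h1
    · rw [hε.neg_s h]
  rw [key α, key β, h]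

theorem formFamily_transition {γ : E} (hγ : Q.IsTransitionVertex (Q.s γ)) :
    Q.formFamily f ε γ 0 = 0 := by
  classical
  have h1 := Q.sum_coeff_zero_form_c f (Q.s γ)
  rw [Finset.sum_filter, Finset.sum_eq_single_of_mem γ (Finset.mem_univ _), if_pos rfl] at h1
  · rw [formFamily_zero, h1, mul_zero]
  · intro β _ hβ
    rw [if_neg fun h => hβ (Q.eq_of_transition hγ h rfl)]

theorem sign_mul_self (u : ℤˣ) : ((u : ℤ) : k) * ((u : ℤ) : k) = 1 := by
  rw [← Int.cast_mul, ← Units.val_mul, Int.units_mul_self]; simp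

/-- Each linear form on `A` is given by an element of `A°`. Both forms agree on all paths of
positive length, hence on `c e_i` and, since `k⟦c⟧` is a domain, on `e_i`. -/
theorem exists_traceForm_eq (hε : Q.IsSignChoice ε) :
    ∃ x, ∃ hx : x ∈ Q.vanishIdeal k, Q.traceForm hε x hx = f := by
  classical
  obtain ⟨x, hx⟩ := Q.exists_coeff_eq (f := Q.formFamily f ε)
    fun _ _ h => Q.formFamily_compatible f hε h
  have hmem : x ∈ Q.vanishIdeal k := fun γ hγ => by rw [hx, Q.formFamily_transition f hγ]
  have hp : ∀ (β : E) (r : ℕ), 0 < r → Q.traceForm hε x hmem (Q.p k β r) = f (Q.p k β r) := by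
    intro β r hr
    ext m
    rw [traceForm_apply]
    rcases lt_or_ge ((m + 1) * Q.ℓ β) r with h | h
    · rw [Q.coeff_trace_p_mul_of_lt ε x β h, Q.coeff_form_p_of_lt f β h]
    · have hℓ := Q.ℓ_iterate_σ β r
      have h1 : Q.σ^[(m + 1) * Q.ℓ (Q.σ^[r] β) - r] (Q.σ^[r] β) = β := by
        rw [hℓ, ← Function.iterate_add_apply, Nat.sub_add_cancel h, iterate_mul_ℓ]
      have h2 : (m + 1) * Q.ℓ (Q.σ^[r] β) - ((m + 1) * Q.ℓ (Q.σ^[r] β) - r) = r := by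
        rw [hℓ]; omega
      have h3 : (m + 1) * Q.ℓ (Q.σ^[r] β) - r < (m + 1) * Q.ℓ (Q.σ^[r] β) := by
        rw [hℓ]; omega
      have h4 := Q.coeff_trace_p_mul ε x (Q.σ^[r] β) h3
      rw [h1, h2] at h4
      rw [h4, hx, Q.formFamily_eq f _ h3, h1, h2, ← mul_assoc, sign_mul_self, one_mul]
  refine ⟨x, hmem, (Q.basis hε).ext fun q => ?_⟩
  rw [basis_apply]
  cases q with
  | vertex i =>
    refine mul_left_cancel₀ (PowerSeries.X_ne_zero (R := k)) ?_
    rw [basisElement, ← smul_eq_mul, ← smul_eq_mul, ← map_smul, ← map_smul, X_smul_e, map_sum,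
      map_sum]
    exact Finset.sum_congr rfl fun α _ => hp α _ (Q.ℓ_pos α)
  | path α n h1 _ => exact hp α n h1
  | cycle β _ => exact hp β _ (Q.ℓ_pos β)

end Surjectivity

theorem traceForm_injective {ε : E → ℤˣ} (hε : Q.IsSignChoice ε) {x : Q.CompletedAlgebra k}
    (hx : x ∈ Q.vanishIdeal k) (h : Q.traceForm hε x hx = 0) : x = 0 := by
  refine Q.ext_coeff fun α n => ?_
  have hn : n < (n + 1) * Q.ℓ α :=
    (Nat.lt_succ_self n).trans_le (Nat.le_mul_of_pos_right _ (Q.ℓ_pos α))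
  have h1 := Q.coeff_trace_p_mul ε x α hn
  rw [← Q.traceForm_apply hε x hx, h, LinearMap.zero_apply, map_zero] at h1
  rw [coeff_zero, Pi.zero_apply, Pi.zero_apply, ← one_mul (Q.coeff x α n),
    ← sign_mul_self (ε α), mul_assoc, ← h1, mul_zero]

/-- The map `ϑ : A° → Hom_R(A, R)`, `ϑ(x)(y) = trace (y x)`. -/
def thetaHom {ε : E → ℤˣ} (hε : Q.IsSignChoice ε) :
    Q.circ k ε →ₗ[Q.CompletedAlgebra k] Q.Omega k where
  toFun x := Q.traceForm hε _ (Q.circEquiv k ε x).2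
  map_add' x y := LinearMap.ext fun z => by
    refine Eq.trans ?_ (Q.trace_add ε (z * (Q.circEquiv k ε x : Q.CompletedAlgebra k))
      (z * (Q.circEquiv k ε y : Q.CompletedAlgebra k)))
    rw [traceForm_apply, map_add, Submodule.coe_add, mul_add]
  map_smul' a x := LinearMap.ext fun z => by
    refine congrArg (Q.trace ε) ?_
    rw [map_smul, Submodule.coe_smul, smul_eq_mul]
    exact (mul_assoc z a _).symm

theorem thetaHom_apply {ε : E → ℤˣ} (hε : Q.IsSignChoice ε) (x : Q.circ k ε) :
    Q.thetaHom hε x = Q.traceForm hε _ (Q.circEquiv k ε x).2 := rfl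

theorem thetaHom_bijective {ε : E → ℤˣ} (hε : Q.IsSignChoice ε) :
    Function.Bijective (Q.thetaHom (k := k) hε) := by
  constructor
  · rw [injective_iff_map_eq_zero]
    intro x hx
    have := Q.traceForm_injective hε (Q.circEquiv k ε x).2 hx
    exact (Q.circEquiv k ε).map_eq_zero_iff.1 (Subtype.ext this)
  · intro f
    obtain ⟨x, hx, h⟩ := Q.exists_traceForm_eq f hε
    refine ⟨(Q.circEquiv k ε).symm ⟨x, hx⟩, ?_⟩
    rw [thetaHom_apply, ← h]
    congr 1

/-- The isomorphism `ϑ : A° ≅ Hom_R(A, R)`. -/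
def theta {ε : E → ℤˣ} (hε : Q.IsSignChoice ε) :
    Q.circ k ε ≃ₗ[Q.CompletedAlgebra k] Q.Omega k :=
  LinearEquiv.ofBijective (Q.thetaHom hε) (Q.thetaHom_bijective hε)

theorem theta_toLinearMap {ε : E → ℤˣ} (hε : Q.IsSignChoice ε) :
    (Q.theta (k := k) hε).toLinearMap = Q.thetaHom hε := rfl

theorem theta_op_smul {ε : E → ℤˣ} (hε : Q.IsSignChoice ε) (x : Q.circ k ε)
    (y : (Q.CompletedAlgebra k)ᵐᵒᵖ) : Q.theta hε (y • x) = y • Q.theta hε x :=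
  LinearMap.ext fun z => by
    refine Eq.trans (congrArg (Q.trace ε) (mul_assoc z _ _).symm) ?_
    refine (Q.trace_mul_ν ε _ _).trans (congrArg (Q.trace ε) ?_)
    exact (mul_assoc _ _ _).symm

theorem hasThetaValues_theta {ε : E → ℤˣ} (hε : Q.IsSignChoice ε) :
    Q.HasThetaValues k (Q.basis hε) (Q.theta hε).toLinearMap := by
  classical
  rw [theta_toLinearMap]
  constructor
  · intro i hi
    obtain ⟨β, rfl, hβ⟩ := hε.exists_pos hi
    exact ⟨β, hβ, rfl, (Q.basis_coord hε (.cycle β hβ)).symm⟩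
  · intro γ hγ
    have hεγ := hε.transition hγ
    have key : ∀ (y : Q.CompletedAlgebra k) (m : ℕ),
        PowerSeries.coeff m (Q.trace ε (y * Q.a k γ)) =
          -Q.coeff y (Q.σ γ) (m * Q.ℓ γ + (Q.ℓ γ - 1)) := by
      intro y m
      have h1 : (m + 1) * Q.ℓ γ = m * Q.ℓ γ + (Q.ℓ γ - 1) + 1 := by
        have := Q.ℓ_pos γ
        rw [add_mul]; omega
      rw [coeff_trace, Finset.sum_eq_single_of_mem γ (Finset.mem_univ _), h1, coeff_mul_a_succ,
        if_pos rfl, hεγ]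
      · simp
      · intro α _ hα
        obtain ⟨N, hN⟩ := Nat.exists_eq_succ_of_ne_zero
          (Nat.mul_pos m.succ_pos (Q.ℓ_pos α)).ne'
        rw [hN, coeff_mul_a_succ, if_neg hα, mul_zero]
    -- for a loop `γ` of length `ℓ_γ = 1`, the path `c_γ ∂` is the idempotent
    by_cases hℓ : Q.ℓ γ = 1
    · have hσ : Q.σ γ = γ := by simpa [hℓ] using Q.iterate_ℓ γ
      refine ⟨.vertex (Q.s γ), ?_, ?_⟩
      · rw [basisElement, cDel, hℓ, hσ]; rfl
      · rw [basis_coord]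
        refine LinearMap.ext fun y => PowerSeries.ext fun m => ?_
        refine (key y m).trans ?_
        rw [hσ, hℓ]
        change _ = PowerSeries.coeff m (-(Q.coordinate hε (.vertex (Q.s γ)) y))
        rw [map_neg, coordinate, coeff_residueCoord, hε.neg_s hεγ, hℓ]
    · have h1 := Q.ℓ_pos γ
      refine ⟨.path (Q.σ γ) (Q.ℓ γ - 1) (by omega) (by rw [ℓ_σ]; omega), rfl, ?_⟩
      rw [basis_coord]
      refine LinearMap.ext fun y => PowerSeries.ext fun m => ?_
      refine (key y m).trans ?_
      change _ = PowerSeries.coeff m (-(Q.coordinate hε _ y))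
      rw [map_neg, coordinate, coeff_residueCoord, ℓ_σ]

theorem eq_theta_of_hasThetaValues {ε : E → ℤˣ} (hε : Q.IsSignChoice ε)
    {ϑ : Q.circ k ε →ₗ[Q.CompletedAlgebra k] Q.Omega k}
    (h : Q.HasThetaValues k (Q.basis hε) ϑ) : ϑ = (Q.theta hε).toLinearMap := by
  have h' := Q.hasThetaValues_theta (k := k) hε
  refine Q.circ_hom_ext (fun i hi => ?_) fun γ hγ => ?_
  · obtain ⟨β, hβ, hs, h1⟩ := h.1 i hi
    obtain ⟨β', hβ', hs', h2⟩ := h'.1 i hi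
    obtain rfl := hε.eq_of_sign (hs.trans hs'.symm) (hβ.trans hβ'.symm)
    rw [h1, h2]
  · obtain ⟨q, hq, h1⟩ := h.2 γ hγ
    obtain ⟨q', hq', h2⟩ := h'.2 γ hγ
    obtain rfl : q = q' := (Q.basis (k := k) hε).injective (by
      rw [basis_apply, basis_apply, hq, hq'])
    rw [h1, h2]

end CyclicGentleQuiver

namespace CyclicGentleQuiver

variable {V E : Type*} (Q : CyclicGentleQuiver V E)
variable {k : Type*} [Field k]

/-! ### Invertible elements -/

/-- The coefficients of a left inverse of an element of `A`, computed recursively on the length of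
the paths. -/
def invFamily (x : E → ℕ → k) : ℕ → E → k
  | n => fun α => ((if n = 0 then 1 else 0) -
      ∑ j : Fin n, invFamily x j (Q.σ^[n - j] α) * x α (n - j)) / x α 0
termination_by n => n
decreasing_by exact j.2

variable [Fintype V] [Fintype E]

theorem exists_left_inverse {x : Q.CompletedAlgebra k} (hx : ∀ α, Q.coeff x α 0 ≠ 0) :
    ∃ y, y * x = 1 := by
  obtain ⟨y, hy⟩ := Q.exists_coeff_eq (f := fun α n => Q.invFamily (Q.coeff x) n α)
    (fun α β h => by
      rw [invFamily]
      simp [Q.coeff_zero_eq h])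
  refine ⟨y, Q.ext_coeff fun α n => ?_⟩
  rw [coeff_mul, Finset.Nat.sum_antidiagonal_eq_sum_range_succ_mk, Finset.sum_range_succ,
    Nat.sub_self, hy, coeff_one]
  simp only [Function.iterate_zero, id]
  rw [invFamily, div_mul_cancel₀ _ (hx α), Finset.sum_range]
  ring

theorem exists_inverse {x : Q.CompletedAlgebra k} (hx : ∀ α, Q.coeff x α 0 ≠ 0) :
    ∃ y, y * x = 1 ∧ x * y = 1 := by
  obtain ⟨y, hy⟩ := Q.exists_left_inverse hx
  obtain ⟨z, hz⟩ := Q.exists_left_inverse (x := y) fun α h => by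
    have := Q.coeff_mul_zero y x α
    rw [hy, h, zero_mul, coeff_one] at this
    simp at this
  have : z = x := by rw [← mul_one z, ← hy, ← mul_assoc, hz, one_mul]
  exact ⟨y, hy, this ▸ hz⟩

theorem mem_jacobson_of_coeff_zero {x : Q.CompletedAlgebra k} (hx : ∀ α, Q.coeff x α 0 = 0) :
    x ∈ Ring.jacobson (Q.CompletedAlgebra k) := by
  rw [← Ideal.jacobson_bot, Ideal.mem_jacobson_iff]
  intro y
  obtain ⟨z, hz⟩ := Q.exists_left_inverse (x := y * x + 1) fun α => by
    simp [coeff_add, coeff_mul_zero, hx, coeff_one]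
  refine ⟨z, ?_⟩
  rw [Submodule.mem_bot, ← hz]
  noncomm_ring

/-- An element of `e_v A e_w` that is not in the radical has a right inverse in `e_w A e_v`. -/
theorem exists_corner_inverse {v w : V} {a : Q.CompletedAlgebra k}
    (h : Q.e k v * a * Q.e k w = a) (ha : a ∉ Ring.jacobson (Q.CompletedAlgebra k)) :
    ∃ b, Q.e k w * b * Q.e k v = b ∧ a * b = Q.e k v := by
  classical
  obtain ⟨α, hα⟩ : ∃ α, Q.coeff a α 0 ≠ 0 := by
    by_contra! h
    exact ha (Q.mem_jacobson_of_coeff_zero h)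
  have hα' := hα
  rw [← h, coeff_mul_e, coeff_e_mul] at hα'
  obtain ⟨hw, hv⟩ : Q.s α = w ∧ Q.s α = v := by
    by_contra! hne
    apply hα'
    split_ifs with h1 h2
    · exact absurd h2 (hne h1)
    · rfl
    · rfl
  subst hw
  subst hv
  have he := Q.e_mul_e_self (k := k) (Q.s α)
  have h1 : Q.e k (Q.s α) * a = a := by
    rw [← h, ← mul_assoc, ← mul_assoc, he]
  -- the constant terms of `a + (1 - e)` do not vanish at any vertex
  obtain ⟨y, -, hy⟩ := Q.exists_inverse (x := a + (1 - Q.e k (Q.s α))) fun β => by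
    rw [coeff_add, coeff_sub, Pi.add_apply, Pi.add_apply, Pi.sub_apply, Pi.sub_apply, coeff_one,
      coeff_e]
    by_cases hβ : Q.s β = Q.s α
    · rw [Q.coeff_zero_eq hβ]; simpa [hβ] using hα
    · rw [← h, coeff_mul_e]; simp [hβ]
  refine ⟨Q.e k (Q.s α) * y * Q.e k (Q.s α), ?_, ?_⟩
  · simp only [← mul_assoc, he]
    rw [mul_assoc, he]
  · have h2 : a * Q.e k (Q.s α) = a := by rw [← h, mul_assoc, he]
    have h3 : Q.e k (Q.s α) * (a + (1 - Q.e k (Q.s α))) = a := by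
      rw [mul_add, mul_sub, mul_one, he, sub_self, add_zero, h1]
    have h4 : a * y = Q.e k (Q.s α) := by rw [← h3, mul_assoc, hy, mul_one]
    rw [← mul_assoc, ← mul_assoc, h2, h4, he]

/-! ### The modules `P_i` and their radicals -/

theorem mem_P {i : V} {z : Q.CompletedAlgebra k} : z ∈ Q.P k i ↔ z * Q.e k i = z := by
  rw [P, Submodule.mem_span_singleton]
  constructor
  · rintro ⟨a, rfl⟩
    rw [smul_eq_mul, mul_assoc, e_mul_e_self]
  · exact fun h => ⟨z, h⟩

/-- An element of `P_i` with nonzero constant term generates `P_i`. -/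
theorem e_mem_of_coeff_ne_zero {γ : E} {z : Q.CompletedAlgebra k} (hz : z ∈ Q.P k (Q.s γ))
    (h : Q.coeff z γ 0 ≠ 0) : ∃ y, y * z = Q.e k (Q.s γ) := by
  classical
  have he := Q.e_mul_e_self (k := k) (Q.s γ)
  rw [mem_P] at hz
  obtain ⟨y, hy⟩ := Q.exists_left_inverse
    (x := Q.e k (Q.s γ) * z + (1 - Q.e k (Q.s γ))) fun β => by
    rw [coeff_add, coeff_sub, Pi.add_apply, Pi.add_apply, Pi.sub_apply, Pi.sub_apply, coeff_one,
      coeff_mul_zero, coeff_e]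
    by_cases hβ : Q.s β = Q.s γ
    · rw [Q.coeff_zero_eq hβ]; simpa [hβ] using h
    · simp [hβ]
  refine ⟨y * Q.e k (Q.s γ), ?_⟩
  have h1 : (Q.e k (Q.s γ) * z + (1 - Q.e k (Q.s γ))) * Q.e k (Q.s γ) = Q.e k (Q.s γ) * z := by
    rw [add_mul, sub_mul, one_mul, he, sub_self, add_zero, mul_assoc, hz]
  rw [mul_assoc, ← h1, ← mul_assoc, hy, one_mul]

/-- The radical of `P_i` for a transition vertex `i`: the unique maximal submodule consists of the
elements without constant term. -/
theorem jacobson_P {i : V} (hi : Q.IsTransitionVertex i) :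
    Module.jacobson (Q.CompletedAlgebra k) (Q.P k i) =
      Submodule.comap (Q.P k i).subtype (Q.vanishIdeal k) := by
  classical
  obtain ⟨γ, rfl⟩ := Q.exists_source i
  set N := Submodule.comap (Q.P k (Q.s γ)).subtype (Q.vanishIdeal k) with hN
  have hmem : ∀ z : Q.P k (Q.s γ), z ∈ N ↔ Q.coeff (z : Q.CompletedAlgebra k) γ 0 = 0 := by
    intro z
    constructor
    · exact fun h => h γ hi
    · intro h α hα
      by_cases hs : Q.s α = Q.s γ
      · rw [Q.eq_of_transition hi hs rfl]; exact h
      · have := Q.mem_P.1 z.2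
        rw [Submodule.subtype_apply, ← this, coeff_mul_e, if_neg hs]
  have hne : N ≠ ⊤ := fun h => by
    have : Q.eP k (Q.s γ) ∈ N := h ▸ Submodule.mem_top
    rw [hmem] at this
    simp [eP, coeff_e] at this
  have htop : ∀ M : Submodule (Q.CompletedAlgebra k) (Q.P k (Q.s γ)), ¬ M ≤ N → M = ⊤ := by
    intro M hM
    obtain ⟨z, hz, hzN⟩ := SetLike.not_le_iff_exists.1 hM
    rw [hmem] at hzN
    obtain ⟨y, hy⟩ := Q.e_mem_of_coeff_ne_zero z.2 hzN
    refine eq_top_iff.2 fun x _ => ?_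
    have hx : x = (x : Q.CompletedAlgebra k) • y • z := by
      refine Subtype.ext ?_
      change (x : Q.CompletedAlgebra k) = x * (y * z)
      rw [hy, Q.mem_P.1 x.2]
    rw [hx]
    exact M.smul_mem _ (M.smul_mem _ hz)
  have hcoatom : ∀ M : Submodule (Q.CompletedAlgebra k) (Q.P k (Q.s γ)), IsCoatom M ↔ M = N := by
    intro M
    constructor
    · intro hM
      have hle : M ≤ N := by_contra fun h => hM.1 (htop M h)
      by_contra hMN
      exact hne (hM.2 N (lt_of_le_of_ne hle hMN))
    · rintro rfl
      exact ⟨hne, fun M hM => htop M (not_le_of_gt hM)⟩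
  rw [Module.jacobson, show {m : Submodule (Q.CompletedAlgebra k) (Q.P k (Q.s γ)) | IsCoatom m}
    = {N} from Set.ext hcoatom, sInf_singleton]

theorem PCirc_eq (i : V) : Q.PCirc k i = Q.P k i ⊓ Q.vanishIdeal k := by
  rw [PCirc]
  split_ifs with h
  · rw [Q.jacobson_P h, Submodule.map_comap_subtype]
  · refine (inf_eq_left.2 ?_).symm
    rw [P, Submodule.span_singleton_le_iff_mem]
    exact Q.e_mem_vanishIdeal ((Q.regular_or_transition i).resolve_right h)

theorem mem_PCirc {i : V} {z : Q.CompletedAlgebra k} :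
    z ∈ Q.PCirc k i ↔ z * Q.e k i = z ∧ z ∈ Q.vanishIdeal k := by
  rw [PCirc_eq, Submodule.mem_inf, mem_P]

theorem iSupIndep_P : iSupIndep (Q.P k) := by
  intro i
  rw [Submodule.disjoint_def]
  intro z hz hz'
  have h : ⨆ j, ⨆ (_ : j ≠ i), Q.P k j ≤
      LinearMap.ker (LinearMap.toSpanSingleton (Q.CompletedAlgebra k) _ (Q.e k i)) := by
    refine iSup₂_le fun j hj => ?_
    intro x hx
    rw [LinearMap.mem_ker, LinearMap.toSpanSingleton_apply, smul_eq_mul, ← Q.mem_P.1 hx, mul_assoc,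
      Q.e_mul_e hj, mul_zero]
  have h2 := h hz'
  rw [LinearMap.mem_ker, LinearMap.toSpanSingleton_apply, smul_eq_mul, Q.mem_P.1 hz] at h2
  exact h2

theorem iSupIndep_PCirc : iSupIndep (Q.PCirc k) :=
  Q.iSupIndep_P.mono fun i => by rw [PCirc_eq]; exact inf_le_left

theorem iSup_PCirc : ⨆ i, Q.PCirc k i = Q.vanishIdeal k := by
  refine le_antisymm (iSup_le fun i => by rw [PCirc_eq]; exact inf_le_right) fun z hz => ?_
  rw [← mul_one z, ← Q.sum_e, Finset.mul_sum]
  refine Submodule.sum_mem _ fun i _ => Submodule.mem_iSup_of_mem i ?_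
  rw [mem_PCirc, mul_assoc, e_mul_e_self]
  exact ⟨rfl, Ideal.mul_mem_right _ _ hz⟩

end CyclicGentleQuiver

namespace CyclicGentleQuiver

variable {V E : Type*} (Q : CyclicGentleQuiver V E)
variable {k : Type*} [Field k] [Fintype V] [Fintype E]

/-! ### Tensor products with the dualising bimodule -/

theorem ν_e (ε : E → ℤˣ) (i : V) : Q.ν k ε (Q.e k i) = Q.e k i := by
  classical
  refine Q.ext_coeff fun α n => ?_
  rw [coeff_ν, coeff_e]
  split_ifs with h
  · simp [h.1]
  · simp

theorem mul_ν_mem_PCirc (ε : E → ℤˣ) {i : V} {x z : Q.CompletedAlgebra k}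
    (hx : x ∈ Q.vanishIdeal k) (hz : z ∈ Q.P k i) : x * Q.ν k ε z ∈ Q.PCirc k i := by
  rw [mem_PCirc]
  refine ⟨?_, Ideal.mul_mem_right _ _ hx⟩
  rw [mul_assoc]
  nth_rewrite 1 [← Q.ν_e ε i]
  rw [← map_mul, Q.mem_P.1 hz]

/-- The element of the ideal `A°` that corresponds to a linear form on `A`. -/
def ofForm {ε : E → ℤˣ} (hε : Q.IsSignChoice ε) :
    Q.Omega k ≃ₗ[Q.CompletedAlgebra k] Q.vanishIdeal k :=
  (Q.theta hε).symm ≪≫ₗ Q.circEquiv k ε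

/-- The bilinearity of `ϑ` in terms of its inverse. -/
theorem ofForm_symm_mul_ν {ε : E → ℤˣ} (hε : Q.IsSignChoice ε) (f : Q.Omega k)
    (a : Q.CompletedAlgebra k) (h : (Q.ofForm hε f : Q.CompletedAlgebra k) * Q.ν k ε a ∈
      Q.vanishIdeal k) : (Q.ofForm hε).symm ⟨_, h⟩ = MulOpposite.op a • f := by
  rw [LinearEquiv.symm_apply_eq]
  refine Subtype.ext ?_
  have h1 : (Q.theta hε).symm (MulOpposite.op a • f) =
      MulOpposite.op a • (Q.theta hε).symm f := by
    rw [LinearEquiv.symm_apply_eq, theta_op_smul, LinearEquiv.apply_symm_apply]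
  change _ = (Q.circEquiv k ε ((Q.theta hε).symm (MulOpposite.op a • f)) : Q.CompletedAlgebra k)
  rw [h1, circEquiv_op_smul]
  rfl

/-- The map `P_i → P_i°`, `z ↦ x ν(z)`, for `x` in the ideal `A°`. -/
def mulν (ε : E → ℤˣ) (x : Q.vanishIdeal k) (i : V) : Q.P k i →+ Q.PCirc k i :=
  AddMonoidHom.mk' (fun z => ⟨x * Q.ν k ε z, Q.mul_ν_mem_PCirc ε x.2 z.2⟩) fun z z' => by
    refine Subtype.ext ?_
    simp only [Submodule.coe_add, map_add, mul_add]

theorem coe_mulν (ε : E → ℤˣ) (x : Q.vanishIdeal k) (i : V) (z : Q.P k i) :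
    (Q.mulν ε x i z : Q.CompletedAlgebra k) = x * Q.ν k ε z := rfl

section Tensor

variable {ε : E → ℤˣ} (hε : Q.IsSignChoice ε) {M X : Type*} [AddCommGroup M]
  [Module (Q.CompletedAlgebra k) M] {v : X → V}
  (d : M ≃ₗ[Q.CompletedAlgebra k] ⨁ x, Q.P k (v x))

/-- The map `ω ⊗_A M → ⨁ P_{v(x)}°` that sends `f ⊗ m` to the family of the products
`ϑ⁻¹(f) ν(m_x)`, for a decomposition of `M`. -/
def tensorToSum : BimoduleTensor (Q.CompletedAlgebra k) (Q.Omega k) M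
    →ₗ[Q.CompletedAlgebra k] ⨁ x, Q.PCirc k (v x) :=
  Submodule.liftQ _ (TensorProduct.AlgebraTensorModule.lift
    { toFun := fun f => ((DirectSum.map fun x => Q.mulν ε (Q.ofForm hε f) (v x)).comp
        d.toLinearMap.toAddMonoidHom).toIntLinearMap
      map_add' := fun f g => by
        refine LinearMap.ext fun m => DFinsupp.ext fun x => Subtype.ext ?_
        change (Q.ofForm hε (f + g) : Q.CompletedAlgebra k) * Q.ν k ε (d m x) =
          Q.ofForm hε f * Q.ν k ε (d m x) + Q.ofForm hε g * Q.ν k ε (d m x)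
        rw [map_add, Submodule.coe_add, add_mul]
      map_smul' := fun a f => by
        refine LinearMap.ext fun m => DFinsupp.ext fun x => Subtype.ext ?_
        change (Q.ofForm hε (a • f) : Q.CompletedAlgebra k) * Q.ν k ε (d m x) =
          a * (Q.ofForm hε f * Q.ν k ε (d m x))
        rw [map_smul, Submodule.coe_smul, smul_eq_mul, mul_assoc] }) (by
    rw [balancedRelations, Submodule.span_le]
    rintro _ ⟨f, a, m, rfl⟩
    rw [SetLike.mem_coe, LinearMap.mem_ker, map_sub, sub_eq_zero]
    refine DFinsupp.ext fun x => Subtype.ext ?_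
    have h : (Q.ofForm hε (MulOpposite.op a • f) : Q.CompletedAlgebra k) =
        Q.ofForm hε f * Q.ν k ε a := by
      rw [← Q.ofForm_symm_mul_ν hε f a (Ideal.mul_mem_right _ _ (Q.ofForm hε f).2),
        LinearEquiv.apply_symm_apply]
    change (Q.ofForm hε (MulOpposite.op a • f) : Q.CompletedAlgebra k) * Q.ν k ε (d m x) =
      Q.ofForm hε f * Q.ν k ε (d (a • m) x)
    rw [h, map_smul, mul_assoc, ← map_mul]
    rfl)

theorem coe_tensorToSum_mk (f : Q.Omega k) (m : M) (x : X) :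
    (Q.tensorToSum hε d (Submodule.Quotient.mk (f ⊗ₜ m)) x : Q.CompletedAlgebra k) =
      Q.ofForm hε f * Q.ν k ε (d m x) := rfl

variable [DecidableEq X]

/-- The generator of `M` that corresponds to the idempotent in a summand of a decomposition. -/
def generator (x : X) : M :=
  d.symm (DirectSum.lof (Q.CompletedAlgebra k) X (fun x => Q.P k (v x)) x (Q.eP k (v x)))

theorem smul_generator (x : X) (z : Q.P k (v x)) :
    (z : Q.CompletedAlgebra k) • Q.generator d x =
      d.symm (DirectSum.lof (Q.CompletedAlgebra k) X (fun x => Q.P k (v x)) x z) := by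
  rw [generator, ← map_smul, ← map_smul]
  congr 2
  exact Subtype.ext (Q.mem_P.1 z.2)

/-- The element `z` in the `x`-th summand is sent to `ϑ(z) ⊗ e_x`, where `e_x` is the generator of
the `x`-th summand. -/
def sumToTensor : (⨁ x, Q.PCirc k (v x)) →ₗ[Q.CompletedAlgebra k]
    BimoduleTensor (Q.CompletedAlgebra k) (Q.Omega k) M :=
  DirectSum.toModule _ _ _ fun x =>
    { toFun := fun z => Submodule.Quotient.mk
        ((Q.ofForm hε).symm ⟨z, (Q.mem_PCirc.1 z.2).2⟩ ⊗ₜ[ℤ] Q.generator d x)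
      map_add' := fun y z => by
        rw [← Submodule.Quotient.mk_add, ← TensorProduct.add_tmul, ← map_add]
        rfl
      map_smul' := fun a z => by
        rw [RingHom.id_apply, ← Submodule.Quotient.mk_smul, TensorProduct.smul_tmul', ← map_smul]
        rfl }

theorem sumToTensor_lof (x : X) (z : Q.PCirc k (v x)) :
    Q.sumToTensor hε d (DirectSum.lof (Q.CompletedAlgebra k) X (fun x => Q.PCirc k (v x)) x z) =
      Submodule.Quotient.mk
        ((Q.ofForm hε).symm ⟨z, (Q.mem_PCirc.1 z.2).2⟩ ⊗ₜ[ℤ] Q.generator d x) :=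
  DirectSum.toModule_lof _ _ _

theorem tensorToSum_sumToTensor (u : ⨁ x, Q.PCirc k (v x)) :
    Q.tensorToSum hε d (Q.sumToTensor hε d u) = u := by
  suffices h : (Q.tensorToSum hε d).comp (Q.sumToTensor hε d) = LinearMap.id from
    LinearMap.congr_fun h u
  refine DirectSum.linearMap_ext _ fun x => LinearMap.ext fun z => DFinsupp.ext fun y =>
    Subtype.ext ?_
  rw [LinearMap.comp_apply, LinearMap.comp_apply, sumToTensor_lof]
  refine (Q.coe_tensorToSum_mk hε d _ _ y).trans ?_
  rw [LinearEquiv.apply_symm_apply, generator, LinearEquiv.apply_symm_apply, LinearMap.comp_apply,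
    LinearMap.id_apply]
  by_cases h : x = y
  · subst h
    have h1 : (DirectSum.lof (Q.CompletedAlgebra k) X (fun x => Q.P k (v x)) x
        (Q.eP k (v x))) x = Q.eP k (v x) := DirectSum.lof_apply _ _ _
    have h2 : (DirectSum.lof (Q.CompletedAlgebra k) X (fun x => Q.PCirc k (v x)) x z) x = z :=
      DirectSum.lof_apply _ _ _
    rw [h1, h2]
    change (z : Q.CompletedAlgebra k) * Q.ν k ε (Q.e k (v x)) = z
    rw [ν_e, (Q.mem_PCirc.1 z.2).1]
  · have h1 : (DirectSum.lof (Q.CompletedAlgebra k) X (fun x => Q.P k (v x)) x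
        (Q.eP k (v x))) y = 0 := DirectSum.of_eq_of_ne _ _ _ (Ne.symm h)
    have h2 : (DirectSum.lof (Q.CompletedAlgebra k) X (fun x => Q.PCirc k (v x)) x z) y = 0 :=
      DirectSum.of_eq_of_ne _ _ _ (Ne.symm h)
    rw [h1, h2, Submodule.coe_zero, map_zero, mul_zero, Submodule.coe_zero]

theorem sumToTensor_tensorToSum_mk (f : Q.Omega k) (m : M) :
    Q.sumToTensor hε d (Q.tensorToSum hε d (Submodule.Quotient.mk (f ⊗ₜ m))) =
      Submodule.Quotient.mk (f ⊗ₜ m) := by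
  obtain ⟨u, rfl⟩ := d.symm.surjective m
  induction u using DirectSum.induction_on with
  | zero =>
    rw [map_zero, TensorProduct.tmul_zero, Submodule.Quotient.mk_zero, map_zero, map_zero]
  | add u u' hu hu' =>
    rw [map_add, TensorProduct.tmul_add, Submodule.Quotient.mk_add, map_add, map_add, hu, hu']
  | of x z =>
    change Q.sumToTensor hε d (Q.tensorToSum hε d (Submodule.Quotient.mk (f ⊗ₜ d.symm
      (DirectSum.lof (Q.CompletedAlgebra k) X (fun x => Q.P k (v x)) x z)))) =
      Submodule.Quotient.mk (f ⊗ₜ d.symm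
        (DirectSum.lof (Q.CompletedAlgebra k) X (fun x => Q.P k (v x)) x z))
    have h1 : Q.tensorToSum hε d (Submodule.Quotient.mk (f ⊗ₜ d.symm
        (DirectSum.lof (Q.CompletedAlgebra k) X (fun x => Q.P k (v x)) x z))) =
        DirectSum.lof (Q.CompletedAlgebra k) X (fun x => Q.PCirc k (v x)) x
          (Q.mulν ε (Q.ofForm hε f) (v x) z) := by
      change DirectSum.map _ (d (d.symm _)) = _
      rw [LinearEquiv.apply_symm_apply]
      exact DirectSum.map_of _ _ _
    rw [h1, sumToTensor_lof, ← smul_generator]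
    have h2 := Q.ofForm_symm_mul_ν hε f z (Ideal.mul_mem_right _ _ (Q.ofForm hε f).2)
    simp only [coe_mulν, h2]
    rw [Submodule.Quotient.eq, balancedRelations]
    exact Submodule.subset_span ⟨f, z, _, rfl⟩

theorem sumToTensor_tensorToSum (u : BimoduleTensor (Q.CompletedAlgebra k) (Q.Omega k) M) :
    Q.sumToTensor hε d (Q.tensorToSum hε d u) = u := by
  obtain ⟨u, rfl⟩ := Submodule.Quotient.mk_surjective _ u
  induction u using TensorProduct.induction_on with
  | zero => rw [Submodule.Quotient.mk_zero, map_zero, map_zero]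
  | add u u' hu hu' => rw [Submodule.Quotient.mk_add, map_add, map_add, hu, hu']
  | tmul f m => exact Q.sumToTensor_tensorToSum_mk hε d f m

/-- The isomorphism `ω ⊗_A M ≅ ⨁ P_{v(x)}°` for a decomposition `M ≅ ⨁ P_{v(x)}`. -/
def tensorEquiv : BimoduleTensor (Q.CompletedAlgebra k) (Q.Omega k) M
    ≃ₗ[Q.CompletedAlgebra k] ⨁ x, Q.PCirc k (v x) :=
  LinearEquiv.ofLinearMap (Q.tensorToSum hε d) (Q.sumToTensor hε d)
    (LinearMap.ext (Q.tensorToSum_sumToTensor hε d))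
    (LinearMap.ext (Q.sumToTensor_tensorToSum hε d))

end Tensor

open Classical in
theorem entry_eq {M N X Y : Type*} [AddCommGroup M] [Module (Q.CompletedAlgebra k) M]
    [AddCommGroup N] [Module (Q.CompletedAlgebra k) N] {v : X → V} {v' : Y → V}
    (d : M ≃ₗ[Q.CompletedAlgebra k] ⨁ x, Q.P k (v x))
    (d' : N ≃ₗ[Q.CompletedAlgebra k] ⨁ y, Q.P k (v' y))
    (f : M →ₗ[Q.CompletedAlgebra k] N) (x : X) (y : Y) :
    Q.entry k d d' f x y = d' (f (Q.generator d x)) y := rfl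

open Classical in
/-- If `z` lies in the summand of `x`, then `id ⊗ f` sends `ϑ(z) ⊗ e_x` to `ϑ(z) ⊗ f(e_x)`, whose
components are the products `z ν(f(e_x)_y)`. -/
theorem isSignedMatrixMap_tensorEquiv {ε : E → ℤˣ} (hε : Q.IsSignChoice ε) {M N X Y : Type*}
    [AddCommGroup M] [Module (Q.CompletedAlgebra k) M] [AddCommGroup N]
    [Module (Q.CompletedAlgebra k) N] {v : X → V} {v' : Y → V}
    (d : M ≃ₗ[Q.CompletedAlgebra k] ⨁ x, Q.P k (v x))
    (d' : N ≃ₗ[Q.CompletedAlgebra k] ⨁ y, Q.P k (v' y))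
    (f : M →ₗ[Q.CompletedAlgebra k] N) :
    Q.IsSignedMatrixMap k ε (Q.entry k d d' f) ((Q.tensorEquiv hε d').toLinearMap ∘ₗ
      BimoduleTensor.map (Q.CompletedAlgebra k) (Q.Omega k) f ∘ₗ
        (Q.tensorEquiv hε d).symm.toLinearMap) := by
  intro x z y
  have h : (Q.tensorToSum hε d' (BimoduleTensor.map _ _ f (Q.sumToTensor hε d
      (DirectSum.lof (Q.CompletedAlgebra k) X (fun x => Q.PCirc k (v x)) x z))) y :
        Q.CompletedAlgebra k) = z * Q.ν k ε (d' (f (Q.generator d x)) y) := by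
    rw [sumToTensor_lof]
    refine (Q.coe_tensorToSum_mk hε d' _ _ y).trans ?_
    change ((Q.ofForm hε ((Q.ofForm hε).symm ⟨z, _⟩) : Q.vanishIdeal k) : Q.CompletedAlgebra k) *
      _ = _
    rw [LinearEquiv.apply_symm_apply]
    rfl
  rw [entry_eq]
  exact h

end CyclicGentleQuiver

/-! ### Projective modules over semiperfect rings -/

namespace SemiperfectRing

section

variable {A : Type*} [Ring A] {V : Type*} (e : V → A)

/-- A set of submodules that are independent, each isomorphic to one of the left ideals `A e_v`. -/
structure IsPrincipalFamily {M : Type*} [AddCommGroup M] [Module A M]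
    (𝒮 : Set (Submodule A M)) : Prop where
  equiv : ∀ N ∈ 𝒮, ∃ v, Nonempty (N ≃ₗ[A] Submodule.span A {e v})
  indep : sSupIndep 𝒮

variable {e} {M : Type*} [AddCommGroup M] [Module A M]

namespace IsPrincipalFamily

theorem empty : IsPrincipalFamily e (∅ : Set (Submodule A M)) := ⟨by simp, sSupIndep_empty⟩

theorem map {N : Type*} [AddCommGroup N] [Module A N] {𝒮 : Set (Submodule A N)}
    (h : IsPrincipalFamily e 𝒮) (f : N →ₗ[A] M) (hf : Function.Injective f) :
    IsPrincipalFamily e (Submodule.map f '' 𝒮) where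
  equiv := by
    rintro _ ⟨K, hK, rfl⟩
    obtain ⟨v, ⟨g⟩⟩ := h.equiv K hK
    exact ⟨v, ⟨(Submodule.equivMapOfInjective f hf K).symm ≪≫ₗ g⟩⟩
  indep := by
    have h1 := (LinearMap.iSupIndep_map f hf ((sSupIndep_iff _).1 h.indep)).sSupIndep_range
    convert! h1
    ext K
    simp

theorem union {𝒮 𝒯 : Set (Submodule A M)} (hS : IsPrincipalFamily e 𝒮)
    (hT : IsPrincipalFamily e 𝒯) (h : Disjoint (sSup 𝒮) (sSup 𝒯)) :
    IsPrincipalFamily e (𝒮 ∪ 𝒯) where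
  equiv := by
    rintro N (hN | hN)
    · exact hS.equiv N hN
    · exact hT.equiv N hN
  indep := by
    have key : ∀ {𝒮 𝒯 : Set (Submodule A M)}, sSupIndep 𝒮 → Disjoint (sSup 𝒮) (sSup 𝒯) →
        ∀ N ∈ 𝒮, Disjoint N (sSup ((𝒮 ∪ 𝒯) \ {N})) := by
      intro 𝒮 𝒯 hS h N hN
      have h1 : sSup ((𝒮 ∪ 𝒯) \ {N}) ≤ sSup (𝒮 \ {N}) ⊔ sSup 𝒯 := by
        rw [← sSup_union]
        refine sSup_le_sSup ?_
        rintro K ⟨hK | hK, hne⟩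
        · exact Or.inl ⟨hK, hne⟩
        · exact Or.inr hK
      refine Disjoint.mono_right h1 ((hS hN).disjoint_sup_right_of_disjoint_sup_left ?_)
      exact h.mono_left (sup_le (le_sSup hN) (sSup_le_sSup Set.sdiff_subset))
    rintro N (hN | hN)
    · exact key hS.indep h N hN
    · rw [Set.union_comm]
      exact key hT.indep h.symm N hN

theorem iUnion {ι : Type*} {𝒮 : ι → Set (Submodule A M)} (hd : Directed (· ⊆ ·) 𝒮)
    (h : ∀ i, IsPrincipalFamily e (𝒮 i)) : IsPrincipalFamily e (⋃ i, 𝒮 i) where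
  equiv N hN := by
    obtain ⟨i, hi⟩ := Set.mem_iUnion.1 hN
    exact (h i).equiv N hi
  indep := sSupIndep_iUnion_of_directed hd fun i => (h i).indep

end IsPrincipalFamily

/-- An endomorphism of a finitely generated projective module that is the identity modulo the
radical is bijective. -/
theorem bijective_of_sub_mem_jacobson [Module.Finite A M] [Module.Projective A M]
    (h : M →ₗ[A] M) (hh : ∀ x, x - h x ∈ Ring.jacobson A • (⊤ : Submodule A M)) :
    Function.Bijective h := by
  have surj : ∀ g : M →ₗ[A] M, (∀ x, x - g x ∈ Ring.jacobson A • (⊤ : Submodule A M)) →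
      Function.Surjective g := by
    intro g hg
    have h1 : (⊤ : Submodule A (M ⧸ LinearMap.range g)) ≤ Ring.jacobson A • ⊤ := by
      intro c _
      obtain ⟨x, rfl⟩ := Submodule.mkQ_surjective _ c
      have h2 : (LinearMap.range g).mkQ x = (LinearMap.range g).mkQ (x - g x) := by
        have h3 : (LinearMap.range g).mkQ (g x) = 0 :=
          (Submodule.Quotient.mk_eq_zero _).2 (LinearMap.mem_range_self g x)
        rw [map_sub, h3, sub_zero]
      rw [h2]
      have h3 := Submodule.mem_map_of_mem (f := (LinearMap.range g).mkQ) (hg x)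
      rw [Submodule.map_smul'', Submodule.map_top, Submodule.range_mkQ] at h3
      exact h3
    have h4 := Submodule.FG.eq_bot_of_le_jacobson_smul Module.Finite.fg_top h1
    rw [← LinearMap.range_eq_top, ← Submodule.ker_mkQ (LinearMap.range g), LinearMap.ker_eq_top]
    refine LinearMap.ext fun x => ?_
    have : (LinearMap.range g).mkQ x ∈ (⊤ : Submodule A (M ⧸ LinearMap.range g)) := trivial
    rwa [h4, Submodule.mem_bot] at this
  have hs := surj h hh
  obtain ⟨s, hs'⟩ := Module.projective_lifting_property h LinearMap.id hs
  have hs1 : ∀ x, h (s x) = x := fun x => LinearMap.congr_fun hs' x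
  have hs2 := surj s fun x => by
    have := Submodule.neg_mem _ (hh (s x))
    rwa [neg_sub, hs1] at this
  refine ⟨?_, hs⟩
  intro x y hxy
  obtain ⟨x, rfl⟩ := hs2 x
  obtain ⟨y, rfl⟩ := hs2 y
  rw [hs1, hs1] at hxy
  rw [hxy]

theorem mem_jacobson_smul_top {κ : Type*} [Fintype κ] {u : κ → A}
    (hu : ∀ l, u l ∈ Ring.jacobson A) : u ∈ Ring.jacobson A • (⊤ : Submodule A (κ → A)) := by
  classical
  rw [pi_eq_sum_univ' u]
  exact Submodule.sum_mem _ fun l _ => Submodule.smul_mem_smul (hu l) trivial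

/-- If elements `w_j` of `M` and linear forms `f_l` are dual to each other modulo the radical, then
the `w_j` generate a direct summand of `M`, which is the direct sum of the modules `A w_j`. -/
theorem exists_summand_of_dual (he : ∀ v, e v * e v = e v) {κ : Type*} [Fintype κ] [DecidableEq κ]
    (v : κ → V) (f : κ → M →ₗ[A] A) (w : κ → M)
    (hf : ∀ j m, f j m * e (v j) = f j m) (hw : ∀ j, e (v j) • w j = w j)
    (hJ : ∀ l j, (if l = j then e (v l) else 0) - f l (w j) ∈ Ring.jacobson A) :
    ∃ 𝒯 : Set (Submodule A M), IsPrincipalFamily e 𝒯 ∧ (∀ j, w j ∈ sSup 𝒯) ∧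
      ∃ K, IsCompl (sSup 𝒯) K := by
  let W : (κ → A) →ₗ[A] M := Fintype.linearCombination A w
  have hW : ∀ a, W a = ∑ j, a j • w j := fun a => rfl
  -- the identity on the coordinates `a (1 - e)` is added to obtain an endomorphism of `A ^ κ`
  let h : (κ → A) →ₗ[A] (κ → A) :=
    (LinearMap.pi f).comp W + LinearMap.pi fun l =>
      (LinearMap.toSpanSingleton A A (1 - e (v l))).comp (LinearMap.proj l)
  have hh : ∀ a l, h a l = f l (W a) + a l * (1 - e (v l)) := fun a l => rfl
  have hbij : Function.Bijective h := by
    refine bijective_of_sub_mem_jacobson h fun a => mem_jacobson_smul_top fun l => ?_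
    have : (a - h a) l = ∑ j, a j * ((if l = j then e (v l) else 0) - f l (w j)) := by
      simp only [Pi.sub_apply, hh, hW, map_sum, map_smul, smul_eq_mul, mul_sub, mul_ite, mul_zero,
        mul_one, Finset.sum_sub_distrib, Finset.sum_ite_eq, Finset.mem_univ, if_true]
      abel
    rw [this]
    exact Submodule.sum_mem _ fun j _ => Submodule.smul_mem _ (a j) (hJ l j)
  have hhom : ∀ a, (∀ j, a j * e (v j) = a j) → ∀ l, h a l = f l (W a) := by
    intro a ha l
    rw [hh, mul_sub, mul_one, ha, sub_self, add_zero]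
  have hinj : ∀ a, (∀ j, a j * e (v j) = a j) → (∀ l, f l (W a) = 0) → a = 0 := by
    intro a ha h0
    refine hbij.1 ?_
    rw [map_zero]
    ext l
    rw [hhom a ha, h0]; rfl
  let p : κ → Submodule A M := fun j => Submodule.span A {w j}
  have hp : ∀ j x, x ∈ p j → ∃ a, a * e (v j) = a ∧ a • w j = x := by
    intro j x hx
    obtain ⟨a, rfl⟩ := Submodule.mem_span_singleton.1 hx
    exact ⟨a * e (v j), by rw [mul_assoc, he], by rw [mul_smul, hw]⟩
  have hsum : ∀ x ∈ ⨆ j, p j, ∃ a : κ → A, (∀ j, a j * e (v j) = a j) ∧ W a = x := by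
    intro x hx
    obtain ⟨y, hy, rfl⟩ := (Submodule.mem_iSup_iff_exists_finsupp p x).1 hx
    choose a ha ha' using fun j => hp j (y j) (hy j)
    refine ⟨a, ha, ?_⟩
    rw [hW, Finset.sum_congr rfl fun j _ => ha' j, Finsupp.sum_fintype _ _ fun _ => rfl]
  have hind : iSupIndep p := by
    rw [iSupIndep_iff_finsetSum_eq_zero_imp_eq_zero]
    intro s y hy hy0 i hi
    have hy' : ∀ j, ∃ a, a * e (v j) = a ∧ a • w j = if j ∈ s then y j else 0 := by
      intro j
      by_cases hj : j ∈ s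
      · rw [if_pos hj]; exact hp j (y j) (hy j hj)
      · exact ⟨0, by simp, by simp [hj]⟩
    choose a ha ha' using hy'
    have h0 : W a = 0 := by
      rw [hW, Finset.sum_congr rfl fun j _ => ha' j]
      simpa using hy0
    have h1 := hinj a ha fun l => by rw [h0, map_zero]
    have h2 := ha' i
    rw [h1, if_pos hi] at h2
    simpa using h2.symm
  have hsup : sSup (Set.range p) = ⨆ j, p j := sSup_range
  refine ⟨Set.range p, ⟨?_, hind.sSupIndep_range⟩, fun j => ?_, ⨅ l, LinearMap.ker (f l), ?_⟩
  · rintro _ ⟨j, rfl⟩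
    refine ⟨v j, ⟨?_⟩⟩
    let g : Submodule.span A {e (v j)} →ₗ[A] M :=
      (LinearMap.toSpanSingleton A M (w j)).comp (Submodule.subtype _)
    have hg : ∀ z, g z = (z : A) • w j := fun z => rfl
    have hz : ∀ z ∈ Submodule.span A {e (v j)}, z * e (v j) = z := by
      intro z hz
      obtain ⟨a, rfl⟩ := Submodule.mem_span_singleton.1 hz
      rw [smul_eq_mul, mul_assoc, he]
    have hgi : Function.Injective g := by
      rw [injective_iff_map_eq_zero]
      intro z hz0
      have h1 : W (Pi.single j (z : A)) = 0 := by
        rw [← hz0, hg, hW, Finset.sum_eq_single j]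
        · simp
        · intro i _ hi; simp [hi]
        · simp
      have h2 := hinj (Pi.single j (z : A)) (fun i => by
        by_cases hi : i = j
        · subst hi; simpa using hz _ z.2
        · simp [hi]) fun l => by rw [h1, map_zero]
      exact Subtype.ext (by simpa using congrFun h2 j)
    have hr : LinearMap.range g = p j := by
      refine le_antisymm ?_ ?_
      · rintro _ ⟨z, rfl⟩
        exact Submodule.smul_mem _ _ (Submodule.mem_span_singleton_self _)
      · rw [Submodule.span_singleton_le_iff_mem]
        exact ⟨⟨e (v j), Submodule.mem_span_singleton_self _⟩, hw j⟩
    exact ((LinearEquiv.ofInjective g hgi) ≪≫ₗ LinearEquiv.ofEq _ _ hr).symm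
  · rw [hsup]
    exact Submodule.mem_iSup_of_mem j (Submodule.mem_span_singleton_self _)
  · rw [hsup]
    constructor
    · rw [Submodule.disjoint_def]
      intro x hx hx'
      obtain ⟨a, ha, rfl⟩ := hsum x hx
      rw [Submodule.mem_iInf] at hx'
      rw [hinj a ha hx', map_zero]
    · rw [codisjoint_iff_le_sup]
      intro m _
      obtain ⟨a, ha⟩ := hbij.2 (LinearMap.pi f m)
      have ha' : ∀ j, a j * e (v j) = a j := by
        intro j
        have h1 := congrFun ha j
        rw [hh, LinearMap.pi_apply] at h1
        have h2 : ∀ x, f j x * (1 - e (v j)) = 0 := fun x => by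
          rw [mul_sub, mul_one, hf, sub_self]
        have h3 : (1 - e (v j)) * (1 - e (v j)) = 1 - e (v j) := by
          rw [mul_sub, mul_one, sub_mul, one_mul, he, sub_self, sub_zero]
        have h4 := congrArg (· * (1 - e (v j))) h1
        simp only [add_mul, h2, zero_add] at h4
        rw [mul_assoc, h3, mul_sub, mul_one] at h4
        exact (sub_eq_zero.1 h4).symm
      rw [← add_sub_cancel (W a) m]
      refine Submodule.add_mem_sup ?_ ?_
      · rw [hW]
        exact Submodule.sum_mem _ fun j _ => Submodule.smul_mem _ _
          (Submodule.mem_iSup_of_mem j (Submodule.mem_span_singleton_self _))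
      · rw [Submodule.mem_iInf]
        intro l
        rw [LinearMap.mem_ker, map_sub, ← hhom a ha', ha]
        exact sub_self _

end

section

variable {A : Type*} [Ring A] {V : Type*}

/-- Idempotents `e_v` with sum `1` such that each element of `e_v A e_w` outside the radical has a
right inverse in `e_w A e_v`. If the `e_v` are orthogonal, this means that they are local or
zero. -/
structure IsLocalDecomposition [Fintype V] (e : V → A) : Prop where
  idem : ∀ v, e v * e v = e v
  sum : ∑ v, e v = 1
  inverse : ∀ {v w : V} {a : A}, e v * a * e w = a → a ∉ Ring.jacobson A →
    ∃ b, e w * b * e v = b ∧ a * b = e v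

variable [Fintype V] {e : V → A} (he : IsLocalDecomposition e)
include he

/-- Each expression `x = ∑ f_j(x) w_j` can be shortened until the elements `w_j` and the linear
forms `f_j` are dual to each other modulo the radical. -/
theorem exists_summand_of_eq_sum {M : Type*} [AddCommGroup M] [Module A M] {x : M} (n : ℕ)
    (v : Fin n → V) (f : Fin n → M →ₗ[A] A) (w : Fin n → M)
    (hf : ∀ j m, f j m * e (v j) = f j m) (hw : ∀ j, e (v j) • w j = w j)
    (hx : x = ∑ j, f j x • w j) :
    ∃ 𝒯 : Set (Submodule A M), IsPrincipalFamily e 𝒯 ∧ x ∈ sSup 𝒯 ∧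
      ∃ K, IsCompl (sSup 𝒯) K := by
  induction n with
  | zero =>
    refine ⟨∅, .empty, ?_, ⊤, ?_⟩
    · rw [hx]; simp
    · rw [sSup_empty]; exact isCompl_bot_top
  | succ n ih =>
    by_cases hJ : ∀ l j, (if l = j then e (v l) else 0) - f l (w j) ∈ Ring.jacobson A
    · obtain ⟨𝒯, h1, h2, h3⟩ := exists_summand_of_dual he.idem v f w hf hw hJ
      refine ⟨𝒯, h1, ?_, h3⟩
      rw [hx]
      exact Submodule.sum_mem _ fun j _ => Submodule.smul_mem _ _ (h2 j)
    · push Not at hJ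
      obtain ⟨l, i, hc⟩ := hJ
      let d : Fin (n + 1) → A := fun j => (if l = j then e (v l) else 0) - f l (w j)
      have hd : ∀ j, e (v j) * d j * e (v l) = d j := by
        intro j
        have h1 : f l (w j) = e (v j) * f l (w j) := by
          rw [← smul_eq_mul, ← map_smul, hw]
        simp only [d]
        rw [mul_sub, sub_mul, ← h1, hf]
        split_ifs with h
        · subst h; rw [he.idem, he.idem]
        · simp
      have hrel : ∑ j, f j x * d j = 0 := by
        have h1 : f l x = ∑ j, f j x * f l (w j) := by
          conv_lhs => rw [hx]
          simp
        simp only [d, mul_sub, mul_ite, mul_zero, Finset.sum_sub_distrib, Finset.sum_ite_eq,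
          Finset.mem_univ, if_true]
        rw [hf, ← h1, sub_self]
      obtain ⟨b, hb, hdb⟩ := he.inverse (hd i) hc
      -- the relation `∑ f_j(x) d_j = 0` expresses `f_i(x)` by the other coefficients
      have hi : f i x = -∑ j, f (i.succAbove j) x * (d (i.succAbove j) * b) := by
        have h1 := congrArg (· * b) hrel
        simp only [Finset.sum_mul, zero_mul, mul_assoc] at h1
        rw [Fin.sum_univ_succAbove _ i, hdb, hf] at h1
        exact eq_neg_of_add_eq_zero_left h1
      refine ih (fun j => v (i.succAbove j)) (fun j => f (i.succAbove j))
        (fun j => w (i.succAbove j) - (d (i.succAbove j) * b) • w i) (fun j => hf _)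
        (fun j => ?_) ?_
      · have h1 : e (v (i.succAbove j)) * d (i.succAbove j) = d (i.succAbove j) := by
          rw [← hd, ← mul_assoc, ← mul_assoc, he.idem]
        rw [smul_sub, hw, ← mul_smul, ← mul_assoc, h1]
      · conv_lhs => rw [hx]
        rw [Fin.sum_univ_succAbove _ i, hi, neg_smul, Finset.sum_smul]
        simp only [smul_sub, Finset.sum_sub_distrib, mul_smul]
        abel

/-- Each element of a projective module lies in a direct summand that is a finite direct sum of
modules `A e_v`. -/
theorem exists_summand {M : Type*} [AddCommGroup M] [Module A M] [Module.Projective A M] (x : M) :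
    ∃ 𝒯 : Set (Submodule A M), IsPrincipalFamily e 𝒯 ∧ x ∈ sSup 𝒯 ∧
      ∃ K, IsCompl (sSup 𝒯) K := by
  obtain ⟨s, hs⟩ := Module.projective_def'.1 (inferInstance : Module.Projective A M)
  let κ := (s x).support × V
  let g := (Fintype.equivFin κ).symm
  have hx : x = ∑ q : κ, (s x q.1 * e q.2) • e q.2 • (q.1 : M) := by
    have h1 : ∀ i : M, ∑ v, (s x i * e v) • e v • i = s x i • i := fun i => by
      simp only [← mul_smul, mul_assoc, he.idem]
      rw [← Finset.sum_smul, ← Finset.mul_sum, he.sum, mul_one]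
    rw [Fintype.sum_prod_type]
    simp only [h1]
    rw [Finset.sum_coe_sort (s x).support fun i => s x i • i]
    exact (LinearMap.congr_fun hs x).symm
  refine exists_summand_of_eq_sum he (Fintype.card κ) (fun j => (g j).2)
    (fun j => (LinearMap.toSpanSingleton A A (e (g j).2)).comp ((Finsupp.lapply (g j).1.1).comp s))
    (fun j => e (g j).2 • ((g j).1 : M)) (fun j m => ?_) (fun j => ?_) ?_
  · simp [mul_assoc, he.idem]
  · rw [← mul_smul, he.idem]
  · conv_lhs => rw [hx]
    exact (g.sum_comp fun q : κ => (s x q.1 * e q.2) • e q.2 • (q.1 : M)).symm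

/-- A countably generated projective module is a direct sum of modules `A e_v`: summands are split
off one after the other so that they exhaust the generators. -/
theorem exists_family_of_countable {M : Type*} [AddCommGroup M] [Module A M]
    [Module.Projective A M] (x : ℕ → M) (hx : Submodule.span A (Set.range x) = ⊤) :
    ∃ 𝒯 : Set (Submodule A M), IsPrincipalFamily e 𝒯 ∧ sSup 𝒯 = ⊤ := by
  let T := {𝒮 : Set (Submodule A M) // IsPrincipalFamily e 𝒮 ∧ ∃ K, IsCompl (sSup 𝒮) K}
  have step : ∀ (𝒮 : T) (y : M), ∃ 𝒮' : T, 𝒮.1 ⊆ 𝒮'.1 ∧ y ∈ sSup 𝒮'.1 := by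
    rintro ⟨𝒮, hS, K, hK⟩ y
    have : Module.Projective A K := .of_split K.subtype (Submodule.projectionOnto K _ hK.symm)
      (LinearMap.ext fun z => by simp)
    have hy : y ∈ sSup 𝒮 ⊔ K := hK.sup_eq_top ▸ Submodule.mem_top
    obtain ⟨l, hl, z, hz, rfl⟩ := Submodule.mem_sup.1 hy
    obtain ⟨𝒯, hT, hzT, L, hL⟩ := exists_summand he (⟨z, hz⟩ : K)
    have hsup : sSup (Submodule.map K.subtype '' 𝒯) = (sSup 𝒯).map K.subtype := by
      rw [sSup_image, sSup_eq_iSup, Submodule.map_iSup]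
      simp only [Submodule.map_iSup]
    have hle : sSup (Submodule.map K.subtype '' 𝒯) ≤ K := hsup ▸ Submodule.map_subtype_le _ _
    have hdis : Disjoint (sSup (Submodule.map K.subtype '' 𝒯)) (L.map K.subtype) := by
      rw [hsup, disjoint_iff, ← Submodule.map_inf _ K.injective_subtype, hL.inf_eq_bot,
        Submodule.map_bot]
    have hcov : sSup (Submodule.map K.subtype '' 𝒯) ⊔ L.map K.subtype = K := by
      rw [hsup, ← Submodule.map_sup, hL.sup_eq_top, Submodule.map_top, Submodule.range_subtype]
    refine ⟨⟨𝒮 ∪ Submodule.map K.subtype '' 𝒯, hS.union (hT.map _ K.injective_subtype)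
      (hK.disjoint.mono_right hle), L.map K.subtype, ?_⟩, Set.subset_union_left, ?_⟩
    · rw [sSup_union]
      exact hdis.isCompl_sup_left_of_isCompl_sup_right (hcov.symm ▸ hK)
    · simp only
      rw [sSup_union]
      refine Submodule.add_mem_sup hl ?_
      rw [hsup]
      exact ⟨⟨z, hz⟩, hzT, rfl⟩
  choose next hnext hmem using step
  let 𝒮 : ℕ → T := fun n => Nat.rec ⟨∅, .empty, ⊤, by rw [sSup_empty]; exact isCompl_bot_top⟩
    (fun n 𝒮 => next 𝒮 (x n)) n
  have hmono : Monotone fun n => (𝒮 n).1 := monotone_nat_of_le_succ fun n => hnext (𝒮 n) (x n)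
  refine ⟨⋃ n, (𝒮 n).1, .iUnion hmono.directed_le fun n => (𝒮 n).2.1, ?_⟩
  rw [eq_top_iff, ← hx, Submodule.span_le]
  rintro _ ⟨n, rfl⟩
  have h := sSup_le_sSup (Set.subset_iUnion (fun n => (𝒮 n).1) (n + 1))
  exact h (hmem (𝒮 n) (x n))

omit he in
/-- If finitely many elements are attached to each element of a set, each element lies in a
countable subset that contains, with an element, those attached to it. -/
theorem exists_countable_closed {M : Type*} (supp : M → Finset M) (x : M) :
    ∃ T : Set M, T.Countable ∧ x ∈ T ∧ ∀ i ∈ T, (supp i : Set M) ⊆ T := by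
  let T : ℕ → Set M := fun n => Nat.rec {x} (fun _ S => ⋃ i ∈ S, (supp i : Set M)) n
  have hT : ∀ n, (T n).Countable := by
    intro n
    induction n with
    | zero => exact Set.countable_singleton x
    | succ n ih => exact ih.biUnion fun i _ => (supp i).countable_toSet
  refine ⟨⋃ n, T n, Set.countable_iUnion hT, Set.mem_iUnion.2 ⟨0, rfl⟩, fun i hi j hj => ?_⟩
  obtain ⟨n, hn⟩ := Set.mem_iUnion.1 hi
  exact Set.mem_iUnion.2 ⟨n + 1, Set.mem_biUnion hn hj⟩

/-- The analogue of Kaplansky's theorem: each projective module is the direct sum of a family of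
submodules isomorphic to modules `A e_v`. A section `s` of the map from the free module on `M` to
`M` makes the span of each set that is closed under taking the supports of `s` a direct summand;
along such sets, the family is extended by countably generated summands. -/
theorem exists_family {M : Type*} [AddCommGroup M] [Module A M] [Module.Projective A M] :
    ∃ 𝒯 : Set (Submodule A M), IsPrincipalFamily e 𝒯 ∧ sSup 𝒯 = ⊤ := by
  classical
  obtain ⟨s, hs⟩ := Module.projective_def'.1 (inferInstance : Module.Projective A M)
  let closed : Set M → Prop := fun S => ∀ i ∈ S, ((s i).support : Set M) ⊆ S
  let r : Set M → M →ₗ[A] M := fun S =>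
    (Finsupp.linearCombination A (fun i : M => if i ∈ S then i else 0)).comp s
  have hr_mem : ∀ S m, r S m ∈ Submodule.span A S := by
    intro S m
    change Finsupp.linearCombination A _ (s m) ∈ _
    rw [Finsupp.linearCombination_apply, Finsupp.sum]
    refine Submodule.sum_mem _ fun i _ => Submodule.smul_mem _ _ ?_
    split_ifs with h
    · exact Submodule.subset_span h
    · exact Submodule.zero_mem _
  have hr_id : ∀ S, closed S → ∀ m ∈ Submodule.span A S, r S m = m := by
    intro S hS m hm
    induction hm using Submodule.span_induction with
    | mem m hm =>
      have h1 : Finsupp.linearCombination A id (s m) = m := LinearMap.congr_fun hs m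
      conv_rhs => rw [← h1]
      change Finsupp.linearCombination A _ (s m) = _
      rw [Finsupp.linearCombination_apply, Finsupp.linearCombination_apply, Finsupp.sum,
        Finsupp.sum]
      refine Finset.sum_congr rfl fun i hi => ?_
      rw [if_pos (hS m hm hi)]; rfl
    | zero => rw [map_zero]
    | add m m' _ _ h h' => rw [map_add, h, h']
    | smul a m _ h => rw [map_smul, h]
  let 𝒵 : Set (Set M × Set (Submodule A M)) :=
    {p | closed p.1 ∧ IsPrincipalFamily e p.2 ∧ sSup p.2 = Submodule.span A p.1}
  obtain ⟨⟨S, 𝒮⟩, ⟨hS, h𝒮, hsup⟩, hmax⟩ : ∃ p, Maximal (· ∈ 𝒵) p := by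
    refine zorn_le₀ 𝒵 fun c hc hchain => ?_
    refine ⟨(⋃ p : c, p.1.1, ⋃ p : c, p.1.2), ⟨?_, ?_, ?_⟩, fun p hp => ⟨?_, ?_⟩⟩
    · intro i hi
      obtain ⟨p, hp⟩ := Set.mem_iUnion.1 hi
      exact ((hc p.2).1 i hp).trans (Set.subset_iUnion (fun p : c => p.1.1) p)
    · refine .iUnion (fun p q => ?_) fun p => (hc p.2).2.1
      rcases hchain.total p.2 q.2 with h | h
      · exact ⟨q, h.2, subset_rfl⟩
      · exact ⟨p, subset_rfl, h.2⟩
    · rw [Submodule.span_iUnion]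
      simp only [sSup_iUnion]
      exact iSup_congr fun p => (hc p.2).2.2
    · exact Set.subset_iUnion (fun p : c => p.1.1) ⟨p, hp⟩
    · exact Set.subset_iUnion (fun p : c => p.1.2) ⟨p, hp⟩
  suffices h : S = Set.univ by
    exact ⟨𝒮, h𝒮, by rw [hsup, h, Submodule.span_univ]⟩
  by_contra hne
  obtain ⟨x, hx⟩ := (Set.ne_univ_iff_exists_notMem S).1 hne
  obtain ⟨T', hT'c, hxT', hT'⟩ := exists_countable_closed (fun i => (s i).support) x
  obtain ⟨t, rfl⟩ := hT'c.exists_eq_range ⟨x, hxT'⟩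
  set T := S ∪ Set.range t with hT_def
  have hT : closed T := by
    rintro i (hi | hi)
    · exact (hS i hi).trans Set.subset_union_left
    · exact (hT' i hi).trans Set.subset_union_right
  have hST : Submodule.span A S ≤ Submodule.span A T := Submodule.span_mono Set.subset_union_left
  set K := Submodule.span A T ⊓ LinearMap.ker (r S) with hK_def
  -- the projection onto the complement `K` of the span of `S` in the span of `T`
  have hproj : ∀ z ∈ Submodule.span A T, z - r S z ∈ K := by
    intro z hz
    refine ⟨Submodule.sub_mem _ hz (hST (hr_mem S z)), ?_⟩
    rw [SetLike.mem_coe, LinearMap.mem_ker, map_sub, hr_id S hS _ (hr_mem S z), sub_self]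
  have : Module.Projective A K := by
    refine .of_split K.subtype
      (((LinearMap.id - r S).comp (r T)).codRestrict K fun m => hproj _ (hr_mem T m)) ?_
    refine LinearMap.ext fun z => Subtype.ext ?_
    change r T z - r S (r T z) = z
    rw [hr_id T hT _ z.2.1, LinearMap.mem_ker.1 z.2.2, sub_zero]
  have htT : ∀ n, t n ∈ Submodule.span A T := fun n =>
    Submodule.subset_span (Or.inr ⟨n, rfl⟩)
  obtain ⟨𝒯, h𝒯, h𝒯top⟩ := exists_family_of_countable he
    (fun n => (⟨t n - r S (t n), hproj _ (htT n)⟩ : K)) (by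
      rw [eq_top_iff]
      rintro ⟨z, hz⟩ -
      have key : ∀ z ∈ Submodule.span A T, z - r S z ∈ (Submodule.span A (Set.range fun n =>
          (⟨t n - r S (t n), hproj _ (htT n)⟩ : K))).map K.subtype := by
        intro z hz
        induction hz using Submodule.span_induction with
        | mem z hz =>
          rcases hz with hz | ⟨n, rfl⟩
          · rw [hr_id S hS z (Submodule.subset_span hz), sub_self]
            exact Submodule.zero_mem _
          · exact ⟨_, Submodule.subset_span ⟨n, rfl⟩, rfl⟩
        | zero => rw [map_zero, sub_zero]; exact Submodule.zero_mem _
        | add z z' _ _ h h' =>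
          rw [map_add, add_sub_add_comm]; exact Submodule.add_mem _ h h'
        | smul a z _ h => rw [map_smul, ← smul_sub]; exact Submodule.smul_mem _ _ h
      obtain ⟨y, hy, hyz⟩ := key z hz.1
      rw [LinearMap.mem_ker.1 hz.2, sub_zero] at hyz
      rwa [show (⟨z, hz⟩ : K) = y from Subtype.ext hyz.symm])
  have hsupK : sSup (Submodule.map K.subtype '' 𝒯) = K := by
    have h1 : sSup (Submodule.map K.subtype '' 𝒯) = (sSup 𝒯).map K.subtype := by
      rw [sSup_image, sSup_eq_iSup, Submodule.map_iSup]
      simp only [Submodule.map_iSup]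
    rw [h1, h𝒯top, Submodule.map_top, Submodule.range_subtype]
  have hdis : Disjoint (Submodule.span A S) K := by
    rw [Submodule.disjoint_def]
    intro z hz hz'
    rw [← hr_id S hS z hz]
    exact hz'.2
  have hnew : (T, 𝒮 ∪ Submodule.map K.subtype '' 𝒯) ∈ 𝒵 := by
    refine ⟨hT, h𝒮.union (h𝒯.map _ K.injective_subtype) ?_, ?_⟩
    · rw [hsup, hsupK]; exact hdis
    · rw [sSup_union, hsup, hsupK]
      refine le_antisymm (sup_le hST inf_le_left) fun z hz => ?_
      rw [← add_sub_cancel (r S z) z]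
      exact Submodule.add_mem_sup (hr_mem S z) (hproj z hz)
  have hle : T ≤ S := (hmax hnew ⟨Set.subset_union_left, Set.subset_union_left⟩).1
  exact hx (hle (Or.inr hxT'))

/-- Each projective module is isomorphic to a direct sum of modules `A e_v`. -/
theorem exists_equiv_directSum {M : Type w} [AddCommGroup M] [Module A M]
    [Module.Projective A M] : ∃ (X : Type w) (v : X → V),
      Nonempty (M ≃ₗ[A] ⨁ x, Submodule.span A {e (v x)}) := by
  classical
  obtain ⟨𝒯, h𝒯, htop⟩ := exists_family he (M := M)
  choose v g using fun N : 𝒯 => h𝒯.equiv N N.2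
  have hint : DirectSum.IsInternal fun N : 𝒯 => (N : Submodule A M) :=
    DirectSum.isInternal_submodule_of_iSupIndep_of_iSup_eq_top ((sSupIndep_iff _).1 h𝒯.indep)
      (by rw [← sSup_eq_iSup', htop])
  exact ⟨𝒯, v, ⟨(LinearEquiv.ofBijective (DirectSum.coeLinearMap _) hint).symm ≪≫ₗ
    DFinsupp.mapRange.linearEquiv fun N => (g N).some⟩⟩

end

end SemiperfectRing

namespace CyclicGentleQuiver

variable {V E : Type*} (Q : CyclicGentleQuiver V E)
variable {k : Type*} [Field k] [Fintype V] [Fintype E]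

variable (k) in
theorem isLocalDecomposition_e : SemiperfectRing.IsLocalDecomposition (Q.e k) where
  idem := Q.e_mul_e_self
  sum := Q.sum_e
  inverse := Q.exists_corner_inverse

end CyclicGentleQuiver

end

theorem mainTheorem8 {k V E : Type*} [Field k] [Fintype V] [Fintype E]
    (Q : CyclicGentleQuiver V E) (ε : E → ℤˣ) (hε : Q.IsSignChoice ε) :
    -- the elements `e_i`, `α_n`, `c_β` form a basis of `A` over `k⟦c⟧`
    (∃ b : Module.Basis (Q.BasisIndex ε) k⟦X⟧ (Q.CompletedAlgebra k),
      (∀ q, b q = Q.basisElement k ε q) ∧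
      -- there is a left linear isomorphism `ϑ` with the prescribed values, and it is bilinear
      ∃ ϑ : Q.circ k ε ≃ₗ[Q.CompletedAlgebra k] Q.Omega k,
        Q.HasThetaValues k b ϑ.toLinearMap ∧
        (∀ ϑ' : Q.circ k ε →ₗ[Q.CompletedAlgebra k] Q.Omega k,
          Q.HasThetaValues k b ϑ' → ϑ' = ϑ.toLinearMap) ∧
        ∀ (x : Q.circ k ε) (y : (Q.CompletedAlgebra k)ᵐᵒᵖ), ϑ (y • x) = y • ϑ x) ∧
    -- as a left module, `A°` is the internal direct sum of the modules `P_i` (`i` regular) and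
    -- `rad P_j` (`j` transition)
    (iSupIndep (Q.PCirc k) ∧
      (Q.circ k ε).map (TwistedBimodule.equiv (Q.ν k ε)).toLinearMap = ⨆ i, Q.PCirc k i) ∧
    -- complexes of projective modules
    ∀ C : CochainComplex (ModuleCat.{w} (Q.CompletedAlgebra k)) ℤ,
      (∀ n, Module.Projective (Q.CompletedAlgebra k) (C.X n)) →
      (∀ n, ∃ (X : Type w) (v : X → V),
        Nonempty (C.X n ≃ₗ[Q.CompletedAlgebra k] ⨁ x, Q.P k (v x))) ∧
      ∀ (X : ℤ → Type w) (v : ∀ n, X n → V)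
        (d : ∀ n, C.X n ≃ₗ[Q.CompletedAlgebra k] ⨁ x, Q.P k (v n x)),
        ∃ (D : ∀ n, (⨁ x, Q.PCirc k (v n x)) →ₗ[Q.CompletedAlgebra k]
            ⨁ x, Q.PCirc k (v (n + 1) x))
          (Θ : ∀ n, BimoduleTensor (Q.CompletedAlgebra k) (Q.Omega k) (C.X n)
            ≃ₗ[Q.CompletedAlgebra k] ⨁ x, Q.PCirc k (v n x)),
          ∀ n,
            Q.IsSignedMatrixMap k ε (Q.entry k (d n) (d (n + 1)) (C.d n (n + 1)).hom) (D n) ∧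
            (Θ (n + 1)).toLinearMap ∘ₗ BimoduleTensor.map (Q.CompletedAlgebra k) (Q.Omega k)
              (C.d n (n + 1)).hom = D n ∘ₗ (Θ n).toLinearMap := by
  classical
  refine ⟨⟨Q.basis hε, Q.basis_apply hε, Q.theta hε, Q.hasThetaValues_theta hε,
    fun ϑ' h => Q.eq_theta_of_hasThetaValues hε h, Q.theta_op_smul hε⟩,
    ⟨Q.iSupIndep_PCirc, by rw [Q.map_circ, Q.iSup_PCirc]⟩, fun C hC =>
      ⟨fun n => ?_, fun X v d => ?_⟩⟩
  · have := hC n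
    exact SemiperfectRing.exists_equiv_directSum (Q.isLocalDecomposition_e k)
  · refine ⟨fun n => (Q.tensorEquiv hε (d (n + 1))).toLinearMap ∘ₗ
        BimoduleTensor.map (Q.CompletedAlgebra k) (Q.Omega k) (C.d n (n + 1)).hom ∘ₗ
          (Q.tensorEquiv hε (d n)).symm.toLinearMap, fun n => Q.tensorEquiv hε (d n),
      fun n => ⟨?_, ?_⟩⟩
    · exact Q.isSignedMatrixMap_tensorEquiv hε (d n) (d (n + 1)) (C.d n (n + 1)).hom
    · refine LinearMap.ext fun u => ?_
      simp only [LinearMap.comp_apply, LinearEquiv.coe_coe, LinearEquiv.symm_apply_apply]
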